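/- Let $G=(V,A)$ be a finite digraph whose arc set $A=A^{\mathrm{fix}}\,\dot\cup\,A^{\mathrm{free}}$ is partitioned into fixed and free arcs, with capacities $u:A\to\mathbb Z_{\ge 0}$, costs $c:A\to\mathbb Z_{\ge 0}$, and, for every scenario $\lambda$ of a finite non-empty set $\Lambda$, balances $b^\lambda:V\to\mathbb Z$ with $\sum_{v\in V}b^\lambda(v)=0$. A $b^\lambda$-flow is a function $f^\lambda:A\to\mathbb Z_{\ge 0}$ with $f^\lambda(a)\le u(a)$ for all $a\in A$ and $\sum_{a=(v,w)\in A}f^\lambda(a)-\sum_{a=(w,v)\in A}f^\lambda(a)=b^\lambda(v)$ for all $v\in V$; its cost is $c(f^\lambda)=\sum_{a\in A}c(a)f^\lambda(a)$. A robust $\boldsymbol b$-flow is a tuple $\boldsymbol f=(f^\lambda)_{\lambda\in\Lambda}$ of $b^\lambda$-flows with $f^\lambda(a)=f^{\lambda'}(a)$ for all $a\in A^{\mathrm{fix}}$ and $\lambda,\lambda'\in\Lambda$; its cost is $\max_{\lambda\in\Lambda}c(f^\lambda)$. Let a load $\ell:A^{\mathrm{fix}}\to\mathbb Z_{\ge 0}$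 be given as part of the input. (i) There is an algorithm that, given $(G,A^{\mathrm{fix}},u,c,\boldsymbol b,\ell)$ with all numbers in binary, computes in time polynomial in the size of the input a robust $\boldsymbol b$-flow of minimum cost among all robust $\boldsymbol b$-flows that satisfy $f^\lambda(a)=\ell(a)$ for all $a\in A^{\mathrm{fix}}$ and $\lambda\in\Lambda$, or reports that there is no such robust $\boldsymbol b$-flow. (ii) For $\lambda\in\Lambda$ let $\widetilde{\mathcal I}^\lambda$ be the minimum cost flow instance obtained by deleting the fixed arcs from $G$ and replacing $b^\lambda$ by $$\tilde b^\lambda(v)=b^\lambda(v)+\sum_{a=(w,v)\in A^{\mathrm{fix}}}\ell(a)-\sum_{a=(v,w)\in A^{\mathrm{fix}}}\ell(a).$$ A robust $\boldsymbol b$-flow with load $\ell$ on the fixed arcs exists if and only if $\ell(a)\le u(a)$ for all $a\in A^{\mathrm{fix}}$ and every $\widetilde{\mathcal I}^\lambda$ has a feasible flow. If $\ell\le u$ on $A^{\mathrm{fix}}$ and $\tilde f^\lambda$ is a minimum cost flow of $\widetilde{\mathcal I}^\lambda$ for every $\lambda\in\Lambda$, then the tuple $\boldsymbol f$ with $f^\lambda=\ell$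 on $A^{\mathrm{fix}}$ and $f^\lambda=\tilde f^\lambda$ on $A^{\mathrm{free}}$ is a robust $\boldsymbol b$-flow of minimum cost among those with load $\ell$ on the fixed arcs. -/

import Mathlib

/-! ### Minimum cost flows -/

/-- A minimum cost flow instance `(G, u, c, b)` on a finite digraph with vertex set `V` and arc
set `A`; an arc `a` goes from `tail a` to `head a` (parallel arcs and loops are allowed). -/
structure FlowInstance (V A : Type*) [Fintype V] where
  tail : A → V
  head : A → V
  cap : A → ℕ
  cost : A → ℕ
  bal : V → ℤ
  bal_sum : ∑ v, bal v = 0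

/-- `f` is an integral `b`-flow: capacity constraints and flow balance constraints. -/
def FlowInstance.IsFlow {V A : Type*} [Fintype V] [DecidableEq V] [Fintype A]
    (M : FlowInstance V A) (f : A → ℕ) : Prop :=
  (∀ a, f a ≤ M.cap a) ∧
    ∀ v, (∑ a with M.tail a = v, (f a : ℤ)) - ∑ a with M.head a = v, (f a : ℤ) = M.bal v

/-- The cost of a flow. -/
def FlowInstance.flowCost {V A : Type*} [Fintype V] [Fintype A]
    (M : FlowInstance V A) (f : A → ℕ) : ℕ :=
  ∑ a, M.cost a * f a

/-- `f` is a `b`-flow of minimum cost. -/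
def FlowInstance.IsMinCostFlow {V A : Type*} [Fintype V] [DecidableEq V] [Fintype A]
    (M : FlowInstance V A) (f : A → ℕ) : Prop :=
  M.IsFlow f ∧ ∀ g, M.IsFlow g → M.flowCost f ≤ M.flowCost g

/-! ### Robust minimum cost flows under consistent flow constraints -/

/-- A network with vertex set `V`, arc set `A`, fixed arcs `fixed ⊆ A` (the other arcs are free)
and balances `bal s` for every scenario `s : S`. -/
structure RobustNetwork (V A S : Type*) [Fintype V] where
  tail : A → V
  head : A → V
  fixed : Finset A
  cap : A → ℕ
  cost : A → ℕ
  bal : S → V → ℤ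
  bal_sum : ∀ s, ∑ v, bal s v = 0

namespace RobustNetwork

/-- The minimum cost flow instance of a single scenario. -/
def scenario {V A S : Type*} [Fintype V] (N : RobustNetwork V A S) (s : S) :
    FlowInstance V A where
  tail := N.tail
  head := N.head
  cap := N.cap
  cost := N.cost
  bal := N.bal s
  bal_sum := N.bal_sum s

/-- Robust flows: a flow for every scenario, with equal values on the fixed arcs. -/
def IsRobustFlow {V A S : Type*} [Fintype V] [DecidableEq V] [Fintype A]
    (N : RobustNetwork V A S) (f : S → A → ℕ) : Prop :=
  (∀ s, (N.scenario s).IsFlow (f s)) ∧ ∀ a ∈ N.fixed, ∀ s s', f s a = f s' a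

/-- The cost of a robust flow: the maximum cost among all scenarios. -/
def robustCost {V A S : Type*} [Fintype V] [Fintype A] [Fintype S]
    (N : RobustNetwork V A S) (f : S → A → ℕ) : ℕ :=
  Finset.univ.sup fun s => (N.scenario s).flowCost (f s)

/-- `f` is a robust flow whose load on every fixed arc is the prescribed one. -/
def IsRobustFlowWithLoad {V A S : Type*} [Fintype V] [DecidableEq V] [Fintype A]
    (N : RobustNetwork V A S) (load : {a // a ∈ N.fixed} → ℕ) (f : S → A → ℕ) : Prop :=
  N.IsRobustFlow f ∧ ∀ s (a : {a // a ∈ N.fixed}), f s a = load a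

/-- `f` has minimum cost among the robust flows with the prescribed load on the fixed arcs. -/
def IsOptimalWithLoad {V A S : Type*} [Fintype V] [DecidableEq V] [Fintype A] [Fintype S]
    (N : RobustNetwork V A S) (load : {a // a ∈ N.fixed} → ℕ) (f : S → A → ℕ) : Prop :=
  N.IsRobustFlowWithLoad load f ∧
    ∀ g, N.IsRobustFlowWithLoad load g → N.robustCost f ≤ N.robustCost g

/-- The balances that remain once the fixed arcs carry the prescribed load. -/
def reducedBal {V A S : Type*} [Fintype V] [DecidableEq V]
    (N : RobustNetwork V A S) (load : {a // a ∈ N.fixed} → ℕ) (s : S) (v : V) : ℤ :=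
  N.bal s v + (∑ a with N.head (Subtype.val a) = v, (load a : ℤ))
    - ∑ a with N.tail (Subtype.val a) = v, (load a : ℤ)

theorem sum_reducedBal {V A S : Type*} [Fintype V] [DecidableEq V]
    (N : RobustNetwork V A S) (load : {a // a ∈ N.fixed} → ℕ) (s : S) :
    ∑ v, N.reducedBal load s v = 0 := by
  simp only [reducedBal, Finset.sum_sub_distrib, Finset.sum_add_distrib, N.bal_sum,
    Finset.sum_fiberwise]
  ring

/-- The minimum cost flow instance of scenario `s` after deleting the fixed arcs and adjusting
the balances. -/
def reduced {V A S : Type*} [Fintype V] [DecidableEq V]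
    (N : RobustNetwork V A S) (load : {a // a ∈ N.fixed} → ℕ) (s : S) :
    FlowInstance V {a // a ∉ N.fixed} where
  tail a := N.tail a
  head a := N.head a
  cap a := N.cap a
  cost a := N.cost a
  bal := N.reducedBal load s
  bal_sum := N.sum_reducedBal load s

/-- Flows on the free arcs, one per scenario, completed by the prescribed load. -/
def extend {V A S : Type*} [Fintype V] [DecidableEq A]
    (N : RobustNetwork V A S) (load : {a // a ∈ N.fixed} → ℕ)
    (g : S → {a // a ∉ N.fixed} → ℕ) (s : S) (a : A) : ℕ :=
  if h : a ∈ N.fixed then load ⟨a, h⟩ else g s ⟨a, h⟩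

end RobustNetwork

/-! ### Polynomial time: a random access machine with logarithmic cost

Programs of a random access machine over the integers, in structured form. A program uses finitely
many integer variables `var x` and finitely many arrays `arr a`. Every operation is charged one
plus the binary lengths of the addresses and operands that it handles (the logarithmic cost
criterion), so that polynomial time on this machine is polynomial time on a Turing machine. -/

namespace Ram

/-- The memory of the machine. -/
structure State where
  var : ℕ → ℤ
  arr : ℕ → ℤ → ℤ

/-- The number of binary digits of an integer. -/
def len (z : ℤ) : ℕ := z.natAbs.size

/-- Binary operations. -/
inductive Op
  | add
  | sub
  | mul
  | div
  | lt
  | eq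

/-- Division is Euclidean (and `0` if the divisor is `0`); comparisons return `1` or `0`. -/
def Op.eval : Op → ℤ → ℤ → ℤ
  | .add, x, y => x + y
  | .sub, x, y => x - y
  | .mul, x, y => x * y
  | .div, x, y => x / y
  | .lt, x, y => if x < y then 1 else 0
  | .eq, x, y => if x = y then 1 else 0

/-- Expressions: `get a e` reads the array `a` at the index given by `e`. -/
inductive Expr
  | const (z : ℤ)
  | var (x : ℕ)
  | get (a : ℕ) (e : Expr)
  | op (o : Op) (e₁ e₂ : Expr)

/-- The value of an expression. -/
def Expr.eval (σ : State) : Expr → ℤ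
  | .const z => z
  | .var x => σ.var x
  | .get a e => σ.arr a (e.eval σ)
  | .op o e₁ e₂ => o.eval (e₁.eval σ) (e₂.eval σ)

/-- The logarithmic cost of evaluating an expression. -/
def Expr.time (σ : State) : Expr → ℕ
  | .const z => 1 + len z
  | .var x => 1 + len (σ.var x)
  | .get a e => e.time σ + 1 + len (e.eval σ) + len (σ.arr a (e.eval σ))
  | .op _ e₁ e₂ => e₁.time σ + e₂.time σ + 1 + len (e₁.eval σ) + len (e₂.eval σ)

/-- Programs. -/
inductive Program
  | skip
  | assign (x : ℕ) (e : Expr)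
  | store (a : ℕ) (i e : Expr)
  | seq (p q : Program)
  | ite (e : Expr) (p q : Program)
  | loop (e : Expr) (p : Program)

/-- The state after writing `z` into the variable `x`. -/
def State.setVar (σ : State) (x : ℕ) (z : ℤ) : State :=
  { σ with var := Function.update σ.var x z }

/-- The state after writing `z` into the array `a` at index `i`. -/
def State.setArr (σ : State) (a : ℕ) (i z : ℤ) : State :=
  { σ with arr := Function.update σ.arr a (Function.update (σ.arr a) i z) }

/-- `Exec p σ τ t`: started in state `σ`, the program `p` halts in state `τ` after time `t`.
`ite e p q` runs `p` if `e ≠ 0` and `q` otherwise; `loop e p` repeats `p` while `e ≠ 0`. -/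
inductive Exec : Program → State → State → ℕ → Prop
  | skip (σ : State) : Exec .skip σ σ 1
  | assign (x : ℕ) (e : Expr) (σ : State) :
      Exec (.assign x e) σ (σ.setVar x (e.eval σ)) (e.time σ + 1)
  | store (a : ℕ) (i e : Expr) (σ : State) :
      Exec (.store a i e) σ (σ.setArr a (i.eval σ) (e.eval σ)) (i.time σ + e.time σ + 1)
  | seq {p q : Program} {σ τ υ : State} {t t' : ℕ} :
      Exec p σ τ t → Exec q τ υ t' → Exec (.seq p q) σ υ (t + t')
  | ite_true {e : Expr} {p q : Program} {σ τ : State} {t : ℕ} :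
      e.eval σ ≠ 0 → Exec p σ τ t → Exec (.ite e p q) σ τ (e.time σ + 1 + t)
  | ite_false {e : Expr} {p q : Program} {σ τ : State} {t : ℕ} :
      e.eval σ = 0 → Exec q σ τ t → Exec (.ite e p q) σ τ (e.time σ + 1 + t)
  | loop_true {e : Expr} {p : Program} {σ τ υ : State} {t t' : ℕ} :
      e.eval σ ≠ 0 → Exec p σ τ t → Exec (.loop e p) τ υ t' →
        Exec (.loop e p) σ υ (e.time σ + 1 + t + t')
  | loop_false {e : Expr} {p : Program} {σ : State} :
      e.eval σ = 0 → Exec (.loop e p) σ σ (e.time σ + 1)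

/-- The initial state on a list of integers: the list is in array `0`, its length in variable `0`,
and everything else is `0`. -/
def initState (l : List ℤ) : State where
  var x := if x = 0 then (l.length : ℤ) else 0
  arr a i := if a = 0 ∧ 0 ≤ i then l.getD i.toNat 0 else 0

/-- The output of a halted program: the first `var 1` entries of array `1`. -/
def State.output (σ : State) : List ℤ :=
  (List.range (σ.var 1).toNat).map fun i => σ.arr 1 (i : ℤ)

/-- The size of an input: its length in binary encoding. -/
def inputSize (l : List ℤ) : ℕ := (l.map fun z => len z + 1).sum

/-- The search problem with instances `ι`, encoded by `enc`, and admissible answers `R` is solvable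
in polynomial time: one program halts on every instance, within time polynomial in the size of the
instance, with an admissible answer. -/
def SolvableInPolyTime {ι : Type*} (enc : ι → List ℤ) (R : ι → List ℤ → Prop) : Prop :=
  ∃ (p : Program) (P : Polynomial ℕ), ∀ I : ι, ∃ (τ : State) (t : ℕ),
    Exec p (initState (enc I)) τ t ∧ t ≤ P.eval (inputSize (enc I)) ∧ R I τ.output

end Ram

/-! ### The computational problem -/

/-- An instance of the robust flow problem together with prescribed loads on the fixed arcs, with
vertices, arcs and (at least one) scenarios numbered consecutively. -/
structure LoadInstance where
  n : ℕ
  m : ℕ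
  k : ℕ
  k_pos : 0 < k
  net : RobustNetwork (Fin n) (Fin m) (Fin k)
  load : {a // a ∈ net.fixed} → ℕ

/-- The encoding of an instance: the numbers of vertices, arcs and scenarios; six numbers per arc
`a`, namely tail, head, whether `a` is fixed, capacity, cost and load (`0` for free arcs); the
balances of all vertices, scenario by scenario. -/
def LoadInstance.encode (I : LoadInstance) : List ℤ :=
  [(I.n : ℤ), (I.m : ℤ), (I.k : ℤ)] ++
    (List.ofFn fun a : Fin I.m =>
      [((I.net.tail a).val : ℤ), ((I.net.head a).val : ℤ), if a ∈ I.net.fixed then 1 else 0,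
        (I.net.cap a : ℤ), (I.net.cost a : ℤ),
        if h : a ∈ I.net.fixed then (I.load ⟨a, h⟩ : ℤ) else 0]).flatten ++
    (List.ofFn fun s : Fin I.k => List.ofFn fun v : Fin I.n => I.net.bal s v).flatten

/-- The list of all flow values, scenario by scenario. -/
def encodeFlow {m k : ℕ} (f : Fin k → Fin m → ℕ) : List ℤ :=
  (List.ofFn fun s : Fin k => List.ofFn fun a : Fin m => (f s a : ℤ)).flatten

/-- The admissible answers: `1` followed by an optimal robust flow with the prescribed load if
there is one, and `0` alone if no robust flow has the prescribed load. -/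
def LoadInstance.IsAnswer (I : LoadInstance) (out : List ℤ) : Prop :=
  (∃ f, I.net.IsOptimalWithLoad I.load f ∧ out = 1 :: encodeFlow f) ∨
    ((¬ ∃ f, I.net.IsRobustFlowWithLoad I.load f) ∧ out = [0])

/-! Once the fixed arcs carry the load `ℓ`, the scenarios no longer interact. The balance
contributed by the fixed arcs moves to the right-hand side, and the cost of a scenario is a constant
plus the cost of a flow in its reduced instance (`isFlow_restrict`, `flowCost_eq`). Choosing a
cheapest flow in every scenario separately therefore minimizes every entry of the maximum at once
(`isOptimalWithLoad_extend`). This is (ii), and it reduces (i) to solving one minimum cost flow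
problem per scenario in polynomial time.

That problem is solved by an explicit program. An auxiliary vertex and one auxiliary arc per vertex,
of capacity `|b(v)|` and very negative cost `-K`, turn a flow instance into a minimum cost
circulation problem, which is always feasible. The flow instance is feasible exactly if an optimal
circulation saturates all auxiliary arcs, and the remaining arcs then carry a cheapest flow
(`Represents.isFlow`, `Represents.compare`). Optimality is certified by a potential for which all
residual arcs have nonnegative reduced cost (`Opt.le_cost`).

The circulation is found by capacity scaling. For capacities `⌊u/D⌋` with `D` above all capacities
the zero circulation is optimal. Halving `D` doubles the rounded capacities and adds at most one
unit per arc. Doubling preserves the certificate (`Solved.double`), and one extra unit on one arc is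
absorbed by at most one shortest augmenting path, found by a Dijkstra search with potential updates
(`Opt.raise`, `Tree.grow`, `Augmenting.step`, `increaseCap_spec`).

For the running time it suffices to count loop iterations. The program never multiplies, so each
operation adds at most one binary digit, and polynomially many iterations give polynomial bit
lengths and polynomial logarithmic time (`Run.exec`). Correctness and iteration bounds are derived
together in a small total-correctness logic `Wp`. -/

/-! ### Counting loop iterations -/

namespace Ram

/-- `Run p σ τ k`: started in `σ`, the program `p` halts in `τ` after `k` loop iterations. -/
inductive Run : Program → State → State → ℕ → Prop
  | skip (σ : State) : Run .skip σ σ 0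
  | assign (x : ℕ) (e : Expr) (σ : State) : Run (.assign x e) σ (σ.setVar x (e.eval σ)) 0
  | store (a : ℕ) (i e : Expr) (σ : State) :
      Run (.store a i e) σ (σ.setArr a (i.eval σ) (e.eval σ)) 0
  | seq {p q : Program} {σ τ υ : State} {k k' : ℕ} :
      Run p σ τ k → Run q τ υ k' → Run (.seq p q) σ υ (k + k')
  | ite_true {e : Expr} {p q : Program} {σ τ : State} {k : ℕ} :
      e.eval σ ≠ 0 → Run p σ τ k → Run (.ite e p q) σ τ k
  | ite_false {e : Expr} {p q : Program} {σ τ : State} {k : ℕ} :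
      e.eval σ = 0 → Run q σ τ k → Run (.ite e p q) σ τ k
  | loop_true {e : Expr} {p : Program} {σ τ υ : State} {k k' : ℕ} :
      e.eval σ ≠ 0 → Run p σ τ k → Run (.loop e p) τ υ k' → Run (.loop e p) σ υ (k + k' + 1)
  | loop_false {e : Expr} {p : Program} {σ : State} :
      e.eval σ = 0 → Run (.loop e p) σ σ 0

/-- No multiplication occurs. -/
def Expr.mulFree : Expr → Bool
  | .const _ => true
  | .var _ => true
  | .get _ e => e.mulFree
  | .op .mul _ _ => false
  | .op _ e₁ e₂ => e₁.mulFree && e₂.mulFree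

/-- No multiplication occurs. -/
def Program.mulFree : Program → Bool
  | .skip => true
  | .assign _ e => e.mulFree
  | .store _ i e => i.mulFree && e.mulFree
  | .seq p q => p.mulFree && q.mulFree
  | .ite e p q => e.mulFree && p.mulFree && q.mulFree
  | .loop e p => e.mulFree && p.mulFree

/-- The size of an expression. -/
def Expr.size : Expr → ℕ
  | .const z => len z + 1
  | .var _ => 1
  | .get _ e => e.size + 1
  | .op _ e₁ e₂ => e₁.size + e₂.size + 1

/-- The size of a program. -/
def Program.size : Program → ℕ
  | .skip => 1
  | .assign _ e => e.size + 1
  | .store _ i e => i.size + e.size + 1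
  | .seq p q => p.size + q.size
  | .ite e p q => e.size + p.size + q.size + 1
  | .loop e p => e.size + p.size + 1

/-- All numbers in the memory have at most `B` binary digits. -/
def State.Bits (σ : State) (B : ℕ) : Prop :=
  (∀ x, len (σ.var x) ≤ B) ∧ ∀ a i, len (σ.arr a i) ≤ B

/-! ### Growth of bit lengths without multiplication -/

theorem len_le_iff {z : ℤ} {B : ℕ} : len z ≤ B ↔ z.natAbs < 2 ^ B := Nat.size_le

theorem len_le_of_natAbs_le_add {x y z : ℤ} {B C : ℕ} (hz : z.natAbs ≤ x.natAbs + y.natAbs)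
    (hx : len x ≤ B + C) (hy : len y ≤ B + C) : len z ≤ B + (C + 1) := by
  rw [len_le_iff] at *
  rw [← add_assoc, pow_succ]
  omega

/-- Sums and differences exceed the longer operand by at most one digit, and quotients do not exceed
the dividend. A product would add the lengths, so repeated squaring could double them in every
iteration. In the bound, `B` stands for the numbers in memory and `C` for the size of the expression
built so far. -/
theorem Op.len_eval_le {o : Op} (ho : o ≠ .mul) {x y : ℤ} {B C : ℕ} (hx : len x ≤ B + C)
    (hy : len y ≤ B + C) : len (o.eval x y) ≤ B + (C + 1) := by
  have one : ∀ z : ℤ, z.natAbs ≤ 1 → len z ≤ B + (C + 1) := by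
    intro z hz
    rw [len_le_iff]
    exact hz.trans_lt (Nat.one_lt_two_pow (by omega))
  cases o with
  | add => exact len_le_of_natAbs_le_add (Int.natAbs_add_le x y) hx hy
  | sub => exact len_le_of_natAbs_le_add (Int.natAbs_sub_le x y) hx hy
  | mul => exact absurd rfl ho
  | div =>
    refine len_le_of_natAbs_le_add ?_ hx hy
    exact (Int.natAbs_ediv_le_natAbs x y).trans (Nat.le_add_right _ _)
  | lt => exact one _ (by simp only [Op.eval]; split_ifs <;> simp)
  | eq => exact one _ (by simp only [Op.eval]; split_ifs <;> simp)

theorem Expr.len_eval_le {σ : State} {B : ℕ} (hσ : σ.Bits B) (e : Expr) (he : e.mulFree) :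
    len (e.eval σ) ≤ B + e.size := by
  induction e with
  | const z => simp only [Expr.eval, Expr.size]; omega
  | var x => exact (hσ.1 x).trans (Nat.le_add_right _ _)
  | get a e ih => exact (hσ.2 a _).trans (Nat.le_add_right _ _)
  | op o e₁ e₂ ih₁ ih₂ =>
    have ho : o ≠ .mul := by rintro rfl; simp [mulFree] at he
    have h : e₁.mulFree ∧ e₂.mulFree := by cases o <;> simp_all [mulFree]
    exact Op.len_eval_le ho ((ih₁ h.1).trans (by omega)) ((ih₂ h.2).trans (by omega))

theorem Expr.time_le {σ : State} {B : ℕ} (hσ : σ.Bits B) (e : Expr) (he : e.mulFree) :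
    e.time σ ≤ e.size * (2 * (B + e.size) + 1) := by
  induction e with
  | const z => simp only [Expr.time, Expr.size]; nlinarith
  | var x => have := hσ.1 x; simp only [Expr.time, Expr.size]; omega
  | get a e ih =>
    have h₁ := hσ.2 a (e.eval σ)
    have h₂ := e.len_eval_le hσ he
    have h₃ := ih he
    simp only [Expr.time, Expr.size]
    nlinarith
  | op o e₁ e₂ ih₁ ih₂ =>
    have h : e₁.mulFree ∧ e₂.mulFree := by cases o <;> simp_all [mulFree]
    have h₁ := e₁.len_eval_le hσ h.1
    have h₂ := e₂.len_eval_le hσ h.2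
    have h₃ := ih₁ h.1
    have h₄ := ih₂ h.2
    simp only [Expr.time, Expr.size]
    nlinarith

theorem State.Bits.mono {σ : State} {B C : ℕ} (h : σ.Bits B) (hBC : B ≤ C) : σ.Bits C :=
  ⟨fun x => (h.1 x).trans hBC, fun a i => (h.2 a i).trans hBC⟩

theorem State.Bits.setVar {σ : State} {B : ℕ} (h : σ.Bits B) (x : ℕ) {z : ℤ} (hz : len z ≤ B) :
    (σ.setVar x z).Bits B := by
  refine ⟨fun y => ?_, h.2⟩
  simp only [State.setVar, Function.update_apply]
  split_ifs
  exacts [hz, h.1 y]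

theorem State.Bits.setArr {σ : State} {B : ℕ} (h : σ.Bits B) (a : ℕ) (i : ℤ) {z : ℤ}
    (hz : len z ≤ B) : (σ.setArr a i z).Bits B := by
  refine ⟨h.1, fun b j => ?_⟩
  simp only [State.setArr, Function.update_apply]
  split_ifs with h₁
  · rw [Function.update_apply]
    split_ifs
    exacts [hz, h.2 a j]
  · exact h.2 b j

/-- For programs without multiplications, logarithmic time is bounded by loop iterations. -/
theorem Run.exec {p : Program} {σ τ : State} {k : ℕ} (h : Run p σ τ k) (hp : p.mulFree) {B : ℕ}
    (hσ : σ.Bits B) :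
    τ.Bits (B + p.size * (k + 1)) ∧
      ∃ t, Exec p σ τ t ∧ t ≤ p.size * (k + 1) * (2 * (B + p.size * (k + 1)) + 1) := by
  induction h generalizing B with
  | skip σ => exact ⟨hσ.mono (Nat.le_add_right _ _), 1, .skip σ, by simp [Program.size]⟩
  | assign x e σ =>
    have h₁ := e.len_eval_le hσ hp
    have h₂ := e.time_le hσ hp
    refine ⟨(hσ.mono ?_).setVar x (h₁.trans ?_), _, .assign x e σ, ?_⟩ <;>
      simp only [Program.size] <;> nlinarith
  | store a i e σ =>
    simp only [Program.mulFree, Bool.and_eq_true] at hp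
    have h₁ := e.len_eval_le hσ hp.2
    have h₂ := e.time_le hσ hp.2
    have h₃ := i.time_le hσ hp.1
    refine ⟨(hσ.mono ?_).setArr a _ (h₁.trans ?_), _, .store a i e σ, ?_⟩ <;>
      simp only [Program.size] <;> nlinarith
  | @seq p q σ τ υ k k' _ _ ih₁ ih₂ =>
    simp only [Program.mulFree, Bool.and_eq_true] at hp
    obtain ⟨b₁, t₁, e₁, l₁⟩ := ih₁ hp.1 hσ
    obtain ⟨b₂, t₂, e₂, l₂⟩ := ih₂ hp.2 b₁
    simp only [Program.size]
    -- Both the growth in digits and the number of charged operations are measured by size times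
    -- (iterations + 1), which is superadditive under composition.
    have hS : p.size * (k + 1) + q.size * (k' + 1) ≤ (p.size + q.size) * (k + k' + 1) := by
      nlinarith
    generalize p.size * (k + 1) = x at *
    generalize q.size * (k' + 1) = y at *
    generalize (p.size + q.size) * (k + k' + 1) = z at *
    refine ⟨b₂.mono (by omega), _, .seq e₁ e₂, ?_⟩
    nlinarith
  | @ite_true e p q σ τ k he _ ih =>
    simp only [Program.mulFree, Bool.and_eq_true] at hp
    obtain ⟨b₁, t₁, e₁, l₁⟩ := ih hp.1.2 hσ
    have h₂ := e.time_le hσ hp.1.1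
    simp only [Program.size]
    have hS : p.size * (k + 1) + e.size + 1 ≤ (e.size + p.size + q.size + 1) * (k + 1) := by
      nlinarith
    generalize p.size * (k + 1) = x at *
    generalize (e.size + p.size + q.size + 1) * (k + 1) = z at *
    refine ⟨b₁.mono (by omega), _, .ite_true he e₁, ?_⟩
    nlinarith
  | @ite_false e p q σ τ k he _ ih =>
    simp only [Program.mulFree, Bool.and_eq_true] at hp
    obtain ⟨b₁, t₁, e₁, l₁⟩ := ih hp.2 hσ
    have h₂ := e.time_le hσ hp.1.1
    simp only [Program.size]
    have hS : q.size * (k + 1) + e.size + 1 ≤ (e.size + p.size + q.size + 1) * (k + 1) := by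
      nlinarith
    generalize q.size * (k + 1) = x at *
    generalize (e.size + p.size + q.size + 1) * (k + 1) = z at *
    refine ⟨b₁.mono (by omega), _, .ite_false he e₁, ?_⟩
    nlinarith
  | @loop_true e p σ τ υ k k' he _ _ ih₁ ih₂ =>
    have hp' := hp
    simp only [Program.mulFree, Bool.and_eq_true] at hp
    obtain ⟨b₁, t₁, e₁, l₁⟩ := ih₁ hp.2 hσ
    obtain ⟨b₂, t₂, e₂, l₂⟩ := ih₂ hp' b₁
    have h₂ := e.time_le hσ hp.1
    simp only [Program.size] at *
    -- The additional iteration leaves a surplus of (loop size) times `k + 1`, which pays for this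
    -- run of the body and one test.
    have hS : p.size * (k + 1) + (e.size + p.size + 1) * (k' + 1) + e.size + 1 ≤
        (e.size + p.size + 1) * (k + k' + 1 + 1) := by
      nlinarith
    generalize p.size * (k + 1) = x at *
    generalize (e.size + p.size + 1) * (k' + 1) = y at *
    generalize (e.size + p.size + 1) * (k + k' + 1 + 1) = z at *
    refine ⟨b₂.mono (by omega), _, .loop_true he e₁ e₂, ?_⟩
    nlinarith
  | @loop_false e p σ he =>
    simp only [Program.mulFree, Bool.and_eq_true] at hp
    have h₂ := e.time_le hσ hp.1
    simp only [Program.size]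
    refine ⟨hσ.mono (Nat.le_add_right _ _), _, .loop_false he, ?_⟩
    nlinarith

/-! ### Program logic -/

/-- The program may change the variable `x`. -/
def Program.writesVar : Program → ℕ → Bool
  | .skip, _ => false
  | .assign y _, x => x == y
  | .store _ _ _, _ => false
  | .seq p q, x => p.writesVar x || q.writesVar x
  | .ite _ p q, x => p.writesVar x || q.writesVar x
  | .loop _ p, x => p.writesVar x

/-- The program may change the array `a`. -/
def Program.writesArr : Program → ℕ → Bool
  | .skip, _ => false
  | .assign _ _, _ => false
  | .store b _ _, a => a == b
  | .seq p q, a => p.writesArr a || q.writesArr a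
  | .ite _ p q, a => p.writesArr a || q.writesArr a
  | .loop _ p, a => p.writesArr a

/-- The states agree outside of the variables and arrays that `p` may change. -/
structure Frame (p : Program) (σ τ : State) : Prop where
  var : ∀ x, p.writesVar x = false → τ.var x = σ.var x
  arr : ∀ a, p.writesArr a = false → τ.arr a = σ.arr a

theorem Frame.refl (p : Program) (σ : State) : Frame p σ σ := ⟨fun _ _ => rfl, fun _ _ => rfl⟩

theorem Frame.trans {p : Program} {σ τ υ : State} (h₁ : Frame p σ τ) (h₂ : Frame p τ υ) :
    Frame p σ υ :=
  ⟨fun x hx => (h₂.var x hx).trans (h₁.var x hx), fun a ha => (h₂.arr a ha).trans (h₁.arr a ha)⟩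

theorem Frame.mono {p q : Program} {σ τ : State} (h : Frame p σ τ)
    (hv : ∀ x, q.writesVar x = false → p.writesVar x = false)
    (ha : ∀ a, q.writesArr a = false → p.writesArr a = false) : Frame q σ τ :=
  ⟨fun x hx => h.var x (hv x hx), fun a hx => h.arr a (ha a hx)⟩

/-- The write sets are computed from the syntax, so for a concrete program `rfl` proves that a
variable or array is untouched. This supplies all the facts of the form `hf.var x rfl` below. -/
theorem Run.frame {p : Program} {σ τ : State} {k : ℕ} (h : Run p σ τ k) : Frame p σ τ := by
  induction h with
  | skip σ => exact .refl _ _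
  | assign x e σ =>
    refine ⟨fun y hy => ?_, fun _ _ => rfl⟩
    simp only [Program.writesVar, beq_eq_false_iff_ne] at hy
    simp [State.setVar, Function.update_of_ne hy]
  | store a i e σ =>
    refine ⟨fun _ _ => rfl, fun b hb => ?_⟩
    simp only [Program.writesArr, beq_eq_false_iff_ne] at hb
    simp [State.setArr, Function.update_of_ne hb]
  | seq _ _ ih₁ ih₂ =>
    refine (ih₁.mono ?_ ?_).trans (ih₂.mono ?_ ?_) <;>
      simp +contextual [Program.writesVar, Program.writesArr]
  | ite_true _ _ ih =>
    refine ih.mono ?_ ?_ <;> simp +contextual [Program.writesVar, Program.writesArr]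
  | ite_false _ _ ih =>
    refine ih.mono ?_ ?_ <;> simp +contextual [Program.writesVar, Program.writesArr]
  | loop_true _ _ _ ih₁ ih₂ =>
    exact (ih₁.mono (q := .loop _ _) (fun _ h => h) (fun _ h => h)).trans ih₂
  | loop_false _ => exact .refl _ _

/-- Started in `σ`, the program `p` halts after at most `T` loop iterations in a state with `Q`. -/
def Wp (p : Program) (σ : State) (T : ℕ) (Q : State → Prop) : Prop :=
  ∃ τ k, Run p σ τ k ∧ k ≤ T ∧ Q τ

/-- The new postcondition may use the frame of the run, so specifications need only describe what
changes. -/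
theorem Wp.mono {p : Program} {σ : State} {T T' : ℕ} {Q Q' : State → Prop} (h : Wp p σ T Q)
    (hT : T ≤ T') (hQ : ∀ τ, Frame p σ τ → Q τ → Q' τ) : Wp p σ T' Q' := by
  obtain ⟨τ, k, h₁, h₂, h₃⟩ := h
  exact ⟨τ, k, h₁, h₂.trans hT, hQ τ h₁.frame h₃⟩

theorem Wp.assign {x : ℕ} {e : Expr} {σ : State} {T : ℕ} {Q : State → Prop}
    (h : Q (σ.setVar x (e.eval σ))) : Wp (.assign x e) σ T Q :=
  ⟨_, 0, .assign x e σ, Nat.zero_le _, h⟩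

theorem Wp.store {a : ℕ} {i e : Expr} {σ : State} {T : ℕ} {Q : State → Prop}
    (h : Q (σ.setArr a (i.eval σ) (e.eval σ))) : Wp (.store a i e) σ T Q :=
  ⟨_, 0, .store a i e σ, Nat.zero_le _, h⟩

theorem Wp.skip {σ : State} {T : ℕ} {Q : State → Prop} (h : Q σ) : Wp .skip σ T Q :=
  ⟨_, 0, .skip σ, Nat.zero_le _, h⟩

theorem Wp.seq {p q : Program} {σ : State} {T₁ T₂ : ℕ} {Q : State → Prop}
    (h : Wp p σ T₁ fun τ => Wp q τ T₂ Q) : Wp (.seq p q) σ (T₁ + T₂) Q := by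
  obtain ⟨τ, k, h₁, h₂, υ, l, h₃, h₄, h₅⟩ := h
  exact ⟨υ, k + l, .seq h₁ h₃, Nat.add_le_add h₂ h₄, h₅⟩

/-- A first program without loops. -/
theorem Wp.seq₀ {p q : Program} {σ : State} {T : ℕ} {Q : State → Prop}
    (h : Wp p σ 0 fun τ => Wp q τ T Q) : Wp (.seq p q) σ T Q := by
  simpa using Wp.seq h

theorem Wp.ite {e : Expr} {p q : Program} {σ : State} {T : ℕ} {Q : State → Prop}
    (h₁ : e.eval σ ≠ 0 → Wp p σ T Q) (h₂ : e.eval σ = 0 → Wp q σ T Q) : Wp (.ite e p q) σ T Q := by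
  by_cases he : e.eval σ = 0
  · obtain ⟨τ, k, h, hk, hQ⟩ := h₂ he
    exact ⟨τ, k, .ite_false he h, hk, hQ⟩
  · obtain ⟨τ, k, h, hk, hQ⟩ := h₁ he
    exact ⟨τ, k, .ite_true he h, hk, hQ⟩

/-- Total correctness of a loop with the invariant `J`, where `J k` bounds the number of remaining
iterations by `k`. -/
theorem Wp.loop {e : Expr} {p : Program} {σ : State} {T k : ℕ} {Q : State → Prop}
    (J : ℕ → State → Prop) (hJ : J k σ)
    (hb : ∀ k τ, Frame (.loop e p) σ τ → J k τ → e.eval τ ≠ 0 →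
      Wp p τ T fun υ => ∃ l < k, J l υ)
    (hQ : ∀ k τ, Frame (.loop e p) σ τ → J k τ → e.eval τ = 0 → Q τ) :
    Wp (.loop e p) σ (k * (T + 1)) Q := by
  -- Frames are taken relative to the state before the whole loop, so that the invariant can refer
  -- to that state.
  suffices ∀ k τ, Frame (.loop e p) σ τ → J k τ → Wp (.loop e p) τ (k * (T + 1)) Q from
    this k σ (.refl _ _) hJ
  intro k
  induction k using Nat.strong_induction_on with
  | _ k ih =>
    intro τ hf hτ
    by_cases he : e.eval τ = 0
    · exact ⟨τ, 0, .loop_false he, Nat.zero_le _, hQ k τ hf hτ he⟩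
    · obtain ⟨υ, i, h₁, h₂, l, hl, h₃⟩ := hb k τ hf hτ he
      obtain ⟨ω, j, h₄, h₅, h₆⟩ :=
        ih l hl υ (hf.trans (h₁.frame.mono (fun _ h => h) (fun _ h => h))) h₃
      refine ⟨ω, i + j + 1, .loop_true he h₁ h₄, ?_, h₆⟩
      have : (l + 1) * (T + 1) ≤ k * (T + 1) := Nat.mul_le_mul_right _ hl
      rw [add_mul] at this
      omega

/-! ### Evaluation rules, notation and counting loops -/

@[simp] theorem State.setVar_var (σ : State) (x : ℕ) (z : ℤ) (y : ℕ) :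
    (σ.setVar x z).var y = if y = x then z else σ.var y := by
  simp [State.setVar, Function.update_apply]

@[simp] theorem State.setVar_arr (σ : State) (x : ℕ) (z : ℤ) : (σ.setVar x z).arr = σ.arr := rfl

@[simp] theorem State.setArr_var (σ : State) (a : ℕ) (i z : ℤ) :
    (σ.setArr a i z).var = σ.var := rfl

@[simp] theorem State.setArr_arr (σ : State) (a : ℕ) (i z : ℤ) (b : ℕ) :
    (σ.setArr a i z).arr b = if b = a then Function.update (σ.arr a) i z else σ.arr b := by
  simp [State.setArr, Function.update_apply]

instance : Add Expr := ⟨.op .add⟩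
instance : Sub Expr := ⟨.op .sub⟩
instance : Div Expr := ⟨.op .div⟩
instance : Neg Expr := ⟨.op .sub (.const 0)⟩

@[simp] theorem Expr.eval_const (σ : State) (z : ℤ) : (Expr.const z).eval σ = z := rfl
@[simp] theorem Expr.eval_var (σ : State) (x : ℕ) : (Expr.var x).eval σ = σ.var x := rfl
@[simp] theorem Expr.eval_get (σ : State) (a : ℕ) (e : Expr) :
    (Expr.get a e).eval σ = σ.arr a (e.eval σ) := rfl
@[simp] theorem Expr.eval_add (σ : State) (e e' : Expr) :
    (e + e').eval σ = e.eval σ + e'.eval σ := rfl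
@[simp] theorem Expr.eval_sub (σ : State) (e e' : Expr) :
    (e - e').eval σ = e.eval σ - e'.eval σ := rfl
@[simp] theorem Expr.eval_div (σ : State) (e e' : Expr) :
    (e / e').eval σ = e.eval σ / e'.eval σ := rfl
@[simp] theorem Expr.eval_neg (σ : State) (e : Expr) : (-e).eval σ = -e.eval σ := zero_sub _
@[simp] theorem Expr.eval_lt (σ : State) (e e' : Expr) :
    (Expr.op .lt e e').eval σ = if e.eval σ < e'.eval σ then 1 else 0 := rfl
@[simp] theorem Expr.eval_eq (σ : State) (e e' : Expr) :
    (Expr.op .eq e e').eval σ = if e.eval σ = e'.eval σ then 1 else 0 := rfl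

/-- Sequential composition. -/
infixr:60 " ;; " => Program.seq

/-- `for x in [lo, hi) do p`. -/
def Program.forTo (x : ℕ) (lo hi : Expr) (p : Program) : Program :=
  .assign x lo ;; .loop (.op .lt (.var x) hi) (p ;; .assign x (.var x + .const 1))

/-- The upper limit is evaluated anew before every round, so `hH` demands that no round changes it.
The increment of the counter belongs to the loop body, hence `hb` asks for the invariant after it.
`R` may be any bound on the number of rounds, which allows one uniform `N` for all loops. -/
theorem Wp.forTo {x : ℕ} {lo hi : Expr} {p : Program} {σ : State} {T R : ℕ} {L H : ℤ}
    {Q : State → Prop} (J : ℤ → State → Prop) (hx : p.writesVar x = false)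
    (hL : lo.eval σ = L) (hle : L ≤ H) (hR : (H - L).toNat ≤ R)
    (hH : ∀ τ, Frame (.forTo x lo hi p) σ τ → hi.eval τ = H)
    (h0 : J L (σ.setVar x L))
    (hb : ∀ i τ, Frame (.forTo x lo hi p) σ τ → L ≤ i → i < H → τ.var x = i → J i τ →
      Wp p τ T fun υ => J (i + 1) (υ.setVar x (i + 1)))
    (hQ : ∀ τ, Frame (.forTo x lo hi p) σ τ → τ.var x = H → J H τ → Q τ) :
    Wp (.forTo x lo hi p) σ (R * (T + 1)) Q := by
  subst hL
  have hf0 : Frame (.forTo x lo hi p) σ (σ.setVar x (lo.eval σ)) :=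
    (Run.assign x lo σ).frame.mono
      (by simp +contextual [Program.forTo, Program.writesVar]) (by simp [Program.writesArr])
  refine Wp.seq₀ (Wp.assign ?_)
  have main : Wp (.loop (.op .lt (.var x) hi) (p ;; .assign x (.var x + .const 1)))
      (σ.setVar x (lo.eval σ)) ((H - lo.eval σ).toNat * (T + 1)) Q := by
    refine Wp.loop (fun k τ => lo.eval σ ≤ τ.var x ∧ τ.var x ≤ H ∧ k = (H - τ.var x).toNat ∧
      J (τ.var x) τ) ⟨by simp, by simpa using hle, by simp, by simpa using h0⟩ ?_ ?_
    · rintro k τ hf ⟨h₁, h₂, rfl, h₄⟩ he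
      have hf' : Frame (.forTo x lo hi p) σ τ := hf0.trans (hf.mono
        (by simp +contextual [Program.forTo, Program.writesVar])
        (by simp +contextual [Program.forTo, Program.writesArr]))
      simp only [Expr.eval_lt, Expr.eval_var, hH τ hf', ne_eq, ite_eq_right_iff,
        one_ne_zero, imp_false, not_not] at he
      have hw := hb _ τ hf' h₁ he rfl h₄
      rw [← Nat.add_zero T]
      refine Wp.seq (hw.mono le_rfl fun υ hυ hJ => Wp.assign ?_)
      have hv : υ.var x = τ.var x := hυ.var x hx
      refine ⟨(H - (τ.var x + 1)).toNat, by omega, ?_⟩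
      simp only [Expr.eval_add, Expr.eval_var, Expr.eval_const, hv, State.setVar_var, if_true]
      exact ⟨by omega, by omega, trivial, hJ⟩
    · rintro k τ hf ⟨h₁, h₂, rfl, h₄⟩ he
      have hf' : Frame (.forTo x lo hi p) σ τ := hf0.trans (hf.mono
        (by simp +contextual [Program.forTo, Program.writesVar])
        (by simp +contextual [Program.forTo, Program.writesArr]))
      simp only [Expr.eval_lt, Expr.eval_var, hH τ hf', ite_eq_right_iff,
        one_ne_zero, imp_false, not_lt] at he
      have : τ.var x = H := le_antisymm h₂ he
      exact hQ τ hf' this (this ▸ h₄)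
  exact main.mono (Nat.mul_le_mul_right _ hR) fun _ _ h => h

end Ram

/-! ### Residual networks

The arcs of a residual network are the integers `e` with `-M ≤ e ≤ M`; the arc `-e` is the reverse
of `e`. The tail of `e` is `tl e`, so its head is `tl (-e)`. An arc `a > 0` is an original arc; it
carries the flow `r (-a)`, where `r` is the residual capacity. -/

namespace Residual

/-- The reduced cost of `e` for the potential `π`. -/
def redCost (tl c π : ℤ → ℤ) (e : ℤ) : ℤ := c e + π (tl e) - π (tl (-e))

/-- All residual arcs have nonnegative reduced cost. -/
def Opt (M : ℤ) (tl c r π : ℤ → ℤ) : Prop :=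
  ∀ e, -M ≤ e → e ≤ M → 0 < r e → 0 ≤ redCost tl c π e

/-- The net outflow of the flow, weighted by `p`. -/
noncomputable def excess (M : ℤ) (tl r p : ℤ → ℤ) : ℤ :=
  ∑ a ∈ Finset.Icc 1 M, r (-a) * (p (tl a) - p (tl (-a)))

/-- The residual capacities after pushing one unit along `e`. -/
def push (r : ℤ → ℤ) (e : ℤ) : ℤ → ℤ :=
  Function.update (Function.update r e (r e - 1)) (-e) (r (-e) + 1)

/-- The vertices are `0, …, n`, and reverse arcs have opposite costs. -/
structure Good (n M : ℤ) (tl c : ℤ → ℤ) : Prop where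
  tl_nonneg : ∀ e, -M ≤ e → e ≤ M → 0 ≤ tl e
  tl_le : ∀ e, -M ≤ e → e ≤ M → tl e ≤ n
  cost_neg : ∀ e, -M ≤ e → e ≤ M → c (-e) = -c e

theorem Good.redCost_neg {n M : ℤ} {tl c π : ℤ → ℤ} (h : Good n M tl c) {e : ℤ} (h₁ : -M ≤ e)
    (h₂ : e ≤ M) : redCost tl c π (-e) = -redCost tl c π e := by
  simp only [redCost, h.cost_neg e h₁ h₂, neg_neg]
  ring

/-- Arc `0` is its own reverse, so the two updates would collide there. For all other arcs they are
independent and can be written additively. -/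
theorem push_apply {r : ℤ → ℤ} {e : ℤ} (he : e ≠ 0) (x : ℤ) :
    push r e x = r x + (if x = -e then 1 else 0) - if x = e then 1 else 0 := by
  simp only [push, Function.update_apply]
  split_ifs with h₁ h₂ <;> subst_vars <;> omega

theorem push_add_push_neg {r : ℤ → ℤ} {e : ℤ} (he : e ≠ 0) (x : ℤ) :
    push r e x + push r e (-x) = r x + r (-x) := by
  rw [push_apply he, push_apply he]
  split_ifs <;> omega

theorem push_nonneg {r : ℤ → ℤ} {e : ℤ} (he : e ≠ 0) (hr : ∀ x, 0 ≤ r x) (h : 0 < r e) (x : ℤ) :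
    0 ≤ push r e x := by
  rw [push_apply he]
  have := hr x
  split_ifs with h₁ h₂ h₂ <;> subst_vars <;> omega

/-- Only the summand of the original arc `|e|` changes: a positive `e` gains one unit of flow, while
for a negative `e` one unit on `-e` is cancelled. Both have the same effect on the balances. -/
theorem excess_push {M : ℤ} {tl r p : ℤ → ℤ} {e : ℤ} (he : e ≠ 0) (h₁ : -M ≤ e) (h₂ : e ≤ M) :
    excess M tl (push r e) p = excess M tl r p + (p (tl e) - p (tl (-e))) := by
  rcases lt_or_gt_of_ne he with h | h
  · have hm : -e ∈ Finset.Icc 1 M := by simp; omega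
    rw [excess, excess, ← Finset.add_sum_erase _ _ hm, ← Finset.add_sum_erase _ _ hm,
      Finset.sum_congr rfl (g := fun a => r (-a) * (p (tl a) - p (tl (-a))))]
    · rw [push_apply he]
      simp only [neg_neg, if_true]
      rw [if_neg (by omega)]
      ring
    · intro a ha
      simp only [Finset.mem_erase, Finset.mem_Icc] at ha
      rw [push_apply he, if_neg (by omega), if_neg (by omega)]
      ring
  · have hm : e ∈ Finset.Icc 1 M := by simp; omega
    rw [excess, excess, ← Finset.add_sum_erase _ _ hm, ← Finset.add_sum_erase _ _ hm,
      Finset.sum_congr rfl (g := fun a => r (-a) * (p (tl a) - p (tl (-a))))]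
    · rw [push_apply he]
      rw [if_pos rfl, if_neg (by omega)]
      ring
    · intro a ha
      simp only [Finset.mem_erase, Finset.mem_Icc] at ha
      rw [push_apply he, if_neg (by omega), if_neg (by omega)]
      ring

/-- The only arc that can become residual is `-e`, and its reduced cost is `0` as well. -/
theorem Opt.push {n M : ℤ} {tl c r π : ℤ → ℤ} {e : ℤ} (hG : Good n M tl c)
    (h : Opt M tl c r π) (he : e ≠ 0) (h₁ : -M ≤ e) (h₂ : e ≤ M) (h₃ : redCost tl c π e = 0) :
    Opt M tl c (push r e) π := by
  intro x hx₁ hx₂ hx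
  rw [push_apply he] at hx
  by_cases h₄ : x = -e
  · rw [h₄, hG.redCost_neg h₁ h₂, h₃, neg_zero]
  · refine h x hx₁ hx₂ ?_
    rw [if_neg h₄] at hx
    split_ifs at hx <;> omega

/-- An optimality criterion: a circulation without residual arcs of negative reduced cost has
minimum cost. -/
theorem Opt.le_cost {M : ℤ} {tl c r π : ℤ → ℤ} (h : Opt M tl c r π)
    (hneg : ∀ e, -M ≤ e → e ≤ M → c (-e) = -c e) (hE : ∀ p, excess M tl r p = 0)
    (g : ℤ → ℤ) (hg : ∀ a, 1 ≤ a → a ≤ M → 0 ≤ g a ∧ g a ≤ r a + r (-a))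
    (hr : ∀ e, 0 ≤ r e)
    (hgE : ∑ a ∈ Finset.Icc 1 M, g a * (π (tl a) - π (tl (-a))) = 0) :
    ∑ a ∈ Finset.Icc 1 M, c a * r (-a) ≤ ∑ a ∈ Finset.Icc 1 M, c a * g a := by
  -- Complementary slackness: an arc of negative reduced cost has no residual capacity and is full,
  -- an arc of positive reduced cost carries no flow, and otherwise the term is `0`.
  have key : ∑ a ∈ Finset.Icc 1 M, redCost tl c π a * r (-a) ≤
      ∑ a ∈ Finset.Icc 1 M, redCost tl c π a * g a := by
    refine Finset.sum_le_sum fun a ha => ?_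
    rw [Finset.mem_Icc] at ha
    obtain ⟨g₁, g₂⟩ := hg a ha.1 ha.2
    rcases lt_trichotomy (redCost tl c π a) 0 with h₁ | h₁ | h₁
    · have : ¬ 0 < r a := fun h₂ => absurd (h a (by omega) ha.2 h₂) (by omega)
      have := hr a
      nlinarith
    · simp [h₁]
    · have : ¬ 0 < r (-a) := fun h₂ => by
        have h₃ := h (-a) (by omega) (by omega) h₂
        simp only [redCost, hneg a (by omega) ha.2, neg_neg] at h₃ h₁
        omega
      have h₂ := hr (-a)
      have h₃ : r (-a) = 0 := by omega
      rw [h₃, mul_zero]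
      positivity
  -- Passing from costs to reduced costs adds a potential term that vanishes for both circulations.
  have h₁ := hE π
  simp only [excess] at h₁
  have e₁ : ∑ a ∈ Finset.Icc 1 M, redCost tl c π a * r (-a) =
      ∑ a ∈ Finset.Icc 1 M, c a * r (-a) +
        ∑ a ∈ Finset.Icc 1 M, r (-a) * (π (tl a) - π (tl (-a))) := by
    rw [← Finset.sum_add_distrib]
    exact Finset.sum_congr rfl fun a _ => by simp only [redCost]; ring
  have e₂ : ∑ a ∈ Finset.Icc 1 M, redCost tl c π a * g a =
      ∑ a ∈ Finset.Icc 1 M, c a * g a +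
        ∑ a ∈ Finset.Icc 1 M, g a * (π (tl a) - π (tl (-a))) := by
    rw [← Finset.sum_add_distrib]
    exact Finset.sum_congr rfl fun a _ => by simp only [redCost]; ring
  omega

/-- The arc `e` has residual capacity and leaves the set of marked vertices. -/
def Leaves (M : ℤ) (tl r mark : ℤ → ℤ) (e : ℤ) : Prop :=
  -M ≤ e ∧ e ≤ M ∧ 0 < r e ∧ mark (tl e) ≠ 0 ∧ mark (tl (-e)) = 0

/-- The marked vertices form a tree with root `w` of residual arcs with reduced cost `0`; the arc
`pred y` leads to `y` from a vertex with a smaller mark. -/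
structure Tree (n M : ℤ) (tl c r π mark pred : ℤ → ℤ) (w cnt : ℤ) : Prop where
  root : mark w ≠ 0
  pos : ∀ y, 0 ≤ y → y ≤ n → mark y ≠ 0 → 0 < mark y
  le : ∀ y, 0 ≤ y → y ≤ n → mark y ≤ cnt
  arc : ∀ y, 0 ≤ y → y ≤ n → mark y ≠ 0 → y ≠ w →
    -M ≤ pred y ∧ pred y ≤ M ∧ 0 < r (pred y) ∧ tl (-pred y) = y ∧ mark (tl (pred y)) ≠ 0 ∧
      mark (tl (pred y)) < mark y ∧ redCost tl c π (pred y) = 0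

/-- The potential `π` raised by `δ` at the unmarked vertices. -/
def raise (mark π : ℤ → ℤ) (δ : ℤ) (x : ℤ) : ℤ := if mark x = 0 then π x + δ else π x

/-! ### One step of the Dijkstra search -/

section Grow

variable {n M : ℤ} {tl c r π π' mark pred : ℤ → ℤ} {w cnt e : ℤ}

/-- Raising the unmarked side by `δ` lowers the reduced cost of leaving arcs by `δ`, raises that of
entering arcs by `δ` and keeps all others. Here `δ ≥ 0` is the least reduced cost of a leaving
residual arc, so nothing becomes negative. -/
theorem Opt.raise (hG : Good n M tl c) (h : Opt M tl c r π)
    (hδ : ∀ x, Leaves M tl r mark x → redCost tl c π e ≤ redCost tl c π x)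
    (he : Leaves M tl r mark e)
    (hπ : ∀ x, 0 ≤ x → x ≤ n → π' x = Residual.raise mark π (redCost tl c π e) x) :
    Opt M tl c r π' := by
  intro x h₁ h₂ h₃
  have h₄ := h x h₁ h₂ h₃
  have h₅ := h e he.1 he.2.1 he.2.2.1
  have h₆ := hδ x
  generalize hd : redCost tl c π e = δ at *
  simp only [redCost] at *
  rw [hπ _ (hG.tl_nonneg x h₁ h₂) (hG.tl_le x h₁ h₂),
    hπ _ (hG.tl_nonneg (-x) (by omega) (by omega)) (hG.tl_le (-x) (by omega) (by omega))]
  simp only [Residual.raise]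
  split_ifs with h₇ h₈ h₈
  · omega
  · omega
  · have := h₆ ⟨h₁, h₂, h₃, h₇, h₈⟩
    omega
  · omega

/-- The raise makes `e` tight, so its head can join the tree. Old tree arcs have both ends marked
and keep reduced cost `0`. The new mark `cnt + 1` exceeds all others, which keeps marks increasing
away from the root. -/
theorem Tree.grow (hG : Good n M tl c) (h : Tree n M tl c r π mark pred w cnt)
    (hcnt : 0 < cnt) (he : Leaves M tl r mark e)
    (hπ : ∀ x, 0 ≤ x → x ≤ n → π' x = Residual.raise mark π (redCost tl c π e) x) :
    Tree n M tl c r π' (Function.update mark (tl (-e)) (cnt + 1))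
      (Function.update pred (tl (-e)) e) w (cnt + 1) := by
  obtain ⟨h₁, h₂, h₃, h₄, h₅⟩ := he
  have b₁ := hG.tl_nonneg e h₁ h₂
  have b₂ := hG.tl_le e h₁ h₂
  refine ⟨?_, fun y hy₁ hy₂ => ?_, fun y hy₁ hy₂ => ?_, fun y hy₁ hy₂ => ?_⟩
  · rw [Function.update_apply]
    split_ifs
    exacts [by omega, h.root]
  · rw [Function.update_apply]
    split_ifs
    exacts [fun _ => by omega, h.pos y hy₁ hy₂]
  · rw [Function.update_apply]
    split_ifs
    exacts [le_rfl, (h.le y hy₁ hy₂).trans (by omega)]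
  · have ht : tl e ≠ tl (-e) := fun h => h₄ (h ▸ h₅)
    by_cases hy : y = tl (-e)
    · subst hy
      intro _ _
      simp only [Function.update_self, Function.update_of_ne ht]
      refine ⟨h₁, h₂, h₃, trivial, h₄, by have := h.le _ b₁ b₂; omega, ?_⟩
      simp only [redCost] at *
      rw [hπ _ b₁ b₂, hπ _ hy₁ hy₂, Residual.raise, Residual.raise, if_neg h₄, if_pos h₅]
      ring
    · simp only [Function.update_of_ne hy]
      intro h₆ h₇
      obtain ⟨a₁, a₂, a₃, a₄, a₅, a₆, a₇⟩ := h.arc y hy₁ hy₂ h₆ h₇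
      have hne : tl (pred y) ≠ tl (-e) := fun h => a₅ (h ▸ h₅)
      rw [Function.update_of_ne hne]
      refine ⟨a₁, a₂, a₃, a₄, a₅, a₆, ?_⟩
      simp only [redCost, a₄] at *
      rw [hπ _ (hG.tl_nonneg _ a₁ a₂) (hG.tl_le _ a₁ a₂), hπ _ hy₁ hy₂, Residual.raise,
        Residual.raise, if_neg a₅, if_neg h₆]
      exact a₇

end Grow

/-- The situation while one unit is pushed along the tree from `w` to the end vertex, which is
reached up to the vertex `x`; the arcs into vertices with marks up to that of `x` are unused. -/
structure Augmenting (n M : ℤ) (tl c r π mark pred : ℤ → ℤ) (w x : ℤ) : Prop where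
  nonneg : ∀ e, 0 ≤ r e
  opt : Opt M tl c r π
  exc : ∀ p, excess M tl r p = p x - p w
  x_nonneg : 0 ≤ x
  x_le : x ≤ n
  marked : mark x ≠ 0
  pos : ∀ y, 0 ≤ y → y ≤ n → mark y ≠ 0 → 0 < mark y
  arc : ∀ y, 0 ≤ y → y ≤ n → mark y ≠ 0 → y ≠ w → mark y ≤ mark x →
    -M ≤ pred y ∧ pred y ≤ M ∧ 0 < r (pred y) ∧ tl (-pred y) = y ∧ mark (tl (pred y)) ≠ 0 ∧
      mark (tl (pred y)) < mark y ∧ redCost tl c π (pred y) = 0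

/-- Pushing along `pred x` moves the surplus from `x` to the tail of that arc. Tree arcs still to be
used end in vertices of smaller mark than `x`; their heads differ from `x`, so they are not `pred x`
and keep their residual capacity. -/
theorem Augmenting.step {n M : ℤ} {tl c r π mark pred : ℤ → ℤ} {w x : ℤ} (hG : Good n M tl c)
    (h : Augmenting n M tl c r π mark pred w x) (hx : x ≠ w) :
    Augmenting n M tl c (push r (pred x)) π mark pred w (tl (pred x)) ∧
      pred x ≠ 0 ∧ 0 < mark (tl (pred x)) ∧ mark (tl (pred x)) < mark x := by
  obtain ⟨a₁, a₂, a₃, a₄, a₅, a₆, a₇⟩ := h.arc x h.x_nonneg h.x_le h.marked hx le_rfl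
  have he : pred x ≠ 0 := by
    intro h
    rw [h, neg_zero] at a₄
    rw [h, a₄] at a₆
    exact lt_irrefl _ a₆
  have b₁ := hG.tl_nonneg _ a₁ a₂
  have b₂ := hG.tl_le _ a₁ a₂
  refine ⟨⟨push_nonneg he h.nonneg a₃, h.opt.push hG he a₁ a₂ a₇, fun p => ?_, b₁, b₂,
    a₅, h.pos, fun y hy₁ hy₂ hy₃ hy₄ hy₅ => ?_⟩, he, h.pos _ b₁ b₂ a₅, a₆⟩
  · rw [excess_push he a₁ a₂, h.exc, a₄]
    ring
  · obtain ⟨c₁, c₂, c₃, c₄, c₅, c₆, c₇⟩ := h.arc y hy₁ hy₂ hy₃ hy₄ (by omega)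
    refine ⟨c₁, c₂, ?_, c₄, c₅, c₆, c₇⟩
    have : pred y ≠ pred x := by
      intro h
      rw [h, a₄] at c₄
      rw [c₄] at hy₅
      omega
    rw [push_apply he, if_neg this]
    split_ifs <;> omega

end Residual

/-! ### Repairing optimality by a shortest augmenting path

Variables: `2` number of vertices minus one, `5` number of arcs, `13` the arc under consideration,
`14` and `15` the ends of the path, `16` counter, `17` best arc, `18` its reduced cost, `19` arc,
`20` vertex. Arrays: `2` tails, `3` costs, `4` capacities, `5` residual capacities, `6` potentials,
`7` marks, `8` tree arcs. -/

namespace Ram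

open Residual

/-- The reduced cost of an arc. -/
def redCostExpr (e : Expr) : Expr :=
  .get 3 e + .get 6 (.get 2 e) - .get 6 (.get 2 (-e))

@[simp] theorem eval_redCostExpr (σ : State) (e : Expr) :
    (redCostExpr e).eval σ = redCost (σ.arr 2) (σ.arr 3) (σ.arr 6) (e.eval σ) := by
  simp [redCostExpr, redCost]

/-- Find a cheapest arc that leaves the marked vertices. -/
def scan : Program :=
  .assign 17 (-.var 13) ;; .assign 18 (redCostExpr (.var 17)) ;;
  .forTo 19 (-.var 5) (.var 5 + .const 1)
    (.ite (.op .lt (.const 0) (.get 5 (.var 19)))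
      (.ite (.get 7 (.get 2 (.var 19)))
        (.ite (.get 7 (.get 2 (-.var 19))) .skip
          (.ite (.op .lt (redCostExpr (.var 19)) (.var 18))
            (.assign 17 (.var 19) ;; .assign 18 (redCostExpr (.var 19))) .skip)) .skip) .skip)

/-- The hypothesis `ha` provides the initial candidate for the minimum. In the search it always
holds, because the reverse of the arc `13` is residual and joins the root directly to the target. -/
theorem scan_spec {σ : State} {N : ℕ} (hM : 0 ≤ σ.var 5) (hN : 2 * σ.var 5 + 1 ≤ N)
    (ha : Leaves (σ.var 5) (σ.arr 2) (σ.arr 5) (σ.arr 7) (-σ.var 13)) :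
    Wp scan σ N fun τ => Leaves (σ.var 5) (σ.arr 2) (σ.arr 5) (σ.arr 7) (τ.var 17) ∧
      τ.var 18 = redCost (σ.arr 2) (σ.arr 3) (σ.arr 6) (τ.var 17) ∧
      ∀ x, Leaves (σ.var 5) (σ.arr 2) (σ.arr 5) (σ.arr 7) x →
        redCost (σ.arr 2) (σ.arr 3) (σ.arr 6) (τ.var 17) ≤
          redCost (σ.arr 2) (σ.arr 3) (σ.arr 6) x := by
  refine Wp.seq₀ (Wp.assign (Wp.seq₀ (Wp.assign (Wp.mono (T := N * (0 + 1)) ?_ (by simp)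
    fun _ _ h => h))))
  refine Wp.forTo (L := -σ.var 5) (H := σ.var 5 + 1)
    (J := fun i τ => Leaves (σ.var 5) (σ.arr 2) (σ.arr 5) (σ.arr 7) (τ.var 17) ∧
      τ.var 18 = redCost (σ.arr 2) (σ.arr 3) (σ.arr 6) (τ.var 17) ∧
      ∀ x < i, Leaves (σ.var 5) (σ.arr 2) (σ.arr 5) (σ.arr 7) x →
        redCost (σ.arr 2) (σ.arr 3) (σ.arr 6) (τ.var 17) ≤
          redCost (σ.arr 2) (σ.arr 3) (σ.arr 6) x) rfl (by simp) ?_ ?_ ?_ ?_ ?_ ?_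
  · omega
  · omega
  · intro τ hf
    have h5 := hf.var 5 rfl
    simp at h5 ⊢
    exact h5
  · simp only [Expr.eval_neg, Expr.eval_var, State.setVar_var, State.setVar_arr, eval_redCostExpr]
    simp only [Nat.reduceEqDiff, if_false, if_true]
    exact ⟨ha, trivial, fun x hx h => absurd h.1 (by omega)⟩
  · rintro i τ hf h₁ h₂ h₃ ⟨h₄, h₅, h₆⟩
    have harr : τ.arr = σ.arr := funext fun b => hf.arr b rfl
    have skip : ¬ Leaves (σ.var 5) (σ.arr 2) (σ.arr 5) (σ.arr 7) i →
        ∀ x < i + 1, Leaves (σ.var 5) (σ.arr 2) (σ.arr 5) (σ.arr 7) x →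
        redCost (σ.arr 2) (σ.arr 3) (σ.arr 6) (τ.var 17) ≤
          redCost (σ.arr 2) (σ.arr 3) (σ.arr 6) x := by
      intro hi x hx hl
      rcases (Int.lt_add_one_iff.1 hx).eq_or_lt with rfl | hx
      exacts [absurd hl hi, h₆ x hx hl]
    refine Wp.ite (fun c₁ => Wp.ite (fun c₂ => Wp.ite (fun c₃ => Wp.skip ?_) fun c₃ =>
      Wp.ite (fun c₄ => Wp.seq₀ (Wp.assign (Wp.assign ?_))) fun c₄ => Wp.skip ?_)
      fun c₂ => Wp.skip ?_) fun c₁ => Wp.skip ?_ <;>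
    simp [h₃, harr] at * <;> clear hf harr
    · exact ⟨h₄, h₅, skip fun h => c₃ h.2.2.2.2⟩
    · refine ⟨⟨h₁, by omega, c₁, c₂, c₃⟩, fun x hx hl => ?_⟩
      rcases (show x ≤ i by omega).eq_or_lt with rfl | hx
      · exact le_rfl
      · have := h₆ x hx hl
        omega
    · refine ⟨h₄, h₅, fun x hx hl => ?_⟩
      rcases (show x ≤ i by omega).eq_or_lt with rfl | hx
      · omega
      · exact h₆ x hx hl
    · exact ⟨h₄, h₅, skip fun h => h.2.2.2.1 c₂⟩
    · exact ⟨h₄, h₅, skip fun h => by have := h.2.2.1; omega⟩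
  · rintro τ hf - ⟨h₄, h₅, h₆⟩
    exact ⟨h₄, h₅, fun x hl => h₆ x (by have := hl.2.1; omega) hl⟩

/-- Raise the potentials of the unmarked vertices. -/
def raisePotentials : Program :=
  .forTo 20 (.const 0) (.var 2 + .const 1)
    (.ite (.get 7 (.var 20)) .skip (.store 6 (.var 20) (.get 6 (.var 20) + .var 18)))

theorem raisePotentials_spec {σ : State} {N : ℕ} (hn : 0 ≤ σ.var 2) (hN : σ.var 2 + 1 ≤ N) :
    Wp raisePotentials σ N fun τ => ∀ x, 0 ≤ x → x ≤ σ.var 2 →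
      τ.arr 6 x = raise (σ.arr 7) (σ.arr 6) (σ.var 18) x := by
  refine Wp.mono (T := N * (0 + 1)) ?_ (by simp) fun _ _ h => h
  refine Wp.forTo (L := 0) (H := σ.var 2 + 1)
    (J := fun i τ => ∀ x, τ.arr 6 x = if 0 ≤ x ∧ x < i then
      raise (σ.arr 7) (σ.arr 6) (σ.var 18) x else σ.arr 6 x) rfl (by simp) ?_ ?_ ?_ ?_ ?_ ?_
  · omega
  · omega
  · intro τ hf
    simp [hf.var 2 rfl]
  · intro x
    rw [if_neg (by omega)]
    rfl
  · intro i τ hf h₁ h₂ h₃ h₄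
    have h7 := hf.arr 7 rfl
    have h18 := hf.var 18 rfl
    refine Wp.ite (fun c => Wp.skip fun x => ?_) fun c => Wp.store fun x => ?_ <;>
    simp only [Expr.eval_get, Expr.eval_var, h7, h₃] at c <;>
    simp only [State.setVar_arr, State.setArr_arr, if_true, Expr.eval_add, Expr.eval_var,
      Expr.eval_get, h18, h₃, Function.update_apply, h₄] <;>
    rcases eq_or_ne x i with rfl | hx
    · rw [if_neg (by omega), if_pos (by omega), raise, if_neg c]
    · split_ifs <;> first | rfl | omega
    · rw [if_pos rfl, if_neg (by omega), if_pos (by omega), raise, if_pos c]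
    · split_ifs <;> first | rfl | omega
  · intro τ hf _ h x h₁ h₂
    rw [h, if_pos (by omega)]

/-- Unmark all vertices. -/
def clearMarks : Program :=
  .forTo 20 (.const 0) (.var 2 + .const 1) (.store 7 (.var 20) (.const 0))

theorem clearMarks_spec {σ : State} {N : ℕ} (hn : 0 ≤ σ.var 2) (hN : σ.var 2 + 1 ≤ N) :
    Wp clearMarks σ N fun τ => ∀ x, 0 ≤ x → x ≤ σ.var 2 → τ.arr 7 x = 0 := by
  refine Wp.mono (T := N * (0 + 1)) ?_ (by simp) fun _ _ h => h
  refine Wp.forTo (L := 0) (H := σ.var 2 + 1)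
    (J := fun i τ => ∀ x, 0 ≤ x → x < i → τ.arr 7 x = 0) rfl (by simp) ?_ ?_ ?_ ?_ ?_ ?_
  · omega
  · omega
  · intro τ hf
    simp [hf.var 2 rfl]
  · intro x h₁ h₂
    omega
  · intro i τ hf h₁ h₂ h₃ h₄
    refine Wp.store fun x hx₁ hx₂ => ?_
    simp only [State.setVar_arr, State.setArr_arr, if_true, Expr.eval_var, h₃,
      Function.update_apply, Expr.eval_const]
    split_ifs
    exacts [rfl, h₄ x hx₁ (by omega)]
  · intro τ hf _ h x h₁ h₂
    exact h x h₁ (by omega)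

/-- Mark vertices until `15` is marked. -/
def grow : Program :=
  .loop (.op .eq (.get 7 (.var 15)) (.const 0))
    (scan ;; raisePotentials ;; .assign 16 (.var 16 + .const 1) ;;
      .store 7 (.get 2 (-.var 17)) (.var 16) ;; .store 8 (.get 2 (-.var 17)) (.var 17))

/-- The vertices of a network are unmarked. -/
noncomputable def unmarked (n : ℤ) (mark : ℤ → ℤ) : ℕ :=
  ((Finset.Icc 0 n).filter fun y => mark y = 0).card

theorem unmarked_update_lt {n : ℤ} {mark : ℤ → ℤ} {y z : ℤ} (h₁ : 0 ≤ y) (h₂ : y ≤ n)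
    (h : mark y = 0) (hz : z ≠ 0) :
    unmarked n (Function.update mark y z) < unmarked n mark := by
  refine Finset.card_lt_card ⟨fun x => ?_, fun hs => ?_⟩
  · simp only [Finset.mem_filter, Function.update_apply]
    split_ifs with hx
    · exact fun h => absurd h.2 hz
    · exact fun h => h
  · have hy : y ∈ (Finset.Icc 0 n).filter fun y => mark y = 0 := by simp [h₁, h₂, h]
    have := hs hy
    simp only [Finset.mem_filter, Function.update_self] at this
    exact hz this.2

/-- Each round marks one more vertex, and a leaving arc exists as long as the target `15` is
unmarked, namely the reverse of the arc `13`. The sum of the counter and the number of unmarked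
vertices never exceeds the number `n + 1` of vertices, which bounds the rounds and all marks. -/
theorem grow_spec {σ : State} {N : ℕ} (hn : 0 ≤ σ.var 2) (hN : σ.var 2 + 1 ≤ N)
    (hM : 0 ≤ σ.var 5) (hN' : 2 * σ.var 5 + 1 ≤ N)
    (hG : Good (σ.var 2) (σ.var 5) (σ.arr 2) (σ.arr 3))
    (hO : Opt (σ.var 5) (σ.arr 2) (σ.arr 3) (σ.arr 5) (σ.arr 6))
    (hT : Tree (σ.var 2) (σ.var 5) (σ.arr 2) (σ.arr 3) (σ.arr 5) (σ.arr 6) (σ.arr 7) (σ.arr 8)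
      (σ.var 14) (σ.var 16))
    (hcnt : 0 < σ.var 16) (hu : σ.var 16 + unmarked (σ.var 2) (σ.arr 7) ≤ σ.var 2 + 1)
    (h₁ : 1 ≤ σ.var 13) (h₂ : σ.var 13 ≤ σ.var 5) (h₃ : 0 < σ.arr 5 (-σ.var 13))
    (h₄ : σ.arr 2 (-σ.var 13) = σ.var 14) (h₅ : σ.arr 2 (σ.var 13) = σ.var 15) :
    Wp grow σ (N * (N + N + 1)) fun τ =>
      Opt (σ.var 5) (σ.arr 2) (σ.arr 3) (σ.arr 5) (τ.arr 6) ∧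
      Tree (σ.var 2) (σ.var 5) (σ.arr 2) (σ.arr 3) (σ.arr 5) (τ.arr 6) (τ.arr 7) (τ.arr 8)
        (σ.var 14) (τ.var 16) ∧ τ.var 16 ≤ σ.var 2 + 1 ∧ τ.arr 7 (σ.var 15) ≠ 0 := by
  refine Wp.mono (T := unmarked (σ.var 2) (σ.arr 7) * (N + N + 1)) ?_
    (Nat.mul_le_mul_right _ (by omega)) fun _ _ h => h
  refine Wp.loop (fun k τ => Opt (σ.var 5) (σ.arr 2) (σ.arr 3) (σ.arr 5) (τ.arr 6) ∧
      Tree (σ.var 2) (σ.var 5) (σ.arr 2) (σ.arr 3) (σ.arr 5) (τ.arr 6) (τ.arr 7) (τ.arr 8)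
        (σ.var 14) (τ.var 16) ∧ k = unmarked (σ.var 2) (τ.arr 7) ∧
        0 < τ.var 16 ∧ τ.var 16 + k ≤ σ.var 2 + 1) ⟨hO, hT, rfl, hcnt, hu⟩ ?_ ?_
  · rintro k τ hf ⟨i₁, i₂, rfl, i₃, i₄⟩ he
    have v2 := hf.var 2 rfl
    have v5 := hf.var 5 rfl
    have v13 := hf.var 13 rfl
    have v15 := hf.var 15 rfl
    have a2 := hf.arr 2 rfl
    have a3 := hf.arr 3 rfl
    have a5 := hf.arr 5 rfl
    simp only [Expr.eval_eq, Expr.eval_get, Expr.eval_var, Expr.eval_const, v15, ne_eq,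
      ite_eq_right_iff, one_ne_zero, imp_false, not_not] at he
    have hs := scan_spec (σ := τ) (N := N) (by omega) (by omega)
    rw [v5, v13, a2, a3, a5] at hs
    specialize hs ⟨by omega, by omega, h₃, by rw [h₄]; exact i₂.root, by rw [neg_neg, h₅, he]⟩
    refine Wp.seq (hs.mono le_rfl fun υ hυ ⟨s₁, s₂, s₃⟩ => ?_)
    have w2 := (hυ.var 2 rfl).trans v2
    have w16 := hυ.var 16 rfl
    have b2 := (hυ.arr 2 rfl).trans a2
    have b6 := hυ.arr 6 rfl
    have b7 := hυ.arr 7 rfl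
    have b8 := hυ.arr 8 rfl
    have hr := raisePotentials_spec (σ := υ) (N := N) (by omega) (by omega)
    rw [w2, s₂, b6, b7] at hr
    refine Wp.seq (T₂ := 0) (hr.mono le_rfl fun ω hω hπ => ?_)
    have x17 := hω.var 17 rfl
    have x16 := (hω.var 16 rfl).trans w16
    have x7 := (hω.arr 7 rfl).trans b7
    have x8 := (hω.arr 8 rfl).trans b8
    have x2 := (hω.arr 2 rfl).trans b2
    refine Wp.seq₀ (Wp.assign (Wp.seq₀ (Wp.store (Wp.store
      ⟨_, ?_, ?_, ?_, rfl, ?_, ?_⟩))))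
    all_goals
      simp [x17, x16, x7, x8, x2]
    · exact unmarked_update_lt (hG.tl_nonneg _ (by have := s₁.2.1; omega) (by have := s₁.1; omega))
        (hG.tl_le _ (by have := s₁.2.1; omega) (by have := s₁.1; omega)) s₁.2.2.2.2 (by omega)
    · exact i₁.raise hG s₃ s₁ hπ
    · exact i₂.grow hG i₃ s₁ hπ
    · omega
    · have := unmarked_update_lt (n := σ.var 2) (z := τ.var 16 + 1)
        (hG.tl_nonneg (-υ.var 17) (by have := s₁.2.1; omega) (by have := s₁.1; omega))
        (hG.tl_le _ (by have := s₁.2.1; omega) (by have := s₁.1; omega)) s₁.2.2.2.2 (by omega)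
      omega
  · rintro k τ hf ⟨i₁, i₂, rfl, i₃, i₄⟩ he
    have v15 := hf.var 15 rfl
    simp only [Expr.eval_eq, Expr.eval_get, Expr.eval_var, Expr.eval_const, v15,
      ite_eq_right_iff, one_ne_zero, imp_false] at he
    exact ⟨i₁, i₂, by omega, he⟩

/-- Push one unit along the tree path from `14` to `15`. -/
def augment : Program :=
  .loop (.var 15 - .var 14)
    (.assign 19 (.get 8 (.var 15)) ;;
      .store 5 (.var 19) (.get 5 (.var 19) - .const 1) ;;
      .store 5 (-.var 19) (.get 5 (-.var 19) + .const 1) ;;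
      .assign 15 (.get 2 (.var 19)))

/-- Marks are positive and decrease strictly along the path back to the root, so the mark of its end
bounds the number of pushes. At the root the surplus meets the deficit and the excess vanishes. -/
theorem augment_spec {σ : State} {N : ℕ} (hN : σ.arr 7 (σ.var 15) ≤ N)
    (hG : Good (σ.var 2) (σ.var 5) (σ.arr 2) (σ.arr 3))
    (hA : Augmenting (σ.var 2) (σ.var 5) (σ.arr 2) (σ.arr 3) (σ.arr 5) (σ.arr 6) (σ.arr 7)
      (σ.arr 8) (σ.var 14) (σ.var 15)) :
    Wp augment σ N fun τ => (∀ x, 0 ≤ τ.arr 5 x) ∧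
      Opt (σ.var 5) (σ.arr 2) (σ.arr 3) (τ.arr 5) (σ.arr 6) ∧
      (∀ p, excess (σ.var 5) (σ.arr 2) (τ.arr 5) p = 0) ∧
      ∀ x, τ.arr 5 x + τ.arr 5 (-x) = σ.arr 5 x + σ.arr 5 (-x) := by
  refine Wp.mono (T := (σ.arr 7 (σ.var 15)).toNat * (0 + 1)) ?_ (by omega) fun _ _ h => h
  refine Wp.loop (fun k τ => Augmenting (σ.var 2) (σ.var 5) (σ.arr 2) (σ.arr 3) (τ.arr 5)
    (σ.arr 6) (σ.arr 7) (σ.arr 8) (σ.var 14) (τ.var 15) ∧ k = (σ.arr 7 (τ.var 15)).toNat ∧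
    ∀ x, τ.arr 5 x + τ.arr 5 (-x) = σ.arr 5 x + σ.arr 5 (-x)) ⟨hA, rfl, fun _ => rfl⟩ ?_ ?_
  · rintro k τ hf ⟨i₁, rfl, i₂⟩ he
    have v14 := hf.var 14 rfl
    have a2 := hf.arr 2 rfl
    have a8 := hf.arr 8 rfl
    simp only [Expr.eval_sub, Expr.eval_var, v14] at he
    obtain ⟨h₁, h₂, h₃, h₄⟩ := i₁.step hG (by omega)
    refine Wp.seq₀ (Wp.assign (Wp.seq₀ (Wp.store (Wp.seq₀ (Wp.store (Wp.assign
      ⟨(σ.arr 7 (σ.arr 2 (σ.arr 8 (τ.var 15)))).toNat, by omega, ?_⟩))))))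
    have hp : Function.update (Function.update (τ.arr 5) (σ.arr 8 (τ.var 15))
        (τ.arr 5 (σ.arr 8 (τ.var 15)) - 1)) (-σ.arr 8 (τ.var 15))
        (τ.arr 5 (-σ.arr 8 (τ.var 15)) + 1) = push (τ.arr 5) (σ.arr 8 (τ.var 15)) := rfl
    have hne : -σ.arr 8 (τ.var 15) ≠ σ.arr 8 (τ.var 15) := by omega
    simp [a2, a8, hne, hp]
    refine ⟨h₁, fun x => ?_⟩
    rw [push_add_push_neg h₂, i₂]
  · rintro k τ hf ⟨i₁, rfl, i₂⟩ he
    have v14 := hf.var 14 rfl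
    simp only [Expr.eval_sub, Expr.eval_var, v14] at he
    refine ⟨i₁.nonneg, i₁.opt, fun p => ?_, i₂⟩
    rw [i₁.exc, sub_eq_zero.1 he, sub_self]

/-- Increase the capacity of the arc `13` by one and restore optimality. -/
def increaseCap : Program :=
  .ite (.op .lt (redCostExpr (.var 13)) (.const 0))
    (.store 5 (-.var 13) (.get 5 (-.var 13) + .const 1) ;;
      .assign 14 (.get 2 (-.var 13)) ;; .assign 15 (.get 2 (.var 13)) ;;
      clearMarks ;; .store 7 (.var 14) (.const 1) ;; .assign 16 (.const 1) ;; grow ;; augment)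
    (.store 5 (.var 13) (.get 5 (.var 13) + .const 1))

/-- If the arc has nonnegative reduced cost, the new unit may stay unused. Otherwise it is filled at
once, which makes only the reverse arc residual, of positive reduced cost, and the resulting
imbalance between its two ends is removed along a tight path from head to tail. The path may be the
reverse arc itself. -/
theorem increaseCap_spec {σ : State} {N : ℕ} (hn : 0 ≤ σ.var 2) (hN : σ.var 2 + 1 ≤ N)
    (hN' : 2 * σ.var 5 + 1 ≤ N)
    (hG : Good (σ.var 2) (σ.var 5) (σ.arr 2) (σ.arr 3))
    (hr : ∀ x, 0 ≤ σ.arr 5 x)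
    (hO : Opt (σ.var 5) (σ.arr 2) (σ.arr 3) (σ.arr 5) (σ.arr 6))
    (hE : ∀ p, excess (σ.var 5) (σ.arr 2) (σ.arr 5) p = 0)
    (h₁ : 1 ≤ σ.var 13) (h₂ : σ.var 13 ≤ σ.var 5) :
    Wp increaseCap σ (N + (N * (N + N + 1) + N)) fun τ => (∀ x, 0 ≤ τ.arr 5 x) ∧
      Opt (σ.var 5) (σ.arr 2) (σ.arr 3) (τ.arr 5) (τ.arr 6) ∧
      (∀ p, excess (σ.var 5) (σ.arr 2) (τ.arr 5) p = 0) ∧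
      ∀ x, 0 < x → τ.arr 5 x + τ.arr 5 (-x) =
        σ.arr 5 x + σ.arr 5 (-x) + if x = σ.var 13 then 1 else 0 := by
  refine Wp.ite (fun c => ?_) fun c => Wp.store ?_
  · simp only [Expr.eval_lt, eval_redCostExpr, Expr.eval_var, Expr.eval_const, ne_eq,
      ite_eq_right_iff, one_ne_zero, imp_false, not_not] at c
    set r := Function.update (σ.arr 5) (-σ.var 13) (σ.arr 5 (-σ.var 13) + 1) with hrdef
    have rpos : ∀ x, 0 ≤ r x := fun x => by
      have := hr x
      have := hr (-σ.var 13)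
      rw [hrdef, Function.update_apply]
      split_ifs <;> omega
    have ropt : Opt (σ.var 5) (σ.arr 2) (σ.arr 3) r (σ.arr 6) := by
      intro e e₁ e₂ e₃
      by_cases he : e = -σ.var 13
      · rw [he, hG.redCost_neg (by omega) h₂]
        omega
      · rw [hrdef, Function.update_of_ne he] at e₃
        exact hO e e₁ e₂ e₃
    -- The additional unit of flow creates a surplus of outflow at the tail and a deficit at the
    -- head of arc `13`.
    have rexc : ∀ p, excess (σ.var 5) (σ.arr 2) r p =
        p (σ.arr 2 (σ.var 13)) - p (σ.arr 2 (-σ.var 13)) := by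
      intro p
      have hm : σ.var 13 ∈ Finset.Icc 1 (σ.var 5) := by simp; omega
      have := hE p
      rw [excess, ← Finset.add_sum_erase _ _ hm] at this ⊢
      rw [Finset.sum_congr rfl (g := fun a => σ.arr 5 (-a) *
        (p (σ.arr 2 a) - p (σ.arr 2 (-a))))]
      · rw [hrdef, Function.update_self]
        linarith
      · intro a ha
        rw [hrdef, Function.update_of_ne]
        have := Finset.ne_of_mem_erase ha
        omega
    have tw₁ := hG.tl_nonneg (-σ.var 13) (by omega) (by omega)
    have tw₂ := hG.tl_le (-σ.var 13) (by omega) (by omega)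
    have tv₁ := hG.tl_nonneg (σ.var 13) (by omega) (by omega)
    have tv₂ := hG.tl_le (σ.var 13) (by omega) (by omega)
    refine Wp.seq₀ (Wp.store (Wp.seq₀ (Wp.assign (Wp.seq₀ (Wp.assign ?_)))))
    simp only [State.setArr_arr, State.setArr_var, State.setVar_arr, State.setVar_var,
      Expr.eval_neg, Expr.eval_var, Expr.eval_get, Expr.eval_add, Expr.eval_const,
      Nat.reduceEqDiff, if_false]
    refine Wp.seq ((clearMarks_spec (by simpa using hn) (by simpa using hN)).mono le_rfl
      fun τ hτ hm => ?_)
    have v2 := hτ.var 2 rfl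
    have v5 := hτ.var 5 rfl
    have v13 := hτ.var 13 rfl
    have v14 := hτ.var 14 rfl
    have v15 := hτ.var 15 rfl
    have a2 := hτ.arr 2 rfl
    have a3 := hτ.arr 3 rfl
    have a5 := hτ.arr 5 rfl
    have a6 := hτ.arr 6 rfl
    simp [← hrdef] at v2 v5 v13 v14 v15 a2 a3 a5 a6 hm
    refine Wp.seq₀ (Wp.store (Wp.seq₀ (Wp.assign ?_)))
    simp only [Expr.eval_const, Expr.eval_var]
    set υ := (τ.setArr 7 (τ.var 14) 1).setVar 16 1 with hυ
    have u2 : υ.var 2 = σ.var 2 := by simp [hυ, v2]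
    have u5 : υ.var 5 = σ.var 5 := by simp [hυ, v5]
    have u13 : υ.var 13 = σ.var 13 := by simp [hυ, v13]
    have u14 : υ.var 14 = σ.arr 2 (-σ.var 13) := by simp [hυ, v14]
    have u15 : υ.var 15 = σ.arr 2 (σ.var 13) := by simp [hυ, v15]
    have u16 : υ.var 16 = 1 := by simp [hυ]
    have c2 : υ.arr 2 = σ.arr 2 := by simp [hυ, a2]
    have c3 : υ.arr 3 = σ.arr 3 := by simp [hυ, a3]
    have c5 : υ.arr 5 = r := by simp [hυ, a5]
    have c6 : υ.arr 6 = σ.arr 6 := by simp [hυ, a6]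
    have c7 : ∀ x, 0 ≤ x → x ≤ σ.var 2 →
        υ.arr 7 x = if x = σ.arr 2 (-σ.var 13) then 1 else 0 := by
      intro x h₁ h₂
      simp only [hυ, State.setVar_arr, State.setArr_arr, if_true, v14, Function.update_apply]
      rw [hm x h₁ h₂]
    have hg := grow_spec (σ := υ) (N := N)
    rw [u2, u5, u13, u14, u15, u16, c2, c3, c5, c6] at hg
    have hcard : unmarked (σ.var 2) (υ.arr 7) < (σ.var 2 + 1).toNat := by
      rw [unmarked, show (σ.var 2 + 1).toNat = (Finset.Icc 0 (σ.var 2)).card by simp]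
      refine Finset.card_lt_card (Finset.filter_ssubset.2
        ⟨σ.arr 2 (-σ.var 13), by simp; omega, ?_⟩)
      rw [c7 _ tw₁ tw₂, if_pos rfl]
      exact one_ne_zero
    specialize hg hn hN (by omega) hN' hG ropt ⟨?_, ?_, ?_, ?_⟩ one_pos (by omega) h₁ h₂
      (by rw [hrdef, Function.update_self]; have := hr (-σ.var 13); omega) rfl rfl
    · rw [c7 _ tw₁ tw₂, if_pos rfl]
      exact one_ne_zero
    · intro y h₁ h₂
      rw [c7 y h₁ h₂]
      split_ifs <;> omega
    · intro y h₁ h₂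
      rw [c7 y h₁ h₂]
      split_ifs <;> omega
    · intro y h₁ h₂ h₃ h₄
      rw [c7 y h₁ h₂, if_neg h₄] at h₃
      exact absurd rfl h₃
    refine Wp.seq (hg.mono le_rfl fun ω hω ⟨g₁, g₂, g₃, g₄⟩ => ?_)
    have x2 := (hω.var 2 rfl).trans u2
    have x5 := (hω.var 5 rfl).trans u5
    have x14 := (hω.var 14 rfl).trans u14
    have x15 := (hω.var 15 rfl).trans u15
    have d2 := (hω.arr 2 rfl).trans c2
    have d3 := (hω.arr 3 rfl).trans c3
    have d5 := (hω.arr 5 rfl).trans c5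
    have ha := augment_spec (σ := ω) (N := N)
    rw [x2, x5, x14, x15, d2, d3, d5] at ha
    refine (ha ((g₂.le _ tv₁ tv₂).trans (by omega)) hG ⟨rpos, g₁, rexc, tv₁, tv₂, g₄, g₂.pos,
      fun y h₁ h₂ h₃ h₄ _ => g₂.arc y h₁ h₂ h₃ h₄⟩).mono le_rfl fun ψ hψ ⟨k₁, k₂, k₃, k₄⟩ =>
      ⟨k₁, ?_, k₃, fun x hx => ?_⟩
    · rw [hψ.arr 6 rfl]
      exact k₂
    · rw [k₄, hrdef]
      simp only [Function.update_apply]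
      rw [if_neg (by omega)]
      by_cases h : x = σ.var 13
      · subst h
        rw [if_pos rfl, if_pos rfl]
        ring
      · rw [if_neg h, if_neg (by omega), add_zero]
  · simp only [Expr.eval_lt, eval_redCostExpr, Expr.eval_var, Expr.eval_const,
      ite_eq_right_iff, one_ne_zero, imp_false, not_lt] at c
    simp only [State.setArr_arr, Expr.eval_var, Expr.eval_add, Expr.eval_get, Expr.eval_const,
      if_true, Nat.reduceEqDiff, if_false]
    refine ⟨fun x => ?_, fun e e₁ e₂ e₃ => ?_, fun p => ?_, fun x hx => ?_⟩
    · have := hr x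
      have := hr (σ.var 13)
      rw [Function.update_apply]
      split_ifs <;> omega
    · by_cases he : e = σ.var 13
      · rw [he]
        exact c
      · rw [Function.update_of_ne he] at e₃
        exact hO e e₁ e₂ e₃
    · rw [← hE p, excess, excess]
      refine Finset.sum_congr rfl fun a ha => ?_
      rw [Finset.mem_Icc] at ha
      rw [Function.update_of_ne (by omega)]
    · simp only [Function.update_apply]
      rw [if_neg (show ¬ -x = σ.var 13 by omega)]
      split_ifs with h
      · subst h; ring
      · ring

end Ram

/-! ### Capacity scaling

Variable `10` is the scale `D`, a power of two. -/

namespace Ram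

open Residual

/-- The arrays hold an optimal circulation for the capacities `u`. -/
structure Solved (M : ℤ) (tl c u r π : ℤ → ℤ) : Prop where
  nonneg : ∀ x, 0 ≤ r x
  opt : Opt M tl c r π
  exc : ∀ p, excess M tl r p = 0
  cap : ∀ a, 1 ≤ a → a ≤ M → r a + r (-a) = u a

/-- Double all residual capacities. -/
def doubleRes : Program :=
  .forTo 13 (-.var 5) (.var 5 + .const 1)
    (.store 5 (.var 13) (.get 5 (.var 13) + .get 5 (.var 13)))

/-- Increase all capacities to the current scale. -/
def increaseCaps : Program :=
  .forTo 13 (.const 1) (.var 5 + .const 1)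
    (.ite (.op .lt (.get 5 (.var 13) + .get 5 (-.var 13)) (.get 4 (.var 13) / .var 10))
      increaseCap .skip)

/-- Capacity scaling. -/
def scaling : Program :=
  .loop (.op .lt (.const 1) (.var 10))
    (.assign 10 (.var 10 / .const 2) ;; doubleRes ;; increaseCaps)

theorem doubleRes_spec {σ : State} {N : ℕ} (hM : 0 ≤ σ.var 5) (hN : 2 * σ.var 5 + 1 ≤ N) :
    Wp doubleRes σ N fun τ => ∀ x, τ.arr 5 x =
      if -σ.var 5 ≤ x ∧ x ≤ σ.var 5 then 2 * σ.arr 5 x else σ.arr 5 x := by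
  refine Wp.mono (T := N * (0 + 1)) ?_ (by simp) fun _ _ h => h
  refine Wp.forTo (L := -σ.var 5) (H := σ.var 5 + 1)
    (J := fun i τ => ∀ x, τ.arr 5 x = if -σ.var 5 ≤ x ∧ x < i then 2 * σ.arr 5 x else σ.arr 5 x)
    rfl (by simp) ?_ ?_ ?_ ?_ ?_ ?_
  · omega
  · omega
  · intro τ hf
    simp [hf.var 5 rfl]
  · intro x
    rw [if_neg (by omega)]
    rfl
  · intro i τ hf h₁ h₂ h₃ h₄
    refine Wp.store fun x => ?_
    simp only [State.setVar_arr, State.setArr_arr, if_true, Expr.eval_add, Expr.eval_var,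
      Expr.eval_get, h₃, Function.update_apply, h₄]
    rcases eq_or_ne x i with rfl | hx
    · rw [if_pos rfl, if_neg (by omega), if_pos (by omega)]
      ring
    · split_ifs <;> first | rfl | omega
  · intro τ hf _ h x
    rw [h]
    split_ifs <;> first | rfl | omega

/-- Doubling does not change which arcs are residual, so the same potential remains a certificate.
-/
theorem Solved.double {M : ℤ} {tl c u r r' π : ℤ → ℤ} (h : Solved M tl c u r π)
    (hr : ∀ x, r' x = if -M ≤ x ∧ x ≤ M then 2 * r x else r x) :
    Solved M tl c (fun a => 2 * u a) r' π := by
  refine ⟨fun x => ?_, fun e h₁ h₂ h₃ => ?_, fun p => ?_, fun a h₁ h₂ => ?_⟩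
  · have := h.nonneg x
    rw [hr]
    split_ifs <;> omega
  · rw [hr, if_pos ⟨h₁, h₂⟩] at h₃
    exact h.opt e h₁ h₂ (by omega)
  · have := h.exc p
    rw [excess] at this ⊢
    rw [← mul_zero 2, ← this, Finset.mul_sum]
    refine Finset.sum_congr rfl fun a ha => ?_
    rw [Finset.mem_Icc] at ha
    rw [hr, if_pos (by omega)]
    ring
  · rw [hr, hr, if_pos (by omega), if_pos (by omega), ← h.cap a h₁ h₂]
    ring

/-- With `q = u / D`, the doubled capacity `2 * (q / 2)` falls short of `q` by `0` or `1`, so one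
unit per arc is enough. -/
theorem increaseCaps_spec {σ : State} {N : ℕ} (hn : 0 ≤ σ.var 2) (hN : σ.var 2 + 1 ≤ N)
    (hM : 0 ≤ σ.var 5) (hN' : 2 * σ.var 5 + 1 ≤ N)
    (hG : Good (σ.var 2) (σ.var 5) (σ.arr 2) (σ.arr 3))
    (hS : Solved (σ.var 5) (σ.arr 2) (σ.arr 3) (fun a => 2 * (σ.arr 4 a / σ.var 10 / 2))
      (σ.arr 5) (σ.arr 6)) :
    Wp increaseCaps σ (N * (N + (N * (N + N + 1) + N) + 1)) fun τ =>
      Solved (σ.var 5) (σ.arr 2) (σ.arr 3) (fun a => σ.arr 4 a / σ.var 10)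
        (τ.arr 5) (τ.arr 6) := by
  refine Wp.forTo (L := 1) (H := σ.var 5 + 1)
    (J := fun i τ => Solved (σ.var 5) (σ.arr 2) (σ.arr 3)
      (fun a => if a < i then σ.arr 4 a / σ.var 10 else 2 * (σ.arr 4 a / σ.var 10 / 2))
      (τ.arr 5) (τ.arr 6)) rfl (by simp) ?_ ?_ ?_ ?_ ?_ ?_
  · omega
  · omega
  · intro τ hf
    simp [hf.var 5 rfl]
  · refine ⟨hS.nonneg, hS.opt, hS.exc, fun a h₁ h₂ => ?_⟩
    simp only [State.setVar_arr]
    rw [hS.cap a h₁ h₂, if_neg (by omega)]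
  · intro i τ hf h₁ h₂ h₃ h₄
    have v2 := hf.var 2 rfl
    have v5 := hf.var 5 rfl
    have v10 := hf.var 10 rfl
    have a2 := hf.arr 2 rfl
    have a3 := hf.arr 3 rfl
    have a4 := hf.arr 4 rfl
    have hc := h₄.cap i h₁ (by omega)
    rw [if_neg (lt_irrefl i)] at hc
    refine Wp.ite (fun c => ?_) fun c => Wp.skip ?_
    all_goals
      simp only [Expr.eval_lt, Expr.eval_add, Expr.eval_get, Expr.eval_var, Expr.eval_neg, h₃,
        Expr.eval_div, a4, v10, ne_eq, ite_eq_right_iff, one_ne_zero, imp_false, not_not,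
        hc] at c
    · have hi := increaseCap_spec (σ := τ) (N := N)
      rw [v2, v5, h₃, a2, a3] at hi
      refine (hi hn hN hN' hG h₄.nonneg h₄.opt h₄.exc h₁ (by omega)).mono le_rfl
        fun υ _ ⟨k₁, k₂, k₃, k₄⟩ => ⟨k₁, k₂, k₃, fun a b₁ b₂ => ?_⟩
      simp only [State.setVar_arr]
      rw [k₄ a (by omega), h₄.cap a b₁ b₂]
      rcases lt_trichotomy a i with h | rfl | h
      · rw [if_pos h, if_neg (by omega), if_pos (by omega), add_zero]
      · rw [if_neg (lt_irrefl a), if_pos rfl, if_pos (by omega)]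
        omega
      · rw [if_neg (by omega), if_neg (by omega), if_neg (by omega), add_zero]
    · refine ⟨h₄.nonneg, h₄.opt, h₄.exc, fun a b₁ b₂ => ?_⟩
      simp only [State.setVar_arr]
      rw [h₄.cap a b₁ b₂]
      rcases lt_trichotomy a i with h | rfl | h
      · rw [if_pos h, if_pos (by omega)]
      · rw [if_neg (lt_irrefl a), if_pos (by omega)]
        omega
      · rw [if_neg (by omega), if_neg (by omega)]
  · intro τ hf _ h
    refine ⟨h.nonneg, h.opt, h.exc, fun a h₁ h₂ => ?_⟩
    rw [h.cap a h₁ h₂, if_pos (by omega)]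

/-- The invariant is optimality for the capacities rounded down to multiples of the scale. At scale
`1` these are the true capacities. -/
theorem scaling_spec {σ : State} {N L : ℕ} (hn : 0 ≤ σ.var 2) (hN : σ.var 2 + 1 ≤ N)
    (hM : 0 ≤ σ.var 5) (hN' : 2 * σ.var 5 + 1 ≤ N)
    (hG : Good (σ.var 2) (σ.var 5) (σ.arr 2) (σ.arr 3)) (hD : σ.var 10 = 2 ^ L)
    (hS : Solved (σ.var 5) (σ.arr 2) (σ.arr 3) (fun a => σ.arr 4 a / σ.var 10)
      (σ.arr 5) (σ.arr 6)) :
    Wp scaling σ (L * (N + N * (N + (N * (N + N + 1) + N) + 1) + 1)) fun τ =>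
      Solved (σ.var 5) (σ.arr 2) (σ.arr 3) (σ.arr 4) (τ.arr 5) (τ.arr 6) := by
  refine Wp.loop (fun k τ => τ.var 10 = 2 ^ k ∧ Solved (σ.var 5) (σ.arr 2) (σ.arr 3)
    (fun a => σ.arr 4 a / τ.var 10) (τ.arr 5) (τ.arr 6)) ⟨hD, hS⟩ ?_ ?_
  · rintro k τ hf ⟨i₁, i₂⟩ he
    have v2 := hf.var 2 rfl
    have v5 := hf.var 5 rfl
    have a2 := hf.arr 2 rfl
    have a3 := hf.arr 3 rfl
    have a4 := hf.arr 4 rfl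
    obtain ⟨k, rfl⟩ : ∃ l, k = l + 1 := by
      cases k with
      | zero => simp [i₁] at he
      | succ k => exact ⟨k, rfl⟩
    have hdiv : τ.var 10 / 2 = 2 ^ k := by rw [i₁, pow_succ]; simp
    refine Wp.seq₀ (Wp.assign ?_)
    simp only [Expr.eval_div, Expr.eval_var, Expr.eval_const, hdiv]
    refine Wp.seq ((doubleRes_spec (by simpa [v5] using hM) (by simpa [v5] using hN')).mono le_rfl
      fun υ hυ hd => ?_)
    have w2 := (hυ.var 2 rfl).trans v2
    have w5 := (hυ.var 5 rfl).trans v5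
    have w10 : υ.var 10 = 2 ^ k := hυ.var 10 rfl
    have b2 := (hυ.arr 2 rfl).trans a2
    have b3 := (hυ.arr 3 rfl).trans a3
    have b4 := (hυ.arr 4 rfl).trans a4
    have b6 : υ.arr 6 = τ.arr 6 := hυ.arr 6 rfl
    have hs := increaseCaps_spec (σ := υ) (N := N)
    rw [w2, w5, w10, b2, b3, b4, b6] at hs
    refine (hs hn hN hM hN' hG ?_).mono le_rfl fun ω hω h =>
      ⟨k, Nat.lt_succ_self k, (hω.var 10 rfl).trans w10, ?_⟩
    · have h := i₂.double (r' := υ.arr 5) (by simpa [v5] using hd)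
      convert h using 3
      -- Nested rounding agrees with direct rounding, so the doubled capacities are those expected
      -- for the halved scale.
      rw [i₁, Int.ediv_ediv_of_nonneg (by positivity), pow_succ]
    · rwa [hω.var 10 rfl, w10]
  · rintro k τ hf ⟨i₁, i₂⟩ he
    have hk : k = 0 := by
      by_contra hk
      simp only [Expr.eval_lt, Expr.eval_var, Expr.eval_const, ite_eq_right_iff, one_ne_zero,
        imp_false, i₁] at he
      exact he (one_lt_pow₀ (by norm_num) hk)
    subst hk
    simpa [i₁] using i₂

end Ram

/-! ### Flows and robust flows -/

section Flow

variable {V A : Type*} [Fintype V] [DecidableEq V] [Fintype A]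

/-- The balance constraints, tested against all potentials. -/
theorem FlowInstance.isFlow_iff (M : FlowInstance V A) (f : A → ℕ) :
    M.IsFlow f ↔ (∀ a, f a ≤ M.cap a) ∧
      ∀ p : V → ℤ, ∑ a, (f a : ℤ) * (p (M.tail a) - p (M.head a)) = ∑ v, p v * M.bal v := by
  have key : ∀ p : V → ℤ, ∑ a, (f a : ℤ) * (p (M.tail a) - p (M.head a)) =
      ∑ v, p v * ((∑ a with M.tail a = v, (f a : ℤ)) - ∑ a with M.head a = v, (f a : ℤ)) := by
    intro p
    have h : ∀ e : A → V, ∑ v, p v * ∑ a with e a = v, (f a : ℤ) = ∑ a, (f a : ℤ) * p (e a) := by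
      intro e
      rw [← Finset.sum_fiberwise Finset.univ e]
      refine Finset.sum_congr rfl fun v _ => ?_
      rw [Finset.mul_sum]
      refine Finset.sum_congr rfl fun a ha => ?_
      rw [(Finset.mem_filter.1 ha).2, mul_comm]
    simp only [mul_sub, Finset.sum_sub_distrib, h]
  refine and_congr_right fun _ => ⟨fun h p => ?_, fun h v => ?_⟩
  · rw [key]
    exact Finset.sum_congr rfl fun v _ => by rw [h v]
  -- The indicator of `v` as potential isolates the balance at `v`.
  · have := (key (Pi.single v 1)).symm.trans (h (Pi.single v 1))
    simpa [Pi.single_apply] using this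

end Flow

/-! ### Prescribing the load separates the scenarios -/

namespace RobustNetwork

section Load

variable {V A S : Type*} [Fintype V] (N : RobustNetwork V A S) (load : {a // a ∈ N.fixed} → ℕ)

theorem sum_mul_reducedBal [DecidableEq V] (s : S) (p : V → ℤ) :
    ∑ v, p v * N.reducedBal load s v = ∑ v, p v * N.bal s v -
      ∑ a : {a // a ∈ N.fixed}, (load a : ℤ) * (p (N.tail a) - p (N.head a)) := by
  have h : ∀ e : {a // a ∈ N.fixed} → V, ∑ v, p v * ∑ a with e a = v, (load a : ℤ) =
      ∑ a, (load a : ℤ) * p (e a) := by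
    intro e
    rw [← Finset.sum_fiberwise Finset.univ e]
    refine Finset.sum_congr rfl fun v _ => ?_
    rw [Finset.mul_sum]
    refine Finset.sum_congr rfl fun a ha => ?_
    rw [(Finset.mem_filter.1 ha).2, mul_comm]
  simp only [reducedBal, mul_add, mul_sub, Finset.sum_sub_distrib, Finset.sum_add_distrib, h]
  ring

theorem extend_fixed [DecidableEq A] (g : S → {a // a ∉ N.fixed} → ℕ) (s : S) (a : {a // a ∈ N.fixed}) :
    N.extend load g s a = load a := by
  simp [extend, a.2]

theorem extend_free [DecidableEq A] (g : S → {a // a ∉ N.fixed} → ℕ) (s : S) (a : {a // a ∉ N.fixed}) :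
    N.extend load g s a = g s a := by
  simp [extend, a.2]

variable [Fintype A] [DecidableEq A]

/-- Splitting off the fixed arcs. -/
theorem sum_arcs {R : Type*} [AddCommMonoid R] (F : A → R) :
    ∑ a, F a = ∑ a : {a // a ∈ N.fixed}, F a + ∑ a : {a // a ∉ N.fixed}, F a := by
  rw [← Fintype.sum_subtype_add_sum_subtype (fun a => a ∈ N.fixed) F]
  congr 1
  exact Finset.sum_congr (by ext; simp) fun _ _ => rfl

variable [DecidableEq V]

/-- A flow with the prescribed load restricts to a flow on the free arcs. -/
theorem isFlow_restrict {s : S} {f : A → ℕ} (hf : ∀ a : {a // a ∈ N.fixed}, f a = load a) :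
    (N.scenario s).IsFlow f ↔ (∀ a, load a ≤ N.cap a) ∧
      (N.reduced load s).IsFlow fun a => f a := by
  simp only [FlowInstance.isFlow_iff, scenario, reduced, sum_mul_reducedBal]
  have h₁ : (∀ a, f a ≤ N.cap a) ↔ (∀ a : {a // a ∈ N.fixed}, load a ≤ N.cap a) ∧
      ∀ a : {a // a ∉ N.fixed}, f a ≤ N.cap a := by
    refine ⟨fun h => ⟨fun a => hf a ▸ h a, fun a => h a⟩, fun h a => ?_⟩
    by_cases ha : a ∈ N.fixed
    · exact (hf ⟨a, ha⟩).trans_le (h.1 ⟨a, ha⟩)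
    · exact h.2 ⟨a, ha⟩
  rw [h₁, and_assoc]
  refine and_congr_right fun _ => and_congr_right fun _ => forall_congr' fun p => ?_
  rw [N.sum_arcs]
  simp only [hf]
  exact eq_sub_iff_add_eq'.symm

theorem flowCost_eq {s : S} {f : A → ℕ} (hf : ∀ a : {a // a ∈ N.fixed}, f a = load a) :
    (N.scenario s).flowCost f = ∑ a : {a // a ∈ N.fixed}, N.cost a * load a +
      (N.reduced load s).flowCost fun a => f a := by
  simp only [FlowInstance.flowCost, scenario, reduced]
  rw [N.sum_arcs]
  simp only [hf]

theorem isRobustFlowWithLoad_extend (hl : ∀ a, load a ≤ N.cap a)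
    {g : S → {a // a ∉ N.fixed} → ℕ} (hg : ∀ s, (N.reduced load s).IsFlow (g s)) :
    N.IsRobustFlowWithLoad load (N.extend load g) := by
  refine ⟨⟨fun s => ?_, fun a ha s s' => ?_⟩, fun s a => N.extend_fixed load g s a⟩
  · rw [N.isFlow_restrict load (N.extend_fixed load g s)]
    simp only [extend_free]
    exact ⟨hl, hg s⟩
  · rw [N.extend_fixed load g s ⟨a, ha⟩, N.extend_fixed load g s' ⟨a, ha⟩]

/-- At least one scenario is needed: only a flow of some scenario forces the load to respect the
capacities. -/
theorem exists_isRobustFlowWithLoad_iff [Nonempty S] :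
    (∃ f, N.IsRobustFlowWithLoad load f) ↔
      (∀ a, load a ≤ N.cap a) ∧ ∀ s, ∃ g, (N.reduced load s).IsFlow g := by
  refine ⟨fun ⟨f, hf, hl⟩ => ?_, fun ⟨hl, h⟩ => ?_⟩
  · have h := fun s => (N.isFlow_restrict load (hl s)).1 (hf.1 s)
    exact ⟨(h (Classical.arbitrary S)).1, fun s => ⟨_, (h s).2⟩⟩
  · choose g hg using h
    exact ⟨_, N.isRobustFlowWithLoad_extend load hl hg⟩

/-- In every scenario the fixed arcs contribute the same cost to all competitors. The extension is
therefore cheapest scenario by scenario, and the maximum is monotone. -/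
theorem isOptimalWithLoad_extend [Fintype S] (hl : ∀ a, load a ≤ N.cap a)
    {g : S → {a // a ∉ N.fixed} → ℕ} (hg : ∀ s, (N.reduced load s).IsMinCostFlow (g s)) :
    N.IsOptimalWithLoad load (N.extend load g) := by
  refine ⟨N.isRobustFlowWithLoad_extend load hl fun s => (hg s).1, fun f ⟨hf, hfl⟩ => ?_⟩
  refine Finset.sup_mono_fun fun s _ => ?_
  rw [N.flowCost_eq load (N.extend_fixed load g s), N.flowCost_eq load (hfl s)]
  simp only [extend_free]
  exact Nat.add_le_add_left
    ((hg s).2 _ ((N.isFlow_restrict load (hfl s)).1 (hf.1 s)).2) _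

/-- The reduced instance with the fixed arcs kept, but without capacity. -/
def closed (s : S) : FlowInstance V A where
  tail := N.tail
  head := N.head
  cap a := if a ∈ N.fixed then 0 else N.cap a
  cost := N.cost
  bal := N.reducedBal load s
  bal_sum := N.sum_reducedBal load s

/-- Capacity `0` has the effect of deletion but keeps the numbering of the arcs, so the program can
work on the input indices. -/
theorem isFlow_closed_iff {s : S} {f : A → ℕ} :
    (N.closed load s).IsFlow f ↔ (∀ a ∈ N.fixed, f a = 0) ∧
      (N.reduced load s).IsFlow fun a => f a := by
  simp only [FlowInstance.isFlow_iff, closed, reduced]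
  have h₁ : (∀ a, f a ≤ if a ∈ N.fixed then 0 else N.cap a) ↔ (∀ a ∈ N.fixed, f a = 0) ∧
      ∀ a : {a // a ∉ N.fixed}, f a ≤ N.cap a := by
    refine ⟨fun h => ⟨fun a ha => ?_, fun a => ?_⟩, fun h a => ?_⟩
    · simpa [ha] using h a
    · simpa [a.2] using h a
    · split_ifs with ha
      exacts [(h.1 a ha).le, h.2 ⟨a, ha⟩]
  rw [h₁, and_assoc]
  refine and_congr_right fun h => and_congr_right fun _ => forall_congr' fun p => ?_
  rw [N.sum_arcs, Finset.sum_eq_zero (s := (Finset.univ : Finset {a // a ∈ N.fixed})), zero_add]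
  intro a _
  simp [h a a.2]

theorem flowCost_closed {s : S} {f : A → ℕ} (hf : ∀ a ∈ N.fixed, f a = 0) :
    (N.closed load s).flowCost f = (N.reduced load s).flowCost fun a => f a := by
  simp only [FlowInstance.flowCost, closed, reduced]
  rw [N.sum_arcs, Finset.sum_eq_zero (s := (Finset.univ : Finset {a // a ∈ N.fixed})), zero_add]
  intro a _
  simp [hf a a.2]

theorem exists_isFlow_closed {s : S} {g : {a // a ∉ N.fixed} → ℕ}
    (hg : (N.reduced load s).IsFlow g) :
    ∃ f, (N.closed load s).IsFlow f ∧
      (N.closed load s).flowCost f = (N.reduced load s).flowCost g := by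
  have h : ∀ a ∈ N.fixed, (fun a => if h : a ∈ N.fixed then 0 else g ⟨a, h⟩) a = 0 :=
    fun a ha => by simp [ha]
  have h' : (fun a : {a // a ∉ N.fixed} =>
      (fun a => if h : a ∈ N.fixed then 0 else g ⟨a, h⟩) (a : A)) = g := by
    funext a
    simp [a.2]
  refine ⟨_, (N.isFlow_closed_iff load).2 ⟨h, by rwa [h']⟩, ?_⟩
  rw [N.flowCost_closed load h, h']

theorem IsMinCostFlow.of_closed {s : S} {f : A → ℕ} (hf : (N.closed load s).IsMinCostFlow f) :
    (N.reduced load s).IsMinCostFlow fun a => f a := by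
  have h := (N.isFlow_closed_iff load).1 hf.1
  refine ⟨h.2, fun g hg => ?_⟩
  obtain ⟨g', hg', hc⟩ := N.exists_isFlow_closed load hg
  rw [← hc, ← N.flowCost_closed load h.1]
  exact hf.2 g' hg'

end Load

end RobustNetwork

/-! ### Flows as circulations -/

namespace Residual

theorem sum_Icc_one (m : ℕ) (F : ℤ → ℤ) :
    ∑ a ∈ Finset.Icc (1 : ℤ) m, F a = ∑ i : Fin m, F ((i : ℕ) + 1) := by
  refine (Finset.sum_nbij (fun i : Fin m => ((i : ℕ) : ℤ) + 1) (fun i _ => ?_) (fun i _ j _ h => ?_)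
    (fun a ha => ?_) fun _ _ => rfl).symm
  · simp
  · exact Fin.ext (by simpa using h)
  · simp only [Finset.coe_Icc, Set.mem_Icc] at ha
    exact ⟨⟨(a - 1).toNat, by omega⟩, by simp, by simp; omega⟩

theorem sum_Icc_add (n m : ℕ) (F : ℤ → ℤ) :
    ∑ a ∈ Finset.Icc (1 : ℤ) (n + m), F a =
      ∑ i : Fin m, F ((i : ℕ) + 1) + ∑ v : Fin n, F (m + 1 + (v : ℕ)) := by
  have h := sum_Icc_one (m + n) F
  rw [Fin.sum_univ_add] at h
  push_cast at h
  rw [add_comm (n : ℤ), h]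
  simp [add_right_comm]

/-- The arrays hold the network `J` with an auxiliary vertex `n` and auxiliary arcs
`m + 1, …, m + n` of very small cost, which carry the balances. -/
structure Represents {n m : ℕ} (J : FlowInstance (Fin n) (Fin m)) (tl c u : ℤ → ℤ) (K : ℤ) :
    Prop where
  tail : ∀ i : Fin m, tl ((i : ℕ) + 1) = (J.tail i : ℕ)
  head : ∀ i : Fin m, tl (-((i : ℕ) + 1)) = (J.head i : ℕ)
  cost : ∀ i : Fin m, c ((i : ℕ) + 1) = J.cost i
  cap : ∀ i : Fin m, u ((i : ℕ) + 1) = J.cap i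
  cost_neg : ∀ a, -(n + m : ℤ) ≤ a → a ≤ n + m → c (-a) = -c a
  aux_cost : ∀ v : Fin n, c (m + 1 + (v : ℕ)) = -K
  aux : ∀ v : Fin n, (0 ≤ J.bal v ∧ tl (m + 1 + (v : ℕ)) = n ∧ tl (-(m + 1 + (v : ℕ))) = (v : ℕ) ∧
      u (m + 1 + (v : ℕ)) = J.bal v) ∨
    (J.bal v < 0 ∧ tl (m + 1 + (v : ℕ)) = (v : ℕ) ∧ tl (-(m + 1 + (v : ℕ))) = n ∧
      u (m + 1 + (v : ℕ)) = -J.bal v)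
  large : ∑ i, (J.cost i * J.cap i : ℤ) < K

variable {n m : ℕ} {J : FlowInstance (Fin n) (Fin m)} {tl c u r π : ℤ → ℤ} {K : ℤ}

/-- The sign of the balance and the orientation of the auxiliary arc compensate each other, so a
saturated auxiliary arc contributes the same expression in both cases. -/
theorem Represents.aux_mul (h : Represents J tl c u K) (p : ℤ → ℤ) (v : Fin n) :
    u (m + 1 + (v : ℕ)) * (p (tl (m + 1 + (v : ℕ))) - p (tl (-(m + 1 + (v : ℕ))))) =
      J.bal v * (p n - p (v : ℕ)) := by
  rcases h.aux v with ⟨-, h₁, h₂, h₃⟩ | ⟨-, h₁, h₂, h₃⟩ <;> rw [h₁, h₂, h₃]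
  ring

/-- If all auxiliary arcs are saturated, the flow on the other arcs is a flow of the instance. -/
theorem Represents.isFlow (h : Represents J tl c u K) (hS : Ram.Solved (n + m) tl c u r π)
    (h0 : ∀ v : Fin n, r (m + 1 + (v : ℕ)) = 0) :
    J.IsFlow fun i => (r (-((i : ℕ) + 1))).toNat := by
  rw [FlowInstance.isFlow_iff]
  refine ⟨fun i => ?_, fun q => ?_⟩
  · have h₁ := hS.cap ((i : ℕ) + 1) (by omega) (by omega)
    have h₂ := hS.nonneg ((i : ℕ) + 1)
    have h₃ := hS.nonneg (-((i : ℕ) + 1))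
    rw [h.cap] at h₁
    omega
  · have hinj : Function.Injective fun v : Fin n => ((v : ℕ) : ℤ) := fun v w hvw =>
      Fin.ext (by simpa using hvw)
    -- Potential `0` at the auxiliary vertex makes the saturated auxiliary arcs contribute exactly
    -- the negative balance term.
    set p : ℤ → ℤ := Function.extend (fun v : Fin n => ((v : ℕ) : ℤ)) q 0 with hp
    have hp₁ : ∀ v : Fin n, p (v : ℕ) = q v := fun v => hinj.extend_apply q 0 v
    have hp₂ : p n = 0 := Function.extend_apply' _ _ _ (by
      rintro ⟨v, hv⟩
      have := v.2
      simp at hv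
      omega)
    have hE := hS.exc p
    rw [excess, sum_Icc_add] at hE
    have e₂ : ∑ v : Fin n, r (-(m + 1 + (v : ℕ))) *
        (p (tl (m + 1 + (v : ℕ))) - p (tl (-(m + 1 + (v : ℕ))))) = -∑ v, q v * J.bal v := by
      rw [← Finset.sum_neg_distrib]
      refine Finset.sum_congr rfl fun v _ => ?_
      have h₁ := hS.cap (m + 1 + (v : ℕ)) (by omega) (by omega)
      rw [h0, zero_add] at h₁
      rw [h₁, h.aux_mul p v, hp₂, hp₁]
      ring
    rw [e₂] at hE
    rw [← sub_eq_zero, sub_eq_add_neg, ← hE]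
    congr 1
    refine Finset.sum_congr rfl fun i _ => ?_
    rw [h.tail, h.head, hp₁, hp₁, Int.toNat_of_nonneg (hS.nonneg _)]

/-- If there is a flow, then the auxiliary arcs are saturated and the circulation is at most as
expensive. -/
theorem Represents.compare (h : Represents J tl c u K) (hS : Ram.Solved (n + m) tl c u r π)
    {g : Fin m → ℕ} (hg : J.IsFlow g) :
    (∀ v : Fin n, r (m + 1 + (v : ℕ)) = 0) ∧
      J.flowCost (fun i => (r (-((i : ℕ) + 1))).toNat) ≤ J.flowCost g := by
  rw [FlowInstance.isFlow_iff] at hg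
  have hinj : Function.Injective fun i : Fin m => ((i : ℕ) : ℤ) + 1 := fun v w hvw =>
    Fin.ext (by simpa using hvw)
  -- The competing circulation: `g` on the original arcs, saturation of all auxiliary arcs.
  set G : ℤ → ℤ := fun a => if a ≤ m then
    Function.extend (fun i : Fin m => ((i : ℕ) : ℤ) + 1) (fun i => (g i : ℤ)) 0 a else u a with hG
  have hG₁ : ∀ i : Fin m, G ((i : ℕ) + 1) = g i := fun i => by
    simp only [hG]
    rw [if_pos (by omega)]
    exact hinj.extend_apply _ _ i
  have hG₂ : ∀ v : Fin n, G (m + 1 + (v : ℕ)) = u (m + 1 + (v : ℕ)) := fun v => by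
    simp only [hG]
    rw [if_neg (by omega)]
  have hle := hS.opt.le_cost h.cost_neg hS.exc G ?_ hS.nonneg ?_
  · rw [sum_Icc_add, sum_Icc_add] at hle
    simp only [hG₁, hG₂, h.cost, h.aux_cost] at hle
    have e₁ : ∑ v : Fin n, -K * u (m + 1 + (v : ℕ)) =
        ∑ v : Fin n, -K * r (-(m + 1 + (v : ℕ))) + -K * ∑ v : Fin n, r (m + 1 + (v : ℕ)) := by
      rw [Finset.mul_sum, ← Finset.sum_add_distrib]
      refine Finset.sum_congr rfl fun v _ => ?_
      rw [← hS.cap (m + 1 + (v : ℕ)) (by omega) (by omega)]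
      ring
    rw [e₁] at hle
    have h₁ : 0 ≤ ∑ i : Fin m, (J.cost i : ℤ) * r (-((i : ℕ) + 1)) :=
      Finset.sum_nonneg fun i _ => mul_nonneg (by positivity) (hS.nonneg _)
    have h₂ : ∑ i : Fin m, (J.cost i : ℤ) * (g i : ℤ) ≤ ∑ i, (J.cost i * J.cap i : ℤ) :=
      Finset.sum_le_sum fun i _ =>
        mul_le_mul_of_nonneg_left (by exact_mod_cast hg.1 i) (by positivity)
    have h₃ := h.large
    have h₄ : 0 ≤ ∑ v : Fin n, r (m + 1 + (v : ℕ)) := Finset.sum_nonneg fun v _ => hS.nonneg _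
    -- One unsaturated unit would lose `K`, more than any flow within the capacities costs.
    have h₅ : ∑ v : Fin n, r (m + 1 + (v : ℕ)) = 0 := by
      by_contra hne
      have : 1 ≤ ∑ v : Fin n, r (m + 1 + (v : ℕ)) := by omega
      have hK : K ≤ K * ∑ v : Fin n, r (m + 1 + (v : ℕ)) := le_mul_of_one_le_right
        (h₃.le.trans' (Finset.sum_nonneg fun i _ => by positivity)) this
      linarith
    refine ⟨fun v => (Finset.sum_eq_zero_iff_of_nonneg fun v _ => hS.nonneg _).1 h₅ v
      (Finset.mem_univ v), ?_⟩
    rw [h₅] at hle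
    have h₆ : ∑ i : Fin m, (J.cost i : ℤ) * r (-((i : ℕ) + 1)) ≤
        ∑ i : Fin m, (J.cost i : ℤ) * (g i : ℤ) := by linarith
    zify [FlowInstance.flowCost]
    simpa only [Int.toNat_of_nonneg (hS.nonneg _)] using h₆
  · intro a h₁ h₂
    rw [hS.cap a h₁ h₂]
    by_cases ha : a ≤ m
    · obtain ⟨i, rfl⟩ : ∃ i : Fin m, a = (i : ℕ) + 1 :=
        ⟨⟨(a - 1).toNat, by omega⟩, by simp; omega⟩
      rw [hG₁, h.cap]
      exact ⟨by positivity, by exact_mod_cast hg.1 i⟩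
    · simp only [hG, if_neg ha, le_refl, and_true]
      rw [← hS.cap a h₁ h₂]
      exact add_nonneg (hS.nonneg _) (hS.nonneg _)
  -- The potential of the auxiliary vertex is multiplied by the sum of all balances, which is `0`.
  · rw [sum_Icc_add]
    simp only [hG₁, hG₂, h.aux_mul, h.tail, h.head]
    have h₁ := hg.2 fun v => π (v : ℕ)
    rw [h₁, ← Finset.sum_add_distrib]
    simp only [mul_sub]
    have : ∀ v : Fin n, π (v : ℕ) * J.bal v + (J.bal v * π n - J.bal v * π (v : ℕ)) =
        J.bal v * π n := fun v => by ring
    simp only [this, ← Finset.sum_mul, J.bal_sum, zero_mul]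

end Residual

/-! ### Setting up the network of a scenario

Variables: `2`, `3`, `4` the numbers of vertices, arcs and scenarios, `5` the number of arcs
including the auxiliary ones, `7` the position of the balances in the input, `9` is nonzero as long
as no infeasibility was found, `10` scale, `11` cost of the auxiliary arcs, `12` sum of the
capacities. Arrays: `0` input, `9` balances, `10` loads. -/

namespace Ram

open Residual

/-- An entry of the input that belongs to the arc `13`. -/
def arcEntry (z : ℤ) : Expr :=
  .get 0 (((.var 13 + .var 13 + .var 13) + (.var 13 + .var 13 + .var 13)) + .const z)

@[simp] theorem eval_arcEntry (σ : State) (z : ℤ) :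
    (arcEntry z).eval σ = σ.arr 0 (6 * σ.var 13 + z) := by
  simp only [arcEntry, Expr.eval_get, Expr.eval_add, Expr.eval_var, Expr.eval_const]
  congr 1
  ring

/-- Read the arcs from the input. Fixed arcs get capacity `0`. -/
def loadArcs : Program :=
  .forTo 13 (.const 1) (.var 3 + .const 1)
    (.store 2 (.var 13) (arcEntry (-3)) ;; .store 2 (-.var 13) (arcEntry (-2)) ;;
      .store 3 (.var 13) (arcEntry 1) ;; .store 3 (-.var 13) (-arcEntry 1) ;;
      .store 10 (.var 13) (arcEntry 2) ;;
      .ite (arcEntry (-1))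
        (.store 4 (.var 13) (.const 0) ;;
          .ite (.op .lt (arcEntry 0) (arcEntry 2)) (.assign 9 (.const 0)) .skip)
        (.store 4 (.var 13) (arcEntry 0)))

/-- The arrays hold the data of the arc `a`. -/
def ArcLoaded (inp tl c u l : ℤ → ℤ) (a : ℤ) : Prop :=
  tl a = inp (6 * a - 3) ∧ tl (-a) = inp (6 * a - 2) ∧ c a = inp (6 * a + 1) ∧
    c (-a) = -inp (6 * a + 1) ∧ l a = inp (6 * a + 2) ∧
    u a = if inp (6 * a - 1) = 0 then inp (6 * a) else 0

theorem ArcLoaded.update {inp tl c u l : ℤ → ℤ} {a i : ℤ} (h : ArcLoaded inp tl c u l a)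
    (ha : 1 ≤ a) (hai : a < i) (t₁ t₂ c₁ c₂ u₁ l₁ : ℤ) :
    ArcLoaded inp (Function.update (Function.update tl i t₁) (-i) t₂)
      (Function.update (Function.update c i c₁) (-i) c₂) (Function.update u i u₁)
      (Function.update l i l₁) a := by
  have h₁ : a ≠ i := hai.ne
  have h₂ : a ≠ -i := by omega
  have h₃ : -a ≠ i := by omega
  have h₄ : -a ≠ -i := by omega
  simpa only [ArcLoaded, Function.update_of_ne h₁, Function.update_of_ne h₂,
    Function.update_of_ne h₃, Function.update_of_ne h₄] using h

/-- Arcs are counted from `1` and three numbers precede them, so arc `a` occupies the positions `6 *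
a - 3` to `6 * a + 2`. The flag `9` is cleared as soon as a load exceeds its capacity. -/
theorem loadArcs_spec {σ : State} {N : ℕ} (hm : 0 ≤ σ.var 3) (hN : σ.var 3 ≤ N) :
    Wp loadArcs σ N fun τ =>
      (∀ a, 1 ≤ a → a ≤ σ.var 3 →
        ArcLoaded (σ.arr 0) (τ.arr 2) (τ.arr 3) (τ.arr 4) (τ.arr 10) a) ∧
      (τ.var 9 ≠ 0 ↔ σ.var 9 ≠ 0 ∧ ∀ a, 1 ≤ a → a ≤ σ.var 3 → σ.arr 0 (6 * a - 1) ≠ 0 →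
        σ.arr 0 (6 * a + 2) ≤ σ.arr 0 (6 * a)) := by
  refine Wp.mono (T := N * (0 + 1)) ?_ (by simp) fun _ _ h => h
  refine Wp.forTo (L := 1) (H := σ.var 3 + 1)
    (J := fun i τ => (∀ a, 1 ≤ a → a < i →
        ArcLoaded (σ.arr 0) (τ.arr 2) (τ.arr 3) (τ.arr 4) (τ.arr 10) a) ∧
      (τ.var 9 ≠ 0 ↔ σ.var 9 ≠ 0 ∧ ∀ a, 1 ≤ a → a < i → σ.arr 0 (6 * a - 1) ≠ 0 →
        σ.arr 0 (6 * a + 2) ≤ σ.arr 0 (6 * a)))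
    rfl (by simp) (by omega) (by omega) ?_ ?_ ?_ ?_
  · intro τ hf
    simp [hf.var 3 rfl]
  · refine ⟨fun a h₁ h₂ => by omega, ?_⟩
    simp only [State.setVar_var, Nat.reduceEqDiff, if_false]
    exact ⟨fun h => ⟨h, fun a h₁ h₂ => by omega⟩, fun h => h.1⟩
  · rintro i τ hf h₁ h₂ h₃ ⟨h₄, h₅⟩
    have a0 := hf.arr 0 rfl
    have hne : -i ≠ i := by omega
    have hne' : i ≠ -i := by omega
    have new : ∀ u₁ : ℤ, (u₁ = if σ.arr 0 (6 * i - 1) = 0 then σ.arr 0 (6 * i) else 0) →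
        ∀ a, 1 ≤ a → a ≤ i → ArcLoaded (σ.arr 0)
          (Function.update (Function.update (τ.arr 2) i (σ.arr 0 (6 * i + -3))) (-i)
            (σ.arr 0 (6 * i + -2)))
          (Function.update (Function.update (τ.arr 3) i (σ.arr 0 (6 * i + 1))) (-i)
            (-σ.arr 0 (6 * i + 1)))
          (Function.update (τ.arr 4) i u₁)
          (Function.update (τ.arr 10) i (σ.arr 0 (6 * i + 2))) a := by
      intro u₁ hu a ha₁ ha₂
      rcases ha₂.eq_or_lt with rfl | hlt
      · simp [ArcLoaded, hne', hu, sub_eq_add_neg]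
      · exact (h₄ a ha₁ hlt).update ha₁ hlt _ _ _ _ _ _
    refine Wp.seq₀ (Wp.store (Wp.seq₀ (Wp.store (Wp.seq₀ (Wp.store (Wp.seq₀ (Wp.store
      (Wp.seq₀ (Wp.store (Wp.ite (fun c₁ => Wp.seq₀ (Wp.store (Wp.ite (fun c₂ => Wp.assign ?_)
      fun c₂ => Wp.skip ?_))) fun c₁ => Wp.store ?_))))))))))
    all_goals
      simp [a0, h₃] at c₁
      try simp [a0, h₃] at c₂
      rw [← sub_eq_add_neg] at c₁
      simp [a0, h₃]
    · refine ⟨new 0 (by rw [if_neg c₁]), fun _ => ⟨i, h₁, by omega, c₁, c₂⟩⟩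
    · refine ⟨new 0 (by rw [if_neg c₁]), h₅.trans (and_congr_right fun _ =>
        ⟨fun h a ha₁ ha₂ => ?_, fun h a ha₁ ha₂ => h a ha₁ (by omega)⟩)⟩
      rcases (show a ≤ i by omega).eq_or_lt with rfl | hlt
      exacts [fun _ => c₂, h a ha₁ hlt]
    · refine ⟨new _ (by rw [if_pos c₁]), h₅.trans (and_congr_right fun _ =>
        ⟨fun h a ha₁ ha₂ => ?_, fun h a ha₁ ha₂ => h a ha₁ (by omega)⟩)⟩
      rcases (show a ≤ i by omega).eq_or_lt with rfl | hlt
      exacts [fun h => absurd c₁ h, h a ha₁ hlt]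
  · rintro τ hf - ⟨h₄, h₅⟩
    refine ⟨fun a h₁ h₂ => h₄ a h₁ (by omega), h₅.trans (and_congr_right fun _ =>
        ⟨fun h a ha₁ ha₂ => h a ha₁ (by omega), fun h a ha₁ ha₂ => h a ha₁ (by omega)⟩)⟩

/-- Read the balances from the input. -/
def loadBalances : Program :=
  .forTo 20 (.const 0) (.var 2) (.store 9 (.var 20) (.get 0 (.var 7 + .var 20)))

theorem loadBalances_spec {σ : State} {N : ℕ} (hn : 0 ≤ σ.var 2) (hN : σ.var 2 ≤ N) :
    Wp loadBalances σ N fun τ => ∀ v, 0 ≤ v → v < σ.var 2 →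
      τ.arr 9 v = σ.arr 0 (σ.var 7 + v) := by
  refine Wp.mono (T := N * (0 + 1)) ?_ (by simp) fun _ _ h => h
  refine Wp.forTo (L := 0) (H := σ.var 2)
    (J := fun i τ => ∀ v, 0 ≤ v → v < i → τ.arr 9 v = σ.arr 0 (σ.var 7 + v))
    rfl (by simp) (by omega) (by omega) ?_ ?_ ?_ ?_
  · intro τ hf
    simp [hf.var 2 rfl]
  · intro v h₁ h₂
    omega
  · intro i τ hf h₁ h₂ h₃ h₄
    refine Wp.store fun v hv₁ hv₂ => ?_
    simp only [State.setVar_arr, State.setArr_arr, if_true, Expr.eval_var, Expr.eval_get,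
      Expr.eval_add, h₃, Function.update_apply, hf.arr 0 rfl, hf.var 7 rfl]
    split_ifs with h
    exacts [by rw [h], h₄ v hv₁ (by omega)]
  · intro τ hf _ h
    exact h

/-- Adjust the balances to the loads. -/
def adjustBalances : Program :=
  .forTo 13 (.const 1) (.var 3 + .const 1)
    (.store 9 (.get 2 (-.var 13)) (.get 9 (.get 2 (-.var 13)) + .get 10 (.var 13)) ;;
      .store 9 (.get 2 (.var 13)) (.get 9 (.get 2 (.var 13)) - .get 10 (.var 13)))

/-- For a loop the two updates hit the same entry and cancel, in agreement with the difference of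
indicators. -/
theorem adjustBalances_spec {σ : State} {N : ℕ} (hm : 0 ≤ σ.var 3) (hN : σ.var 3 ≤ N) :
    Wp adjustBalances σ N fun τ => ∀ v, τ.arr 9 v = σ.arr 9 v +
      ∑ a ∈ Finset.Icc 1 (σ.var 3), σ.arr 10 a *
        ((if σ.arr 2 (-a) = v then 1 else 0) - if σ.arr 2 a = v then 1 else 0) := by
  refine Wp.mono (T := N * (0 + 1)) ?_ (by simp) fun _ _ h => h
  refine Wp.forTo (L := 1) (H := σ.var 3 + 1)
    (J := fun i τ => ∀ v, τ.arr 9 v = σ.arr 9 v + ∑ a ∈ Finset.Ico 1 i, σ.arr 10 a *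
        ((if σ.arr 2 (-a) = v then 1 else 0) - if σ.arr 2 a = v then 1 else 0))
    rfl (by simp) (by omega) (by omega) ?_ ?_ ?_ ?_
  · intro τ hf
    simp [hf.var 3 rfl]
  · intro v
    simp
  · intro i τ hf h₁ h₂ h₃ h₄
    refine Wp.seq₀ (Wp.store (Wp.store fun v => ?_))
    rw [← Finset.insert_Ico_right_eq_Ico_add_one h₁, Finset.sum_insert (by simp),
      add_left_comm, ← h₄ v]
    simp only [State.setVar_arr, State.setArr_arr, if_true, Expr.eval_var, Expr.eval_get,
      Expr.eval_add, Expr.eval_sub, Expr.eval_neg, h₃, hf.arr 2 rfl, hf.arr 10 rfl,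
      Function.update_apply, Nat.reduceEqDiff, if_false, State.setArr_var]
    by_cases e₁ : v = σ.arr 2 i <;> by_cases e₂ : v = σ.arr 2 (-i)
    · rw [if_pos e₁, if_pos (e₁ ▸ e₂), if_pos e₂.symm, if_pos e₁.symm, ← e₂]
      ring
    · rw [if_pos e₁, if_neg (e₁ ▸ e₂), if_neg (Ne.symm e₂), if_pos e₁.symm, ← e₁]
      ring
    · rw [if_neg e₁, if_pos e₂, if_pos e₂.symm, if_neg (Ne.symm e₁), ← e₂]
      ring
    · rw [if_neg e₁, if_neg e₂, if_neg (Ne.symm e₂), if_neg (Ne.symm e₁)]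
      ring
  · intro τ hf _ h v
    rw [h]
    rfl

/-- Set up the auxiliary arcs. -/
def auxArcs : Program :=
  .forTo 20 (.const 0) (.var 2)
    (.assign 13 (.var 3 + .const 1 + .var 20) ;;
      .store 3 (.var 13) (.const 0) ;;
      .ite (.op .lt (.get 9 (.var 20)) (.const 0))
        (.store 2 (.var 13) (.var 20) ;; .store 2 (-.var 13) (.var 2) ;;
          .store 4 (.var 13) (-.get 9 (.var 20)))
        (.store 2 (.var 13) (.var 2) ;; .store 2 (-.var 13) (.var 20) ;;
          .store 4 (.var 13) (.get 9 (.var 20))))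

/-- The auxiliary arc `a` of the vertex `v` with balance `b`, where `n` is the auxiliary vertex. -/
def AuxArc (tl u : ℤ → ℤ) (n v b a : ℤ) : Prop :=
  (0 ≤ b ∧ tl a = n ∧ tl (-a) = v ∧ u a = b) ∨ (b < 0 ∧ tl a = v ∧ tl (-a) = n ∧ u a = -b)

theorem AuxArc.congr {tl tl' u u' : ℤ → ℤ} {n v b a : ℤ} (h : AuxArc tl u n v b a)
    (h₁ : tl' a = tl a) (h₂ : tl' (-a) = tl (-a)) (h₃ : u' a = u a) : AuxArc tl' u' n v b a := by
  rwa [AuxArc, h₁, h₂, h₃]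

/-- The auxiliary costs are `0` for the moment: their final value depends on the sum of all costs,
which must not see values left by an earlier scenario. -/
theorem auxArcs_spec {σ : State} {N : ℕ} (hn : 0 ≤ σ.var 2) (hN : σ.var 2 ≤ N)
    (hm : 0 ≤ σ.var 3) :
    Wp auxArcs σ N fun τ => (∀ v, 0 ≤ v → v < σ.var 2 →
        AuxArc (τ.arr 2) (τ.arr 4) (σ.var 2) v (σ.arr 9 v) (σ.var 3 + 1 + v) ∧
        τ.arr 3 (σ.var 3 + 1 + v) = 0) ∧
      ∀ x, -σ.var 3 ≤ x → x ≤ σ.var 3 →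
        τ.arr 2 x = σ.arr 2 x ∧ τ.arr 3 x = σ.arr 3 x ∧ τ.arr 4 x = σ.arr 4 x := by
  refine Wp.mono (T := N * (0 + 1)) ?_ (by simp) fun _ _ h => h
  refine Wp.forTo (L := 0) (H := σ.var 2)
    (J := fun i τ => (∀ v, 0 ≤ v → v < i →
        AuxArc (τ.arr 2) (τ.arr 4) (σ.var 2) v (σ.arr 9 v) (σ.var 3 + 1 + v) ∧
        τ.arr 3 (σ.var 3 + 1 + v) = 0) ∧
      ∀ x, -σ.var 3 ≤ x → x ≤ σ.var 3 →
        τ.arr 2 x = σ.arr 2 x ∧ τ.arr 3 x = σ.arr 3 x ∧ τ.arr 4 x = σ.arr 4 x)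
    rfl (by simp) (by omega) (by omega) ?_ ?_ ?_ ?_
  · intro τ hf
    simp [hf.var 2 rfl]
  · exact ⟨fun v h₁ h₂ => by omega, fun x _ _ => ⟨rfl, rfl, rfl⟩⟩
  · rintro i τ hf h₁ h₂ h₃ ⟨h₄, h₅⟩
    have v2 := hf.var 2 rfl
    have v3 := hf.var 3 rfl
    have a9 := hf.arr 9 rfl
    refine Wp.seq₀ (Wp.assign (Wp.seq₀ (Wp.store (Wp.ite
      (fun c => Wp.seq₀ (Wp.store (Wp.seq₀ (Wp.store (Wp.store ?_)))))
      (fun c => Wp.seq₀ (Wp.store (Wp.seq₀ (Wp.store (Wp.store ?_)))))))))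
    all_goals
      simp only [Expr.eval_lt, Expr.eval_get, Expr.eval_var, Expr.eval_const, State.setArr_arr,
        State.setVar_arr, State.setArr_var, State.setVar_var, Expr.eval_add, Nat.reduceEqDiff,
        if_false, if_true, h₃, a9, v3, v2, ne_eq, ite_eq_right_iff, one_ne_zero, imp_false,
        not_not, Expr.eval_neg] at c ⊢
      have q : ∀ x, -σ.var 3 ≤ x → x < σ.var 3 + 1 + i →
        x ≠ σ.var 3 + 1 + i ∧ x ≠ -(σ.var 3 + 1 + i) := fun x _ _ => by omega
      have q' : -(σ.var 3 + 1 + i) ≠ σ.var 3 + 1 + i := by omega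
      refine ⟨fun v b₁ b₂ => ?_, fun x b₁ b₂ => ?_⟩
      · rcases (show v ≤ i by omega).eq_or_lt with rfl | hlt
        · refine ⟨?_, Function.update_self _ _ _⟩
          simp only [AuxArc, Function.update_self, Function.update_of_ne q'.symm]
          simp only [and_true]
          omega
        · have e₁ : σ.var 3 + 1 + v ≠ σ.var 3 + 1 + i := by omega
          have e₂ : σ.var 3 + 1 + v ≠ -(σ.var 3 + 1 + i) := by omega
          have e₃ : -(σ.var 3 + 1 + v) ≠ σ.var 3 + 1 + i := by omega
          have e₄ : -(σ.var 3 + 1 + v) ≠ -(σ.var 3 + 1 + i) := by omega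
          obtain ⟨k₁, k₂⟩ := h₄ v b₁ hlt
          refine ⟨k₁.congr ?_ ?_ ?_, ?_⟩ <;>
            simp only [Function.update_of_ne e₁, Function.update_of_ne e₂,
              Function.update_of_ne e₃, Function.update_of_ne e₄, k₂]
      · obtain ⟨q₁, q₂⟩ := q x b₁ (by omega)
        simp only [Function.update_of_ne q₁, Function.update_of_ne q₂]
        exact h₅ x b₁ b₂
  · intro τ hf _ h
    exact h

/-- Sum up capacities and costs. -/
def sumUp : Program :=
  .assign 12 (.const 0) ;; .assign 11 (.const 1) ;;
  .forTo 13 (.const 1) (.var 5 + .const 1)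
    (.assign 12 (.var 12 + .get 4 (.var 13)) ;; .assign 11 (.var 11 + .get 3 (.var 13)))

theorem sumUp_spec {σ : State} {N : ℕ} (hM : 0 ≤ σ.var 5) (hN : σ.var 5 ≤ N) :
    Wp sumUp σ N fun τ => τ.var 12 = ∑ a ∈ Finset.Icc 1 (σ.var 5), σ.arr 4 a ∧
      τ.var 11 = 1 + ∑ a ∈ Finset.Icc 1 (σ.var 5), σ.arr 3 a := by
  refine Wp.seq₀ (Wp.assign (Wp.seq₀ (Wp.assign (Wp.mono (T := N * (0 + 1)) ?_ (by simp)
    fun _ _ h => h))))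
  refine Wp.forTo (L := 1) (H := σ.var 5 + 1)
    (J := fun i τ => τ.var 12 = ∑ a ∈ Finset.Ico 1 i, σ.arr 4 a ∧
      τ.var 11 = 1 + ∑ a ∈ Finset.Ico 1 i, σ.arr 3 a)
    rfl (by simp) (by omega) (by omega) ?_ ?_ ?_ ?_
  · intro τ hf
    have h5 := hf.var 5 rfl
    simp at h5 ⊢
    exact h5
  · simp
  · intro i τ hf h₁ h₂ h₃ h₄
    refine Wp.seq₀ (Wp.assign (Wp.assign ?_))
    rw [← Finset.insert_Ico_right_eq_Ico_add_one h₁, Finset.sum_insert (by simp),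
      Finset.sum_insert (by simp)]
    have a4 : τ.arr 4 = σ.arr 4 := hf.arr 4 rfl
    have a3 : τ.arr 3 = σ.arr 3 := hf.arr 3 rfl
    simp [h₃, h₄.1, h₄.2, a3, a4]
    constructor <;> ring
  · intro τ hf _ h
    exact h

/-- Find a power of two that exceeds the sum of the capacities. -/
def findScale : Program :=
  .assign 10 (.const 1) ;;
  .loop (.op .lt (.var 10) (.var 12 + .const 1))
    (.assign 10 (.var 10 + .var 10) ;; .assign 11 (.var 11 + .var 11))

/-- Variable `11` is doubled along with the scale. This yields the product of one plus the sum of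
the costs with the scale, the required `K`, without a multiplication. -/
theorem findScale_spec {σ : State} {N : ℕ} (hN : σ.var 12 < 2 ^ N) :
    Wp findScale σ N fun τ => ∃ L ≤ N, τ.var 10 = 2 ^ L ∧ τ.var 11 = σ.var 11 * 2 ^ L ∧
      σ.var 12 < τ.var 10 := by
  refine Wp.seq₀ (Wp.assign (Wp.mono (T := N * (0 + 1)) ?_ (by simp) fun _ _ h => h))
  refine Wp.loop (fun k τ => ∃ j, k + j = N ∧ τ.var 10 = 2 ^ j ∧ τ.var 11 = σ.var 11 * 2 ^ j)
    ⟨0, by simp⟩ ?_ ?_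
  · rintro k τ hf ⟨j, rfl, h₁, h₂⟩ he
    have v12 : τ.var 12 = σ.var 12 := hf.var 12 rfl
    simp only [Expr.eval_lt, Expr.eval_add, Expr.eval_var, Expr.eval_const, v12, h₁, ne_eq,
      ite_eq_right_iff, one_ne_zero, imp_false, not_not] at he
    have hj : j < k + j := (pow_lt_pow_iff_right₀ (one_lt_two (α := ℤ))).1 (by omega)
    refine Wp.seq₀ (Wp.assign (Wp.assign ⟨k - 1, by omega, j + 1, by omega, ?_⟩))
    simp [h₁, h₂, pow_succ]
    constructor <;> ring
  · rintro k τ hf ⟨j, rfl, h₁, h₂⟩ he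
    have v12 : τ.var 12 = σ.var 12 := hf.var 12 rfl
    simp only [Expr.eval_lt, Expr.eval_add, Expr.eval_var, Expr.eval_const, v12,
      ite_eq_right_iff, one_ne_zero, imp_false] at he
    exact ⟨j, by omega, h₁, h₂, by omega⟩

/-- Set the costs of the auxiliary arcs. -/
def auxCosts : Program :=
  .forTo 20 (.const 0) (.var 2)
    (.store 3 (.var 3 + .const 1 + .var 20) (-.var 11) ;;
      .store 3 (-(.var 3 + .const 1 + .var 20)) (.var 11))

theorem auxCosts_spec {σ : State} {N : ℕ} (hn : 0 ≤ σ.var 2) (hN : σ.var 2 ≤ N)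
    (hm : 0 ≤ σ.var 3) :
    Wp auxCosts σ N fun τ => (∀ v, 0 ≤ v → v < σ.var 2 →
        τ.arr 3 (σ.var 3 + 1 + v) = -σ.var 11 ∧ τ.arr 3 (-(σ.var 3 + 1 + v)) = σ.var 11) ∧
      ∀ x, -σ.var 3 ≤ x → x ≤ σ.var 3 → τ.arr 3 x = σ.arr 3 x := by
  refine Wp.mono (T := N * (0 + 1)) ?_ (by simp) fun _ _ h => h
  refine Wp.forTo (L := 0) (H := σ.var 2)
    (J := fun i τ => (∀ v, 0 ≤ v → v < i →
        τ.arr 3 (σ.var 3 + 1 + v) = -σ.var 11 ∧ τ.arr 3 (-(σ.var 3 + 1 + v)) = σ.var 11) ∧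
      ∀ x, -σ.var 3 ≤ x → x ≤ σ.var 3 → τ.arr 3 x = σ.arr 3 x)
    rfl (by simp) (by omega) (by omega) ?_ ?_ ?_ ?_
  · intro τ hf
    simp [hf.var 2 rfl]
  · exact ⟨fun v h₁ h₂ => by omega, fun x _ _ => rfl⟩
  · rintro i τ hf h₁ h₂ h₃ ⟨h₄, h₅⟩
    have v3 := hf.var 3 rfl
    have v11 := hf.var 11 rfl
    refine Wp.seq₀ (Wp.store (Wp.store ?_))
    simp only [Expr.eval_var, Expr.eval_const, State.setArr_arr, State.setVar_arr,
      State.setArr_var, Expr.eval_add, if_true, h₃, v3, v11, Expr.eval_neg,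
      Function.update_apply]
    refine ⟨fun v b₁ b₂ => ?_, fun x b₁ b₂ => ?_⟩
    · rcases (show v ≤ i by omega).eq_or_lt with rfl | hlt
      · rw [if_neg (by omega), if_pos rfl, if_pos rfl]
        exact ⟨rfl, rfl⟩
      · rw [if_neg (by omega), if_neg (by omega), if_neg (by omega), if_neg (by omega)]
        exact h₄ v b₁ hlt
    · rw [if_neg (by omega), if_neg (by omega)]
      exact h₅ x b₁ b₂
  · intro τ hf _ h
    exact h

/-- Start with capacities `0`. -/
def clearRes : Program :=
  .forTo 13 (-.var 5) (.var 5 + .const 1) (.store 5 (.var 13) (.const 0))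

theorem clearRes_spec {σ : State} {N : ℕ} (hM : 0 ≤ σ.var 5) (hN : 2 * σ.var 5 + 1 ≤ N) :
    Wp clearRes σ N fun τ => ∀ x, τ.arr 5 x =
      if -σ.var 5 ≤ x ∧ x ≤ σ.var 5 then 0 else σ.arr 5 x := by
  refine Wp.mono (T := N * (0 + 1)) ?_ (by simp) fun _ _ h => h
  refine Wp.forTo (L := -σ.var 5) (H := σ.var 5 + 1)
    (J := fun i τ => ∀ x, τ.arr 5 x = if -σ.var 5 ≤ x ∧ x < i then 0 else σ.arr 5 x)
    rfl (by simp) (by omega) (by omega) ?_ ?_ ?_ ?_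
  · intro τ hf
    simp [hf.var 5 rfl]
  · intro x
    rw [if_neg (by omega)]
    rfl
  · intro i τ hf h₁ h₂ h₃ h₄
    refine Wp.store fun x => ?_
    simp only [State.setVar_arr, State.setArr_arr, if_true, Expr.eval_const, Expr.eval_var,
      h₃, Function.update_apply, h₄]
    split_ifs <;> first | rfl | omega
  · intro τ hf _ h x
    rw [h]
    split_ifs <;> first | rfl | omega

/-- Check that all auxiliary arcs are saturated. -/
def checkAux : Program :=
  .forTo 20 (.const 0) (.var 2)
    (.ite (.get 5 (.var 3 + .const 1 + .var 20)) (.assign 9 (.const 0)) .skip)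

theorem checkAux_spec {σ : State} {N : ℕ} (hn : 0 ≤ σ.var 2) (hN : σ.var 2 ≤ N) :
    Wp checkAux σ N fun τ => (τ.var 9 ≠ 0 ↔ σ.var 9 ≠ 0 ∧ ∀ v, 0 ≤ v → v < σ.var 2 →
      σ.arr 5 (σ.var 3 + 1 + v) = 0) := by
  refine Wp.mono (T := N * (0 + 1)) ?_ (by simp) fun _ _ h => h
  refine Wp.forTo (L := 0) (H := σ.var 2)
    (J := fun i τ => (τ.var 9 ≠ 0 ↔ σ.var 9 ≠ 0 ∧ ∀ v, 0 ≤ v → v < i →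
      σ.arr 5 (σ.var 3 + 1 + v) = 0))
    rfl (by simp) (by omega) (by omega) ?_ ?_ ?_ ?_
  · intro τ hf
    simp [hf.var 2 rfl]
  · simp only [State.setVar_var, Nat.reduceEqDiff, if_false]
    exact ⟨fun h => ⟨h, fun a h₁ h₂ => by omega⟩, fun h => h.1⟩
  · intro i τ hf h₁ h₂ h₃ h₄
    have v3 := hf.var 3 rfl
    have a5 := hf.arr 5 rfl
    refine Wp.ite (fun c => Wp.assign ?_) fun c => Wp.skip ?_
    all_goals
      simp only [Expr.eval_get, Expr.eval_add, Expr.eval_var, Expr.eval_const, v3, a5, h₃] at c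
      simp only [State.setVar_var, Nat.reduceEqDiff, if_false, if_true, Expr.eval_const]
    · exact ⟨fun h => absurd rfl h, fun h => absurd (h.2 i h₁ (by omega)) c⟩
    · refine h₄.trans (and_congr_right fun _ =>
        ⟨fun h a ha₁ ha₂ => ?_, fun h a ha₁ ha₂ => h a ha₁ (by omega)⟩)
      rcases (show a ≤ i by omega).eq_or_lt with rfl | hlt
      exacts [c, h a ha₁ hlt]
  · intro τ hf _ h
    exact h

/-- Write the flow of the current scenario to the output. -/
def writeFlow : Program :=
  .forTo 13 (.const 1) (.var 3 + .const 1)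
    (.store 1 (.var 8) (.get 10 (.var 13) + .get 5 (-.var 13)) ;;
      .assign 8 (.var 8 + .const 1))

theorem writeFlow_spec {σ : State} {N : ℕ} (hm : 0 ≤ σ.var 3) (hN : σ.var 3 ≤ N) :
    Wp writeFlow σ N fun τ => τ.var 8 = σ.var 8 + σ.var 3 ∧
      (∀ x < σ.var 8, τ.arr 1 x = σ.arr 1 x) ∧
      ∀ a, 1 ≤ a → a ≤ σ.var 3 → τ.arr 1 (σ.var 8 + (a - 1)) = σ.arr 10 a + σ.arr 5 (-a) := by
  refine Wp.mono (T := N * (0 + 1)) ?_ (by simp) fun _ _ h => h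
  refine Wp.forTo (L := 1) (H := σ.var 3 + 1)
    (J := fun i τ => τ.var 8 = σ.var 8 + (i - 1) ∧
      (∀ x < σ.var 8, τ.arr 1 x = σ.arr 1 x) ∧
      ∀ a, 1 ≤ a → a < i → τ.arr 1 (σ.var 8 + (a - 1)) = σ.arr 10 a + σ.arr 5 (-a))
    rfl (by simp) (by omega) (by omega) ?_ ?_ ?_ ?_
  · intro τ hf
    simp [hf.var 3 rfl]
  · refine ⟨by simp, fun x _ => rfl, fun a h₁ h₂ => by omega⟩
  · rintro i τ hf h₁ h₂ h₃ ⟨h₄, h₅, h₆⟩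
    have a10 := hf.arr 10 rfl
    have a5 := hf.arr 5 rfl
    refine Wp.seq₀ (Wp.store (Wp.assign ?_))
    simp only [Expr.eval_var, Expr.eval_const, State.setArr_arr, State.setVar_arr,
      State.setArr_var, State.setVar_var, Expr.eval_add, Expr.eval_get, if_true, h₃, h₄, a10, a5,
      Nat.reduceEqDiff, if_false, Expr.eval_neg, Function.update_apply]
    refine ⟨by ring, fun x hx => ?_, fun a ha₁ ha₂ => ?_⟩
    · rw [if_neg (by omega), h₅ x hx]
    · rcases (show a ≤ i by omega).eq_or_lt with rfl | hlt
      · rw [if_pos rfl]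
      · rw [if_neg (by omega), h₆ a ha₁ hlt]
  · rintro τ hf - ⟨h₄, h₅, h₆⟩
    exact ⟨by omega, h₅, fun a ha₁ ha₂ => h₆ a ha₁ (by omega)⟩

end Ram

/-! ### One scenario -/

namespace LoadInstance

/-- The load of an arc, `0` for free arcs. -/
def loadOf (I : LoadInstance) (a : Fin I.m) : ℕ :=
  if h : a ∈ I.net.fixed then I.load ⟨a, h⟩ else 0

/-- The array `inp` holds the encoding of `I`. -/
structure InputOf (I : LoadInstance) (inp : ℤ → ℤ) : Prop where
  n : inp 0 = I.n
  m : inp 1 = I.m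
  k : inp 2 = I.k
  tail : ∀ i : Fin I.m, inp (6 * ((i : ℕ) + 1) - 3) = (I.net.tail i : ℕ)
  head : ∀ i : Fin I.m, inp (6 * ((i : ℕ) + 1) - 2) = (I.net.head i : ℕ)
  fixed : ∀ i : Fin I.m, inp (6 * ((i : ℕ) + 1) - 1) = if i ∈ I.net.fixed then 1 else 0
  cap : ∀ i : Fin I.m, inp (6 * ((i : ℕ) + 1)) = I.net.cap i
  cost : ∀ i : Fin I.m, inp (6 * ((i : ℕ) + 1) + 1) = I.net.cost i
  load : ∀ i : Fin I.m, inp (6 * ((i : ℕ) + 1) + 2) = I.loadOf i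
  bal : ∀ (s : Fin I.k) (v : Fin I.n),
    inp (3 + 6 * I.m + (s : ℕ) * I.n + (v : ℕ)) = I.net.bal s v

/-- Bounds on the dimensions and the numbers of an instance. -/
structure SizeLe (I : LoadInstance) (N : ℕ) : Prop where
  arcs : 2 * (I.n + I.m) + 1 ≤ N
  scenarios : I.k ≤ N
  cap : ∀ i, I.net.cap i < 2 ^ N
  load : ∀ i, I.loadOf i < 2 ^ N
  bal : ∀ s v, (I.net.bal s v).natAbs < 2 ^ N

variable (I : LoadInstance)

/-- The reduced instance of the scenario `s`, with the fixed arcs kept without capacity. -/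
abbrev closed (s : Fin I.k) : FlowInstance (Fin I.n) (Fin I.m) := I.net.closed I.load s

/-- Free arcs have load `0`, so the sum may run over all arcs, as it does in the program. -/
theorem closed_bal (s : Fin I.k) (v : Fin I.n) :
    (I.closed s).bal v = I.net.bal s v + ∑ i, (I.loadOf i : ℤ) *
      ((if I.net.head i = v then 1 else 0) - if I.net.tail i = v then 1 else 0) := by
  have h := I.net.sum_mul_reducedBal I.load s (Pi.single v 1)
  simp only [Pi.single_apply, ite_mul, one_mul, zero_mul, Finset.sum_ite_eq', Finset.mem_univ,
    if_true] at h
  have h' := I.net.sum_arcs fun i => (I.loadOf i : ℤ) *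
      ((if I.net.head i = v then 1 else 0) - if I.net.tail i = v then 1 else 0)
  rw [Finset.sum_eq_zero (s := (Finset.univ : Finset {a // a ∉ I.net.fixed})), add_zero] at h'
  · rw [h']
    refine h.trans ?_
    rw [sub_eq_add_neg, ← Finset.sum_neg_distrib]
    congr 1
    refine Finset.sum_congr rfl fun a _ => ?_
    have : I.loadOf a = I.load a := dif_pos a.2
    rw [this]
    ring
  · intro a _
    simp [loadOf, a.2]

theorem SizeLe.closed_bal_le {I : LoadInstance} {N : ℕ} (h : I.SizeLe N) (s : Fin I.k)
    (v : Fin I.n) : |(I.closed s).bal v| ≤ (I.m + 1) * 2 ^ N := by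
  rw [closed_bal]
  have h₁ : |I.net.bal s v| ≤ 2 ^ N := by
    have := h.bal s v
    zify at this
    exact this.le
  have h₂ : |∑ i, (I.loadOf i : ℤ) *
      ((if I.net.head i = v then 1 else 0) - if I.net.tail i = v then 1 else 0)| ≤
      I.m * 2 ^ N := by
    refine (Finset.abs_sum_le_sum_abs _ _).trans ?_
    refine (Finset.sum_le_card_nsmul _ _ (2 ^ N) fun i _ => ?_).trans (by simp)
    have h₃ : (I.loadOf i : ℤ) ≤ 2 ^ N := by exact_mod_cast (h.load i).le
    rw [abs_mul, Nat.abs_cast]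
    refine (mul_le_of_le_one_right (by positivity) ?_).trans h₃
    split_ifs <;> simp
  refine (abs_add_le _ _).trans ((add_le_add h₁ h₂).trans_eq ?_)
  ring

end LoadInstance

namespace Residual

theorem arc_cases {n m : ℕ} {a : ℤ} (h₁ : 1 ≤ a) (h₂ : a ≤ n + m) :
    (∃ i : Fin m, a = (i : ℕ) + 1) ∨ ∃ v : Fin n, a = m + 1 + (v : ℕ) := by
  rcases le_or_gt a m with h | h
  · exact .inl ⟨⟨(a - 1).toNat, by omega⟩, by simp; omega⟩
  · exact .inr ⟨⟨(a - m - 1).toNat, by omega⟩, by simp; omega⟩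

/-- The index `0` lies in the range of residual arcs without belonging to any arc, hence the
separate hypothesis `h0`. -/
theorem Represents.good {n m : ℕ} {J : FlowInstance (Fin n) (Fin m)} {tl c u : ℤ → ℤ} {K : ℤ}
    (h : Represents J tl c u K) (h0 : tl 0 = 0) : Good n (n + m) tl c := by
  have key : ∀ a, 1 ≤ a → a ≤ (n + m : ℤ) →
      (0 ≤ tl a ∧ tl a ≤ n) ∧ 0 ≤ tl (-a) ∧ tl (-a) ≤ n := by
    intro a h₁ h₂
    rcases arc_cases h₁ h₂ with ⟨i, rfl⟩ | ⟨v, rfl⟩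
    · rw [h.tail, h.head]
      omega
    · rcases h.aux v with ⟨-, e₁, e₂, -⟩ | ⟨-, e₁, e₂, -⟩ <;> rw [e₁, e₂] <;> omega
  have key' : ∀ e, -(n + m : ℤ) ≤ e → e ≤ n + m → 0 ≤ tl e ∧ tl e ≤ n := by
    intro e h₁ h₂
    rcases lt_trichotomy e 0 with h₃ | rfl | h₃
    · simpa using (key (-e) (by omega) (by omega)).2
    · rw [h0]
      omega
    · exact (key e (by omega) h₂).1
  exact ⟨fun e h₁ h₂ => (key' e h₁ h₂).1, fun e h₁ h₂ => (key' e h₁ h₂).2, h.cost_neg⟩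

end Residual

/-! ### Preparing and solving the network of one scenario -/

namespace Ram

open Residual

/-- Set up the network of a scenario. -/
def prepare : Program :=
  loadArcs ;; loadBalances ;; adjustBalances ;; auxArcs ;; sumUp ;; findScale ;; auxCosts ;;
    .store 2 (.const 0) (.const 0) ;; .store 3 (.const 0) (.const 0) ;; clearRes

/-- The global variables while the scenario `s` is processed. -/
structure Ready (I : LoadInstance) (s : ℕ) (σ : State) : Prop where
  n : σ.var 2 = I.n
  m : σ.var 3 = I.m
  k : σ.var 4 = I.k
  arcs : σ.var 5 = I.n + I.m
  pos : σ.var 7 = 3 + 6 * I.m + s * I.n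
  inp : I.InputOf (σ.arr 0)
  res : ∀ x, 0 ≤ σ.arr 5 x

/-- The scale exceeds every capacity, so all rounded capacities are `0` and no arc in range is
residual. Any potential is then a certificate, including the one left by the previous scenario. -/
theorem prepare_spec {I : LoadInstance} {N : ℕ} {σ : State} (s : Fin I.k) (hR : Ready I s σ)
    (hN : I.SizeLe N) :
    Wp prepare σ (N + (N + (N + (N + (N + (3 * N + (N + N))))))) fun τ =>
      (∃ K, Represents (I.closed s) (τ.arr 2) (τ.arr 3) (τ.arr 4) K) ∧ τ.arr 2 0 = 0 ∧
      (∃ L ≤ 3 * N, τ.var 10 = 2 ^ L) ∧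
      Solved (I.n + I.m) (τ.arr 2) (τ.arr 3) (fun a => τ.arr 4 a / τ.var 10) (τ.arr 5)
        (τ.arr 6) ∧
      (∀ i : Fin I.m, τ.arr 10 ((i : ℕ) + 1) = I.loadOf i) ∧
      (τ.var 9 ≠ 0 ↔ σ.var 9 ≠ 0 ∧ ∀ a, I.load a ≤ I.net.cap a) := by
  have hNa := hN.arcs
  have r2 := hR.n
  have r3 := hR.m
  have r5 := hR.arcs
  -- reading the input
  refine Wp.seq ((loadArcs_spec (by omega) (by omega)).mono le_rfl fun τ₁ f₁ ⟨p₁, p₁'⟩ => ?_)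
  have arc : ∀ i : Fin I.m, τ₁.arr 2 ((i : ℕ) + 1) = (I.net.tail i : ℕ) ∧
      τ₁.arr 2 (-((i : ℕ) + 1)) = (I.net.head i : ℕ) ∧
      τ₁.arr 3 ((i : ℕ) + 1) = I.net.cost i ∧ τ₁.arr 3 (-((i : ℕ) + 1)) = -I.net.cost i ∧
      τ₁.arr 10 ((i : ℕ) + 1) = I.loadOf i ∧ τ₁.arr 4 ((i : ℕ) + 1) = (I.closed s).cap i := by
    intro i
    obtain ⟨q₁, q₂, q₃, q₄, q₅, q₆⟩ := p₁ ((i : ℕ) + 1) (by omega) (by omega)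
    rw [hR.inp.tail] at q₁
    rw [hR.inp.head] at q₂
    rw [hR.inp.cost] at q₃ q₄
    rw [hR.inp.load] at q₅
    rw [hR.inp.fixed, hR.inp.cap] at q₆
    refine ⟨q₁, q₂, q₃, q₄, q₅, q₆.trans ?_⟩
    simp only [LoadInstance.closed, RobustNetwork.closed]
    by_cases hi : i ∈ I.net.fixed <;> simp [hi]
  have ok : τ₁.var 9 ≠ 0 ↔ σ.var 9 ≠ 0 ∧ ∀ a, I.load a ≤ I.net.cap a := by
    rw [p₁']
    refine and_congr_right fun _ => ⟨fun h a => ?_, fun h a h₁ h₂ h₃ => ?_⟩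
    · have := h ((a.1 : ℕ) + 1) (by omega) (by omega)
      rw [hR.inp.fixed, hR.inp.load, hR.inp.cap, if_pos a.2, LoadInstance.loadOf,
        dif_pos a.2] at this
      exact_mod_cast this one_ne_zero
    · obtain ⟨i, rfl⟩ : ∃ i : Fin I.m, a = (i : ℕ) + 1 :=
        ⟨⟨(a - 1).toNat, by omega⟩, by simp; omega⟩
      rw [hR.inp.fixed] at h₃
      have hi : i ∈ I.net.fixed := by
        by_contra hi
        simp [hi] at h₃
      rw [hR.inp.load, hR.inp.cap, LoadInstance.loadOf, dif_pos hi]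
      exact_mod_cast h ⟨i, hi⟩
  have r2₁ := (f₁.var 2 rfl).trans r2
  refine Wp.seq ((loadBalances_spec (by omega) (by omega)).mono le_rfl fun τ₂ f₂ p₂ => ?_)
  have r3₂ := ((f₂.var 3 rfl).trans (f₁.var 3 rfl)).trans r3
  refine Wp.seq ((adjustBalances_spec (by omega) (by omega)).mono le_rfl fun τ₃ f₃ p₃ => ?_)
  have bal : ∀ v : Fin I.n, τ₃.arr 9 (v : ℕ) = (I.closed s).bal v := by
    intro v
    rw [p₃, p₂ _ (by omega) (by omega), f₁.arr 0 rfl, f₁.var 7 rfl, hR.pos, hR.inp.bal,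
      I.closed_bal, r3₂, sum_Icc_one]
    congr 1
    refine Finset.sum_congr rfl fun i _ => ?_
    obtain ⟨q₁, q₂, q₃, q₄, q₅, q₆⟩ := arc i
    rw [f₂.arr 10 rfl, f₂.arr 2 rfl, q₁, q₂, q₅]
    simp only [Nat.cast_inj, Fin.val_inj]
  -- auxiliary arcs
  have r2₃ := ((f₃.var 2 rfl).trans (f₂.var 2 rfl)).trans r2₁
  have r3₃ := (f₃.var 3 rfl).trans r3₂
  refine Wp.seq ((auxArcs_spec (by omega) (by omega) (by omega)).mono le_rfl
    fun τ₄ f₄ ⟨p₄, p₄'⟩ => ?_)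
  rw [r2₃, r3₃] at p₄
  rw [r3₃] at p₄'
  have a2₃ := (f₃.arr 2 rfl).trans (f₂.arr 2 rfl)
  have a3₃ := (f₃.arr 3 rfl).trans (f₂.arr 3 rfl)
  have a4₃ := (f₃.arr 4 rfl).trans (f₂.arr 4 rfl)
  have arc₄ : ∀ i : Fin I.m, τ₄.arr 2 ((i : ℕ) + 1) = (I.net.tail i : ℕ) ∧
      τ₄.arr 2 (-((i : ℕ) + 1)) = (I.net.head i : ℕ) ∧
      τ₄.arr 3 ((i : ℕ) + 1) = I.net.cost i ∧ τ₄.arr 3 (-((i : ℕ) + 1)) = -I.net.cost i ∧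
      τ₄.arr 4 ((i : ℕ) + 1) = (I.closed s).cap i := by
    intro i
    obtain ⟨q₁, q₂, q₃, q₄, q₅, q₆⟩ := arc i
    obtain ⟨w₁, w₂, w₃⟩ := p₄' ((i : ℕ) + 1) (by omega) (by omega)
    obtain ⟨x₁, x₂, x₃⟩ := p₄' (-((i : ℕ) + 1)) (by omega) (by omega)
    rw [w₁, w₂, w₃, x₁, x₂, a2₃, a3₃, a4₃]
    exact ⟨q₁, q₂, q₃, q₄, q₆⟩
  have aux₄ : ∀ v : Fin I.n, AuxArc (τ₄.arr 2) (τ₄.arr 4) I.n (v : ℕ) ((I.closed s).bal v)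
      (I.m + 1 + (v : ℕ)) ∧ τ₄.arr 3 (I.m + 1 + (v : ℕ)) = 0 := by
    intro v
    have := p₄ (v : ℕ) (by omega) (by omega)
    rwa [bal] at this
  -- scale
  have r5₄ := (f₄.var 5 rfl).trans ((f₃.var 5 rfl).trans ((f₂.var 5 rfl).trans
    ((f₁.var 5 rfl).trans r5)))
  refine Wp.seq ((sumUp_spec (by omega) (by omega)).mono le_rfl fun τ₅ f₅ ⟨p₅, p₅'⟩ => ?_)
  rw [r5₄, sum_Icc_add] at p₅ p₅'
  have uaux : ∀ v : Fin I.n, τ₄.arr 4 (I.m + 1 + (v : ℕ)) = |(I.closed s).bal v| := by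
    intro v
    rcases (aux₄ v).1 with ⟨h, -, -, h'⟩ | ⟨h, -, -, h'⟩
    · rw [h', abs_of_nonneg h]
    · rw [h', abs_of_neg h]
  have cap_le : ∀ i, (I.closed s).cap i < 2 ^ N := by
    intro i
    simp only [LoadInstance.closed, RobustNetwork.closed]
    split_ifs
    exacts [by positivity, hN.cap i]
  simp only [fun i => (arc₄ i).2.2.2.2, uaux] at p₅
  simp only [fun i => (arc₄ i).2.2.1, fun v => (aux₄ v).2, Finset.sum_const_zero,
    add_zero] at p₅'
  -- There are fewer than `N * N` summands of size `2 ^ N` in total, counting the adjusted balances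
  -- with weight `m + 1`, and `N * N ≤ 2 ^ N * 2 ^ N`.
  have sum_lt : τ₅.var 12 < 2 ^ (3 * N) := by
    have h₁ : ∑ i, ((I.closed s).cap i : ℤ) ≤ I.m * 2 ^ N :=
      (Finset.sum_le_card_nsmul _ _ (2 ^ N) fun i _ => by exact_mod_cast (cap_le i).le).trans
        (by simp)
    have h₂ : ∑ v, |(I.closed s).bal v| ≤ I.n * ((I.m + 1) * 2 ^ N) :=
      (Finset.sum_le_card_nsmul _ _ _ fun v _ => hN.closed_bal_le s v).trans (by simp)
    have h₃ : (I.m + I.n * (I.m + 1) : ℤ) < N * N := by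
      have : (2 * (I.n + I.m) + 1 : ℤ) ≤ N := by exact_mod_cast hNa
      nlinarith
    have h₄ : (N : ℤ) < 2 ^ N := by exact_mod_cast Nat.lt_two_pow_self
    have h₅ : (N * N : ℤ) ≤ 2 ^ N * 2 ^ N := mul_le_mul h₄.le h₄.le (by positivity) (by positivity)
    rw [p₅, pow_mul', pow_succ, pow_two]
    have h₆ : (0 : ℤ) < 2 ^ N := by positivity
    nlinarith
  refine Wp.seq ((findScale_spec sum_lt).mono le_rfl fun τ₆ f₆ ⟨L, hL, p₆, p₆', p₆''⟩ => ?_)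
  -- costs of the auxiliary arcs
  have r2₆ := (f₆.var 2 rfl).trans ((f₅.var 2 rfl).trans ((f₄.var 2 rfl).trans r2₃))
  have r3₆ := (f₆.var 3 rfl).trans ((f₅.var 3 rfl).trans ((f₄.var 3 rfl).trans r3₃))
  refine Wp.seq ((auxCosts_spec (by omega) (by omega) (by omega)).mono le_rfl
    fun τ₇ f₇ ⟨p₇, p₇'⟩ => ?_)
  rw [r2₆, r3₆] at p₇
  rw [r3₆, f₆.arr 3 rfl, f₅.arr 3 rfl] at p₇'
  refine Wp.seq₀ (Wp.store (Wp.seq₀ (Wp.store ?_)))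
  have r5₇ := (f₇.var 5 rfl).trans ((f₆.var 5 rfl).trans ((f₅.var 5 rfl).trans r5₄))
  refine (clearRes_spec (by simp [r5₇]; omega) (by simp [r5₇]; omega)).mono le_rfl
    fun τ₈ f₈ p₈ => ?_
  simp only [Expr.eval_const] at f₈ p₈
  have x2 : τ₈.arr 2 = Function.update (τ₄.arr 2) 0 0 := by
    rw [f₈.arr 2 rfl]
    simp [f₇.arr 2 rfl, f₆.arr 2 rfl, f₅.arr 2 rfl]
  have x3 : τ₈.arr 3 = Function.update (τ₇.arr 3) 0 0 := by
    rw [f₈.arr 3 rfl]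
    simp
  have x4 : τ₈.arr 4 = τ₄.arr 4 :=
    (f₈.arr 4 rfl).trans ((f₇.arr 4 rfl).trans ((f₆.arr 4 rfl).trans (f₅.arr 4 rfl)))
  have x5 : ∀ x, τ₈.arr 5 x = if -(I.n + I.m : ℤ) ≤ x ∧ x ≤ I.n + I.m then 0 else σ.arr 5 x := by
    intro x
    rw [p₈]
    simp [r5₇, f₇.arr 5 rfl, f₆.arr 5 rfl, f₅.arr 5 rfl, f₄.arr 5 rfl, f₃.arr 5 rfl,
      f₂.arr 5 rfl, f₁.arr 5 rfl]
  have x10 : τ₈.arr 10 = τ₁.arr 10 :=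
    (f₈.arr 10 rfl).trans ((f₇.arr 10 rfl).trans ((f₆.arr 10 rfl).trans ((f₅.arr 10 rfl).trans
      ((f₄.arr 10 rfl).trans ((f₃.arr 10 rfl).trans (f₂.arr 10 rfl))))))
  have y9 : τ₈.var 9 = τ₁.var 9 :=
    (f₈.var 9 rfl).trans ((f₇.var 9 rfl).trans ((f₆.var 9 rfl).trans ((f₅.var 9 rfl).trans
      ((f₄.var 9 rfl).trans ((f₃.var 9 rfl).trans (f₂.var 9 rfl))))))
  have y10 : τ₈.var 10 = 2 ^ L := (f₈.var 10 rfl).trans ((f₇.var 10 rfl).trans p₆)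
  have cap_nonneg : ∀ a, 1 ≤ a → a ≤ (I.n + I.m : ℤ) → 0 ≤ τ₄.arr 4 a ∧ τ₄.arr 4 a < 2 ^ L := by
    intro a h₁ h₂
    rw [← p₆]
    have h₃ : 0 ≤ ∑ i, ((I.closed s).cap i : ℤ) := by positivity
    have h₄ : 0 ≤ ∑ v, |(I.closed s).bal v| := by positivity
    rcases arc_cases h₁ h₂ with ⟨i, rfl⟩ | ⟨v, rfl⟩
    · rw [(arc₄ i).2.2.2.2]
      have := Finset.single_le_sum (f := fun i => ((I.closed s).cap i : ℤ))
        (fun i _ => by positivity) (Finset.mem_univ i)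
      omega
    · rw [uaux]
      have := Finset.single_le_sum (f := fun v => |(I.closed s).bal v|)
        (fun i _ => abs_nonneg _) (Finset.mem_univ v)
      have := abs_nonneg ((I.closed s).bal v)
      omega
  have cost₇ : ∀ i : Fin I.m, τ₇.arr 3 ((i : ℕ) + 1) = I.net.cost i ∧
      τ₇.arr 3 (-((i : ℕ) + 1)) = -I.net.cost i := by
    intro i
    rw [p₇' _ (by omega) (by omega), p₇' _ (by omega) (by omega)]
    exact ⟨(arc₄ i).2.2.1, (arc₄ i).2.2.2.1⟩
  have cost_neg : ∀ a, 1 ≤ a → a ≤ (I.n + I.m : ℤ) → τ₇.arr 3 (-a) = -τ₇.arr 3 a := by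
    intro a h₁ h₂
    rcases arc_cases h₁ h₂ with ⟨i, rfl⟩ | ⟨v, rfl⟩
    · rw [(cost₇ i).1, (cost₇ i).2]
    · obtain ⟨q₁, q₂⟩ := p₇ (v : ℕ) (by omega) (by omega)
      rw [q₁, q₂, neg_neg]
  refine ⟨⟨τ₆.var 11, ?_⟩, by rw [x2, Function.update_self], ⟨L, hL, y10⟩, ?_, ?_, ?_⟩
  · refine ⟨fun i => ?_, fun i => ?_, fun i => ?_, fun i => ?_, fun a h₁ h₂ => ?_, fun v => ?_,
      fun v => ?_, ?_⟩
    · rw [x2, Function.update_of_ne (by omega)]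
      exact (arc₄ i).1
    · rw [x2, Function.update_of_ne (by omega)]
      exact (arc₄ i).2.1
    · rw [x3, Function.update_of_ne (by omega)]
      exact (cost₇ i).1
    · rw [x4]
      exact (arc₄ i).2.2.2.2
    · rw [x3]
      rcases lt_trichotomy a 0 with h | rfl | h
      · have := cost_neg (-a) (by omega) (by omega)
        rw [Function.update_of_ne (by omega), Function.update_of_ne (by omega)]
        rw [neg_neg] at this
        omega
      · simp
      · rw [Function.update_of_ne (by omega), Function.update_of_ne (by omega)]
        exact cost_neg a (by omega) h₂
    · rw [x3, Function.update_of_ne (by omega)]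
      exact (p₇ (v : ℕ) (by omega) (by omega)).1
    · rw [x4]
      refine (aux₄ v).1.congr ?_ ?_ rfl <;> rw [x2, Function.update_of_ne (by omega)]
    -- Every capacity is below `2 ^ L`, so the largest conceivable cost is below `(1 + ∑ cost) * 2 ^
    -- L`.
    · rw [p₆', p₅']
      have h₁ : ∑ i, (((I.closed s).cost i : ℤ) * ((I.closed s).cap i : ℤ)) ≤
          (∑ i, (I.net.cost i : ℤ)) * 2 ^ L := by
        rw [Finset.sum_mul]
        refine Finset.sum_le_sum fun i _ => mul_le_mul_of_nonneg_left ?_ (by positivity)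
        rw [← (arc₄ i).2.2.2.2]
        exact (cap_nonneg _ (by omega) (by omega)).2.le
      have h₂ : (0 : ℤ) < 2 ^ L := by positivity
      rw [add_mul]
      omega
  · refine ⟨fun x => ?_, fun e h₁ h₂ h₃ => ?_, fun p => ?_, fun a h₁ h₂ => ?_⟩
    -- Outside of the arc range old entries survive; `Ready.res` records that they are nonnegative.
    · rw [x5]
      split_ifs
      exacts [le_rfl, hR.res x]
    · rw [x5, if_pos ⟨h₁, h₂⟩] at h₃
      exact absurd h₃ (lt_irrefl 0)
    · refine Finset.sum_eq_zero fun a ha => ?_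
      rw [Finset.mem_Icc] at ha
      rw [x5, if_pos (by omega), zero_mul]
    · rw [x5, x5, if_pos (by omega), if_pos (by omega), x4, y10]
      obtain ⟨h₃, h₄⟩ := cap_nonneg a h₁ h₂
      rw [Int.ediv_eq_zero_of_lt h₃ h₄, add_zero]
  · intro i
    rw [x10]
    exact (arc i).2.2.2.2.1
  · rw [y9]
    exact ok

/-- Solve a scenario. -/
def solveScenario : Program :=
  prepare ;; scaling ;; checkAux ;; writeFlow ;; .assign 7 (.var 7 + .var 2)

/-- A bound on the number of loop iterations of `solveScenario`. -/
def scenarioTime (N : ℕ) : ℕ :=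
  (N + (N + (N + (N + (N + (3 * N + (N + N))))))) +
    (3 * N * (N + N * (N + (N * (N + N + 1) + N) + 1) + 1) + (N + (N + 0)))

/-- An infeasible scenario does not stop the program. It only clears the flag `9`, and the values
written for it are meaningless. Feasibility is read off from saturation of the auxiliary arcs. -/
theorem solveScenario_spec {I : LoadInstance} {N : ℕ} {σ : State} (s : Fin I.k)
    (hR : Ready I s σ) (hN : I.SizeLe N) :
    Wp solveScenario σ (scenarioTime N) fun τ => Ready I (s + 1) τ ∧
      τ.var 8 = σ.var 8 + I.m ∧ (∀ x < σ.var 8, τ.arr 1 x = σ.arr 1 x) ∧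
      (τ.var 9 ≠ 0 ↔ σ.var 9 ≠ 0 ∧ (∀ a, I.load a ≤ I.net.cap a) ∧
        ∃ f, (I.closed s).IsFlow f) ∧
      (τ.var 9 ≠ 0 → ∃ f, (I.closed s).IsMinCostFlow f ∧
        ∀ i : Fin I.m, τ.arr 1 (σ.var 8 + (i : ℕ)) = (I.loadOf i + f i : ℕ)) := by
  have hNa := hN.arcs
  have r2 := hR.n
  have r3 := hR.m
  have r5 := hR.arcs
  refine Wp.seq ((prepare_spec s hR hN).mono le_rfl
    fun τ₁ f₁ ⟨⟨K, hK⟩, h0, ⟨L, hL, hD⟩, hS, hl, hok⟩ => ?_)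
  have r2₁ := (f₁.var 2 rfl).trans r2
  have r5₁ := (f₁.var 5 rfl).trans r5
  have sc := scaling_spec (σ := τ₁) (N := N) (L := L)
  rw [r2₁, r5₁] at sc
  refine Wp.seq ((sc (by omega) (by omega) (by omega) (by omega) (hK.good h0) hD hS).mono
    (Nat.mul_le_mul_right _ hL) fun τ₂ f₂ p₂ => ?_)
  have r2₂ := (f₂.var 2 rfl).trans r2₁
  refine Wp.seq ((checkAux_spec (by omega) (by omega)).mono le_rfl fun τ₃ f₃ p₃ => ?_)
  have r3₂ := ((f₂.var 3 rfl).trans (f₁.var 3 rfl)).trans r3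
  have r3₃ := (f₃.var 3 rfl).trans r3₂
  refine Wp.seq ((writeFlow_spec (by omega) (by omega)).mono le_rfl
    fun τ₄ f₄ ⟨p₄, p₄', p₄''⟩ => Wp.assign ?_)
  have r2₄ := ((f₄.var 2 rfl).trans (f₃.var 2 rfl)).trans r2₂
  have y8 : τ₃.var 8 = σ.var 8 := (f₃.var 8 rfl).trans ((f₂.var 8 rfl).trans (f₁.var 8 rfl))
  have x5 : τ₄.arr 5 = τ₂.arr 5 := (f₄.arr 5 rfl).trans (f₃.arr 5 rfl)
  have y9 : τ₄.var 9 = τ₃.var 9 := f₄.var 9 rfl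
  have y7 : τ₄.var 7 = σ.var 7 := (f₄.var 7 rfl).trans ((f₃.var 7 rfl).trans ((f₂.var 7 rfl).trans
    (f₁.var 7 rfl)))
  have aux : (∀ v, 0 ≤ v → v < τ₂.var 2 → τ₂.arr 5 (τ₂.var 3 + 1 + v) = 0) ↔
      ∀ v : Fin I.n, τ₂.arr 5 (I.m + 1 + (v : ℕ)) = 0 := by
    rw [r2₂, r3₂]
    refine ⟨fun h v => h _ (by omega) (by omega), fun h v h₁ h₂ => ?_⟩
    have := h ⟨v.toNat, by omega⟩
    simpa [Int.toNat_of_nonneg h₁] using this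
  rw [aux, f₂.var 9 rfl, hok] at p₃
  refine ⟨⟨?_, ?_, ?_, ?_, ?_, ?_, ?_⟩, ?_, ?_, ?_, ?_⟩ <;>
    simp only [State.setVar_var, State.setVar_arr, Nat.reduceEqDiff, if_false, if_true,
      Expr.eval_add, Expr.eval_var]
  · exact r2₄
  · exact (f₄.var 3 rfl).trans r3₃
  · exact (f₄.var 4 rfl).trans ((f₃.var 4 rfl).trans ((f₂.var 4 rfl).trans
      ((f₁.var 4 rfl).trans hR.k)))
  · exact (f₄.var 5 rfl).trans ((f₃.var 5 rfl).trans ((f₂.var 5 rfl).trans r5₁))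
  · rw [y7, r2₄, hR.pos]
    push_cast
    ring
  · rw [f₄.arr 0 rfl, f₃.arr 0 rfl, f₂.arr 0 rfl, f₁.arr 0 rfl]
    exact hR.inp
  · rw [x5]
    exact p₂.nonneg
  · rw [p₄, y8, r3₃]
  · intro x hx
    rw [p₄' x (by omega), f₃.arr 1 rfl, f₂.arr 1 rfl, f₁.arr 1 rfl]
  · rw [y9, p₃, and_assoc]
    refine and_congr_right fun _ => and_congr_right fun _ => ⟨fun h => ⟨_, hK.isFlow p₂ h⟩, ?_⟩
    rintro ⟨f, hf⟩
    exact (hK.compare p₂ hf).1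
  · intro h
    rw [y9, p₃] at h
    refine ⟨_, ⟨hK.isFlow p₂ h.2, fun g hg => (hK.compare p₂ hg).2⟩, fun i => ?_⟩
    have := p₄'' ((i : ℕ) + 1) (by omega) (by omega)
    rw [add_sub_cancel_right, y8] at this
    rw [this, f₃.arr 10 rfl, f₂.arr 10 rfl, hl, f₃.arr 5 rfl]
    push_cast
    rw [Int.toNat_of_nonneg (p₂.nonneg _)]

end Ram

/-! ### Encodings -/

theorem ofFn_eq_map_range {α : Type*} (n : ℕ) (g : ℕ → α) :
    (List.ofFn fun i : Fin n => g i) = (List.range n).map g :=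
  List.ext_getElem (by simp) (by simp)

theorem flatten_ofFn_eq_map {α : Type*} {k m : ℕ} (f : Fin k → Fin m → α) (g : ℕ → α)
    (h : ∀ (s : Fin k) (j : Fin m), g (s * m + j) = f s j) :
    (List.ofFn fun s => List.ofFn (f s)).flatten = (List.range (k * m)).map g := by
  rw [← ofFn_eq_map_range, List.ofFn_mul]
  simp only [h]

theorem length_flatten_ofFn {α : Type*} {k m : ℕ} (f : Fin k → Fin m → α) :
    (List.ofFn fun s => List.ofFn (f s)).flatten.length = k * m := by
  simp [List.length_flatten, List.map_ofFn, Function.comp_def]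

theorem getD_flatten_ofFn {α : Type*} {k m : ℕ} (f : Fin k → Fin m → α) (s : Fin k) (j : Fin m)
    (d : α) : (List.ofFn fun s => List.ofFn (f s)).flatten.getD (s * m + j) d = f s j := by
  have hs := s.2
  have hj := j.2
  have hlt : (s : ℕ) * m + j < k * m := by nlinarith
  have e₁ : ∀ (s : Fin k) (j : Fin m), ((s : ℕ) * m + j) / m = s := fun s j => by
    rw [mul_comm, Nat.mul_add_div j.pos, Nat.div_eq_of_lt j.2, add_zero]
  have e₂ : ∀ (s : Fin k) (j : Fin m), ((s : ℕ) * m + j) % m = j := fun s j => by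
    rw [mul_comm, Nat.mul_add_mod, Nat.mod_eq_of_lt j.2]
  rw [flatten_ofFn_eq_map f
    (fun t => if h : t / m < k ∧ t % m < m then f ⟨t / m, h.1⟩ ⟨t % m, h.2⟩ else d)]
  · simp [List.getD_eq_getElem?_getD, hlt, e₁, e₂]
  · intro s j
    simp [e₁, e₂]

namespace Ram

theorem len_getD_le (l : List ℤ) (i : ℕ) : len (l.getD i 0) ≤ inputSize l := by
  rcases lt_or_ge i l.length with h | h
  · rw [List.getD_eq_getElem _ _ h]
    have := List.single_le_sum (l := l.map fun z => len z + 1) (fun _ _ => Nat.zero_le _)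
      (len l[i] + 1) (List.mem_map.2 ⟨_, List.getElem_mem h, rfl⟩)
    exact (Nat.le_succ _).trans this
  · rw [List.getD_eq_default _ _ h]
    exact Nat.zero_le _

theorem length_le_inputSize (l : List ℤ) : l.length ≤ inputSize l := by
  have := List.length_le_sum_of_one_le (l.map fun z => len z + 1) (by simp)
  rwa [List.length_map] at this

theorem bits_initState (l : List ℤ) : (initState l).Bits (inputSize l) := by
  refine ⟨fun x => ?_, fun a i => ?_⟩ <;> simp only [initState] <;> split_ifs
  · rw [len_le_iff]
    exact lt_of_le_of_lt (by simpa using length_le_inputSize l) Nat.lt_two_pow_self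
  · exact Nat.zero_le _
  · exact len_getD_le l _
  · exact Nat.zero_le _

end Ram

/-! ### Positions and sizes in the encoding of an instance -/

namespace LoadInstance

variable (I : LoadInstance)

/-- The six numbers that encode an arc. -/
def arcCode (a : Fin I.m) : Fin 6 → ℤ :=
  ![((I.net.tail a).val : ℤ), ((I.net.head a).val : ℤ), if a ∈ I.net.fixed then 1 else 0,
    (I.net.cap a : ℤ), (I.net.cost a : ℤ), (I.loadOf a : ℤ)]

theorem encode_eq : I.encode = [(I.n : ℤ), (I.m : ℤ), (I.k : ℤ)] ++
    ((List.ofFn fun a => List.ofFn (I.arcCode a)).flatten ++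
      (List.ofFn fun s : Fin I.k => List.ofFn fun v : Fin I.n => I.net.bal s v).flatten) := by
  rw [encode, List.append_assoc]
  congr 4
  funext a
  simp only [arcCode, loadOf, List.ofFn_succ, List.ofFn_zero]
  by_cases ha : a ∈ I.net.fixed <;> simp [ha]

theorem length_encode : I.encode.length = 3 + (I.m * 6 + I.k * I.n) := by
  rw [encode_eq, List.length_append, List.length_append, length_flatten_ofFn, length_flatten_ofFn]
  rfl

theorem getD_encode_arc (a : Fin I.m) (j : Fin 6) :
    I.encode.getD (3 + (a * 6 + j)) 0 = I.arcCode a j := by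
  rw [encode_eq, List.getD_append_right _ _ _ _ (by simp)]
  simp only [List.length_cons, List.length_nil, zero_add, Nat.reduceAdd, Nat.add_sub_cancel_left]
  rw [List.getD_append, getD_flatten_ofFn]
  rw [length_flatten_ofFn]
  omega

theorem getD_encode_bal (s : Fin I.k) (v : Fin I.n) :
    I.encode.getD (3 + (I.m * 6 + (s * I.n + v))) 0 = I.net.bal s v := by
  rw [encode_eq, List.getD_append_right _ _ _ _ (by simp)]
  simp only [List.length_cons, List.length_nil, zero_add, Nat.reduceAdd, Nat.add_sub_cancel_left]
  rw [List.getD_append_right _ _ _ _ (by rw [length_flatten_ofFn]; omega), length_flatten_ofFn,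
    Nat.add_sub_cancel_left]
  exact getD_flatten_ofFn (fun s v => I.net.bal s v) s v 0

theorem inputOf_encode : I.InputOf ((Ram.initState I.encode).arr 0) := by
  have h : ∀ i : ℕ, (Ram.initState I.encode).arr 0 i = I.encode.getD i 0 := fun i => by
    simp [Ram.initState]
  have ha : ∀ (a : Fin I.m) (j : Fin 6), (Ram.initState I.encode).arr 0 (6 * ((a : ℕ) + 1) +
      ((j : ℕ) - 3)) = I.arcCode a j := fun a j => by
    rw [← getD_encode_arc, ← h]
    congr 1
    push_cast
    ring
  refine ⟨?_, ?_, ?_, fun i => ha i 0, fun i => ha i 1, fun i => ha i 2, fun i => ?_,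
    fun i => ha i 4, fun i => ha i 5, fun s v => ?_⟩
  · exact (h 0).trans (by rw [encode_eq]; rfl)
  · exact (h 1).trans (by rw [encode_eq]; rfl)
  · exact (h 2).trans (by rw [encode_eq]; rfl)
  · exact (congrArg _ (by simp)).trans (ha i 3)
  · rw [← getD_encode_bal, ← h]
    congr 1
    push_cast
    ring

/-- The balances contribute `k * n` numbers to the input. With at least one vertex this bounds `k`,
which otherwise enters only through its logarithm. The factor `2` accommodates `2 * (n + m) + 1`. -/
theorem sizeLe_encode (hn : I.n ≠ 0) : I.SizeLe (2 * Ram.inputSize I.encode) := by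
  have hl := Ram.length_le_inputSize I.encode
  rw [length_encode] at hl
  have hk := I.k_pos
  have h₁ : I.n ≤ I.k * I.n := Nat.le_mul_of_pos_left _ hk
  have h₂ : I.k ≤ I.k * I.n := Nat.le_mul_of_pos_right _ (Nat.pos_of_ne_zero hn)
  have hb : ∀ i : ℤ, ((Ram.initState I.encode).arr 0 i).natAbs <
      2 ^ (2 * Ram.inputSize I.encode) := fun i =>
    (Ram.len_le_iff.1 ((Ram.bits_initState I.encode).2 0 i)).trans_le
      (Nat.pow_le_pow_right (by norm_num) (by omega))
  have hI := I.inputOf_encode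
  refine ⟨by omega, by omega, fun i => ?_, fun i => ?_, fun s v => ?_⟩
  · have := hb (6 * ((i : ℕ) + 1))
    rwa [hI.cap, Int.natAbs_natCast] at this
  · have := hb (6 * ((i : ℕ) + 1) + 2)
    rwa [hI.load, Int.natAbs_natCast] at this
  · have := hb (3 + 6 * I.m + (s : ℕ) * I.n + (v : ℕ))
    rwa [hI.bal] at this

end LoadInstance

/-! ### The algorithm -/

namespace Ram

/-- Solve all scenarios. -/
def solveAll : Program :=
  .assign 2 (.get 0 (.const 0)) ;; .assign 3 (.get 0 (.const 1)) ;;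
  .assign 4 (.get 0 (.const 2)) ;; .assign 5 (.var 2 + .var 3) ;;
  .assign 7 (.const 3 + ((.var 3 + .var 3 + .var 3) + (.var 3 + .var 3 + .var 3))) ;;
  .assign 8 (.const 1) ;; .assign 9 (.const 1) ;;
  .forTo 6 (.const 0) (.var 4) solveScenario

/-- Compute an optimal robust flow with the prescribed load. If there are no vertices, the number
of scenarios is not bounded by the size of the input, but nothing has to be computed. -/
def robustFlowProgram : Program :=
  .ite (.get 0 (.const 0))
    (solveAll ;;
      .ite (.var 9) (.store 1 (.const 0) (.const 1) ;; .assign 1 (.var 8))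
        (.store 1 (.const 0) (.const 0) ;; .assign 1 (.const 1)))
    (.store 1 (.const 0) (.const 1) ;; .assign 1 (.const 1))

theorem solveAll_spec (I : LoadInstance) {N : ℕ} {σ : State} (hinp : I.InputOf (σ.arr 0))
    (h5 : ∀ x, 0 ≤ σ.arr 5 x) (hN : I.SizeLe N) :
    Wp solveAll σ (N * (scenarioTime N + 1)) fun τ => τ.var 8 = 1 + I.k * I.m ∧
      (τ.var 9 = 0 → ¬((∀ a, I.load a ≤ I.net.cap a) ∧ ∀ s, ∃ f, (I.closed s).IsFlow f)) ∧
      (τ.var 9 ≠ 0 → (∀ a, I.load a ≤ I.net.cap a) ∧ ∃ f : Fin I.k → Fin I.m → ℕ,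
        ∀ s, (I.closed s).IsMinCostFlow (f s) ∧
          ∀ i : Fin I.m, τ.arr 1 (1 + (s : ℕ) * I.m + (i : ℕ)) = (I.loadOf i + f s i : ℕ)) := by
  refine Wp.seq₀ (Wp.assign (Wp.seq₀ (Wp.assign (Wp.seq₀ (Wp.assign (Wp.seq₀ (Wp.assign
    (Wp.seq₀ (Wp.assign (Wp.seq₀ (Wp.assign (Wp.seq₀ (Wp.assign ?_)))))))))))))
  have hk := hN.scenarios
  -- The loads are compared with the capacities only while a scenario is processed, hence the guard
  -- `0 < i`; it disappears at the end because `k` is positive.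
  refine Wp.forTo (L := 0) (H := I.k) (J := fun i τ => Ready I i.toNat τ ∧
    τ.var 8 = 1 + i * I.m ∧
      (τ.var 9 = 0 → ¬((∀ a, I.load a ≤ I.net.cap a) ∧ ∀ s, ∃ f, (I.closed s).IsFlow f)) ∧
      (τ.var 9 ≠ 0 → (0 < i → ∀ a, I.load a ≤ I.net.cap a) ∧ ∃ f : Fin I.k → Fin I.m → ℕ,
        ∀ s : Fin I.k, ((s : ℕ) : ℤ) < i → (I.closed s).IsMinCostFlow (f s) ∧
          ∀ j : Fin I.m, τ.arr 1 (1 + (s : ℕ) * I.m + (j : ℕ)) = (I.loadOf j + f s j : ℕ)))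
    rfl rfl (by omega) (by omega) ?_ ?_ ?_ ?_
  · intro τ hf
    have := hf.var 4 rfl
    simpa [hinp.k] using this
  · refine ⟨⟨?_, ?_, ?_, ?_, ?_, hinp, h5⟩, ?_, ?_, ?_⟩
    · simp [hinp.n]
    · simp [hinp.m]
    · simp [hinp.k]
    · simp [hinp.n, hinp.m]
    · simp [hinp.m]
      ring
    · simp
    · simp
    · exact fun _ => ⟨fun h => absurd h (lt_irrefl _), fun _ _ => 0, fun s hs => by omega⟩
  · rintro i τ hf h₁ h₂ h₃ ⟨i₁, i₂, i₃, i₄⟩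
    obtain ⟨s, rfl⟩ : ∃ s : Fin I.k, i = ((s : ℕ) : ℤ) := ⟨⟨i.toNat, by omega⟩, by simp [h₁]⟩
    refine (solveScenario_spec s i₁ hN).mono le_rfl fun υ fυ ⟨p₁, p₂, p₃, p₄, p₅⟩ => ?_
    refine ⟨⟨?_, ?_, ?_, ?_, ?_, ?_, ?_⟩, ?_, ?_, ?_⟩ <;>
      simp only [State.setVar_var, State.setVar_arr, Nat.reduceEqDiff, if_false]
    · exact p₁.n
    · exact p₁.m
    · exact p₁.k
    · exact p₁.arcs
    · rw [p₁.pos]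
      congr 2
    · exact p₁.inp
    · exact p₁.res
    · rw [p₂, i₂]
      ring
    · intro h₉ hP
      by_cases hτ : τ.var 9 = 0
      · exact i₃ hτ hP
      · exact p₄.2 ⟨hτ, hP.1, hP.2 s⟩ h₉
    · intro h₉
      obtain ⟨hτ, hl, -⟩ := p₄.1 h₉
      obtain ⟨f, hf⟩ := (i₄ hτ).2
      obtain ⟨g, hg, hg'⟩ := p₅ h₉
      refine ⟨fun _ => hl, Function.update f s g, fun t ht => ?_⟩
      rcases eq_or_ne t s with rfl | hts
      · rw [Function.update_self]
        refine ⟨hg, fun j => ?_⟩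
        rw [← hg', i₂]
      · have hlt : (t : ℕ) < s := by
          have : (t : ℕ) ≠ s := fun h => hts (Fin.ext h)
          omega
        rw [Function.update_of_ne hts]
        obtain ⟨q₁, q₂⟩ := hf t (by omega)
        refine ⟨q₁, fun j => ?_⟩
        -- Earlier scenarios were written to positions below the current one and are preserved.
        rw [← q₂, p₃]
        rw [i₂]
        have : ((t : ℕ) * I.m + j : ℕ) < (s : ℕ) * I.m := by
          have := j.2
          nlinarith
        zify at this
        omega
  · rintro τ hf - ⟨i₁, i₂, i₃, i₄⟩
    refine ⟨i₂, i₃, fun h₉ => ?_⟩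
    obtain ⟨hl, f, hf⟩ := i₄ h₉
    exact ⟨hl (by exact_mod_cast I.k_pos), f, fun s => hf s (by omega)⟩

/-- In `State.output` the list of indices is itself cast to a list of integers, which unfolds to a
`flatMap`. -/
theorem State.output_eq (σ : State) :
    σ.output = (List.range (σ.var 1).toNat).map fun i : ℕ => σ.arr 1 (i : ℤ) := by
  rw [State.output]
  change List.map _ (List.flatMap _ _) = _
  rw [List.map_flatMap]
  exact List.flatMap_pure_eq_map _ _

theorem output_setArr_zero {σ : State} {l z : ℕ} {y : ℤ} {g : ℕ → ℤ}
    (hl : l = z + 1) (hg : ∀ i < z, σ.arr 1 (1 + i) = g i) :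
    ((σ.setArr 1 0 y).setVar 1 l).output = y :: (List.range z).map g := by
  subst hl
  simp only [State.output_eq, State.setVar_var, if_true, Int.toNat_natCast, State.setVar_arr,
    State.setArr_arr, List.range_succ_eq_map, List.map_cons, List.map_map]
  congr 1
  refine List.map_congr_left fun i hi => ?_
  rw [← hg i (List.mem_range.1 hi)]
  simp only [Function.comp_apply, Nat.cast_succ]
  rw [Function.update_of_ne (by omega), add_comm]

theorem robustFlowProgram_spec (I : LoadInstance) :
    Wp robustFlowProgram (initState I.encode)
      (2 * inputSize I.encode * (scenarioTime (2 * inputSize I.encode) + 1))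
      fun τ => I.IsAnswer τ.output := by
  have hinp := I.inputOf_encode
  have : Nonempty (Fin I.k) := ⟨⟨0, I.k_pos⟩⟩
  refine Wp.ite (fun hn => ?_) fun hn => Wp.seq₀ (Wp.store (Wp.assign ?_))
  · have hn' : I.n ≠ 0 := by simpa [hinp.n] using hn
    rw [← Nat.add_zero (2 * inputSize I.encode * _)]
    refine Wp.seq ((solveAll_spec I hinp (fun x => by simp [initState])
      (I.sizeLe_encode hn')).mono le_rfl fun τ _ ⟨h₁, h₂, h₃⟩ => ?_)
    refine Wp.ite (fun h₉ => Wp.seq₀ (Wp.store (Wp.assign ?_)))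
      fun h₉ => Wp.seq₀ (Wp.store (Wp.assign ?_))
    · obtain ⟨hl, f, hf⟩ := h₃ h₉
      refine .inl ⟨_, I.net.isOptimalWithLoad_extend I.load hl
        fun s => RobustNetwork.IsMinCostFlow.of_closed I.net I.load (hf s).1, ?_⟩
      have hm : τ.var 8 = ((I.k * I.m + 1 : ℕ) : ℤ) := by
        rw [h₁]
        push_cast
        ring
      simp only [Expr.eval_const, Expr.eval_var, State.setArr_var, hm]
      rw [output_setArr_zero rfl (g := fun i => τ.arr 1 (1 + i)) fun _ _ => rfl, encodeFlow,
        flatten_ofFn_eq_map _ (fun i : ℕ => τ.arr 1 (1 + i))]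
      intro s j
      push_cast
      rw [← add_assoc, (hf s).2]
      -- On each arc one summand of load plus computed flow vanishes: the flow on fixed arcs, the
      -- load on free arcs.
      have h0 := ((I.net.isFlow_closed_iff I.load).1 (hf s).1.1).1
      by_cases hj : j ∈ I.net.fixed
      · simp [LoadInstance.loadOf, RobustNetwork.extend, hj, h0 j hj]
      · simp [LoadInstance.loadOf, RobustNetwork.extend, hj]
    · refine .inr ⟨?_, ?_⟩
      · rw [I.net.exists_isRobustFlowWithLoad_iff I.load]
        rintro ⟨hl, hf⟩
        refine h₂ h₉ ⟨hl, fun s => ?_⟩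
        obtain ⟨g, hg⟩ := hf s
        obtain ⟨f, hf, -⟩ := I.net.exists_isFlow_closed I.load hg
        exact ⟨f, hf⟩
      · exact output_setArr_zero (l := 1) (z := 0) (g := 0) rfl (by simp)
  -- Without vertices there are no arcs, so the empty flow is optimal and its encoding is empty for
  -- every number of scenarios.
  · have hn' : I.n = 0 := by simpa [hinp.n] using hn
    have : IsEmpty (Fin I.n) := by rw [hn']; infer_instance
    have hA : IsEmpty (Fin I.m) := ⟨fun a => isEmptyElim (I.net.tail a)⟩
    have hm : I.m = 0 := by
      by_contra h
      exact hA.false ⟨0, Nat.pos_of_ne_zero h⟩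
    refine .inl ⟨fun _ _ => 0, ⟨⟨⟨fun s => ⟨isEmptyElim, isEmptyElim⟩, isEmptyElim⟩,
      fun s a => isEmptyElim (a : Fin I.m)⟩, fun g _ => ?_⟩, ?_⟩
    · simp [RobustNetwork.robustCost, FlowInstance.flowCost]
    · rw [encodeFlow, flatten_ofFn_eq_map _ 0 fun s j => isEmptyElim j, hm, mul_zero]
      exact output_setArr_zero (l := 1) (z := 0) rfl (by simp)

theorem mulFree_robustFlowProgram : robustFlowProgram.mulFree = true := by
  rfl

/-- `W` bounds program size times (iterations + 1) as a polynomial in the input size. The time bound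
of `Run.exec`, with the input size as initial bit length, is then `W * (2 * (X + W) + 1)`. -/
theorem solvableInPolyTime_robustFlow :
    SolvableInPolyTime LoadInstance.encode LoadInstance.IsAnswer := by
  let N : Polynomial ℕ := 2 * .X
  let S : Polynomial ℕ := (N + (N + (N + (N + (N + (3 * N + (N + N))))))) +
    (3 * N * (N + N * (N + (N * (N + N + 1) + N) + 1) + 1) + (N + (N + 0)))
  let W : Polynomial ℕ := .C robustFlowProgram.size * (N * (S + 1) + 1)
  have hW : ∀ x, W.eval x =
      robustFlowProgram.size * (2 * x * (scenarioTime (2 * x) + 1) + 1) := by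
    intro x
    simp [W, S, N, scenarioTime]
  refine ⟨robustFlowProgram, W * (2 * (.X + W) + 1), fun I => ?_⟩
  obtain ⟨τ, k, h₁, h₂, h₃⟩ := robustFlowProgram_spec I
  obtain ⟨-, t, h₄, h₅⟩ := h₁.exec mulFree_robustFlowProgram (bits_initState I.encode)
  refine ⟨τ, t, h₄, h₅.trans ?_, h₃⟩
  have h₆ : robustFlowProgram.size * (k + 1) ≤ W.eval (inputSize I.encode) := by
    rw [hW]
    exact Nat.mul_le_mul_left _ (Nat.succ_le_succ h₂)
  simp only [Polynomial.eval_mul, Polynomial.eval_add, Polynomial.eval_X, Polynomial.eval_ofNat,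
    Polynomial.eval_one]
  gcongr

end Ram

theorem mainTheorem7 :
    Ram.SolvableInPolyTime LoadInstance.encode LoadInstance.IsAnswer ∧
    ∀ I : LoadInstance,
      ((∃ f, I.net.IsRobustFlowWithLoad I.load f) ↔
        (∀ a, I.load a ≤ I.net.cap a) ∧ ∀ s, ∃ g, (I.net.reduced I.load s).IsFlow g) ∧
      ((∀ a, I.load a ≤ I.net.cap a) →
        ∀ g, (∀ s, (I.net.reduced I.load s).IsMinCostFlow (g s)) →
          I.net.IsOptimalWithLoad I.load (I.net.extend I.load g)) := by
  refine ⟨Ram.solvableInPolyTime_robustFlow, fun I => ⟨?_, fun hl g hg => ?_⟩⟩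
  · have : Nonempty (Fin I.k) := ⟨⟨0, I.k_pos⟩⟩
    exact I.net.exists_isRobustFlowWithLoad_iff I.load
  · exact I.net.isOptimalWithLoad_extend I.load hl hg
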